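/- Let $Q$ be the canonically oriented Euclidean quiver $\widetilde{\mathbb D}_6$, with vertices $1,\dots,7$ and arrows $3\to1$, $3\to2$, $4\to3$, $5\to4$, $6\to5$, $7\to5$. A representation $M$ of $Q$ over a field $k$ consists of finite dimensional $k$-spaces $M_i$ and linear maps $M_{i\to j}:M_i\to M_j$; $\ell(M)=\sum_i\dim M_i$. It is *exceptional* if it is indecomposable and $\operatorname{Ext}^1(M,M)=0$. It is a *tree module* if it is indecomposable and in some basis all matrices of the maps have entries in $\{0,1\}$ and there are exactly $\ell(M)-1$ nonzero entries in total. The *coefficient quiver* in a given basis has the basis elements as vertices and one arrow for each nonzero matrix entry. A family of $0$–$1$ matrices (one for each arrow, of sizes given by a dimension vector) has the *field independent tree property* if over every field $k$ the representation with formally these matrices is an exceptional indecomposable tree module, and in its canonical basis it has $\ell(M)-1$ nonzero entries and its coefficient quiver is a tree. Consider the following list of $0$–$1$ matrix representations. Rows and columns are numbered from $0$; $[P]$ is $1$ if $P$ holds and $0$ otherwise; $n\ge 0$ is an integer. The matrices of $5\to4$ and $4\to3$ always have entry $[r=c]$ in row $r$ and column $c$. The entries in row $r$ and column $c$ of the other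 four matrices $M_{31},M_{32},M_{65},M_{75}$ (of $3\to1$, $3\to2$, $6\to5$, $7\to5$) and the dimension vectors $(d_1,\dots,d_7)$ are as follows. * $A_e^{(n)}$, $0\le e\le3$: $(n+1,\,n,\,2n+[e\ge1],\,2n+[e\ge2],\,2n+[e\ge3],\,n,\,n)$; $M_{31}=[r=c=0\text{ or }c=2r-1]$, $M_{32}=[c\in\{2r+1,2r+2\}]$, $M_{65}=[r=2c+1]$, $M_{75}=[r\in\{2c,2c+1\}]$. * $B_e^{(n)}$, $0\le e\le3$: $(n+1,\,n+1,\,2n+1+[e\ge1],\,2n+1+[e\ge2],\,2n+1+[e\ge3],\,n+1,\,n)$; $M_{31}=[c=2r]$, $M_{32}=[c\in\{2r,2r+1\}]$, $M_{65}=[r=2c]$, $M_{75}=[r\in\{2c+1,2c+2\}]$. * $C_{e,e'}^{(n)}$, $0\le e'<e\le3$: $(n+1,\,n+1,\,2n+t_1,\,2n+t_2,\,2n+t_3,\,n,\,n)$ with $t_q=[e\ge q]+[e'\ge q]$. Put $\lambda(0)=2n$, $\lambda(r)=2r-1$ for $r\ge1$, $\rho(n)=2n+1$ and $\rho(r)=2r$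 for $r\ne n$. Then $M_{31}=[c=\lambda(r)]$ if $n\le 2r$ and $M_{31}=[c=\rho(r)]$ if $n>2r$; $M_{32}=[c\in\{\lambda(r),\rho(r)\}]$; $M_{65}=[r=2c+1]$ if $n\le2c+1$ and $M_{65}=[r=2c]$ if $n>2c+1$; $M_{75}=[r\in\{2c,2c+1\}]$. * the representations obtained from $A_e^{(n)}$ by exchanging the roles of the vertices $1$ and $2$, and from $B_e^{(n)}$ by exchanging those of $6$ and $7$; * the transposes of all the representations above: all matrices are transposed, and the vertices are renamed by $1\leftrightarrow6$, $2\leftrightarrow7$, $3\leftrightarrow5$, $4\leftrightarrow4$; * sixteen single representations: the six with dimension $1$ on an interval $\{a,\dots,b\}$, $3\le a\le b\le5$, and $0$ elsewhere, and the four with dimension $1$ at $3,4,5$, at one of $1,2$ and at one of $6,7$, and $0$ elsewhere (all matrices between nonzero spaces being $(1)$); and, for the six triples $(x,y,z)\in\{0,1\}^3$ such that $y=1$ implies $x\ne z$, the one with dimension vector $(1,1,1+x,1+y,1+z,1,1)$, $M_{31}=[c=0]$, $M_{65}=[r=0]$ and all entries of $M_{32}$ and $M_{75}$ equal to $1$.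 Then every representation in this list has the field independent tree property, and the list is complete: for every field $k$, every exceptional representation of $Q$ over $k$ is isomorphic, over $k$, to exactly one of the representations in the list. -/

import Mathlib

/-! ## Representations of quivers -/

universe u v v' w

/-- A finite dimensional representation of the quiver `Q` over the field `k`. -/
structure QuiverRep (k : Type u) [Field k] (Q : Type w) [Quiver.{0} Q] where
  space : Q → Type v
  [addCommGroup : ∀ i, AddCommGroup (space i)]
  [module : ∀ i, Module k (space i)]
  [finite : ∀ i, Module.Finite k (space i)]
  map : ∀ {i j : Q}, (i ⟶ j) → space i →ₗ[k] space j

attribute [instance] QuiverRep.addCommGroup QuiverRep.module QuiverRep.finite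

namespace QuiverRep

/-- A family of linear maps is a morphism of representations. -/
def IsMorphism {k : Type u} [Field k] {Q : Type w} [Quiver.{0} Q]
    {M N : QuiverRep.{u, v, w} k Q}
    (f : ∀ i, M.space i →ₗ[k] N.space i) : Prop :=
  ∀ {i j : Q} (α : i ⟶ j), N.map α ∘ₗ f i = f j ∘ₗ M.map α

/-- Isomorphism of representations (the spaces may live in different universes). -/
def IsIsomorphic {k : Type u} [Field k] {Q : Type w} [Quiver.{0} Q]
    (M : QuiverRep.{u, v, w} k Q) (N : QuiverRep.{u, v', w} k Q) : Prop :=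
  ∃ e : ∀ i, M.space i ≃ₗ[k] N.space i,
    ∀ {i j : Q} (α : i ⟶ j) (x : M.space i), N.map α (e i x) = e j (M.map α x)

/-- `M` is indecomposable: it is nonzero, and whenever it is the direct sum of two
subrepresentations `U` and `W`, one of them is zero. -/
def IsIndecomposable {k : Type u} [Field k] {Q : Type w} [Quiver.{0} Q]
    (M : QuiverRep.{u, v, w} k Q) : Prop :=
  (∃ i, Nontrivial (M.space i)) ∧
  ∀ U W : ∀ i, Submodule k (M.space i),
    (∀ {i j : Q} (α : i ⟶ j), U i ≤ (U j).comap (M.map α)) →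
    (∀ {i j : Q} (α : i ⟶ j), W i ≤ (W j).comap (M.map α)) →
    (∀ i, IsCompl (U i) (W i)) →
    (∀ i, U i = ⊥) ∨ (∀ i, W i = ⊥)

/-- `0 → Y → Z → X → 0` is a short exact sequence of representations, with maps `f` and `g`. -/
def IsShortExact {k : Type u} [Field k] {Q : Type w} [Quiver.{0} Q]
    {Y Z X : QuiverRep.{u, v, w} k Q}
    (f : ∀ i, Y.space i →ₗ[k] Z.space i) (g : ∀ i, Z.space i →ₗ[k] X.space i) : Prop :=
  IsMorphism f ∧ IsMorphism g ∧
  ∀ i, Function.Injective (f i) ∧ Function.Exact (f i) (g i) ∧ Function.Surjective (g i)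

/-- `M` has no self-extensions, `Ext¹(M, M) = 0`: every short exact sequence
`0 → M → E → M → 0` splits. -/
def HasNoSelfExtensions {k : Type u} [Field k] {Q : Type w} [Quiver.{0} Q]
    (M : QuiverRep.{u, v, w} k Q) : Prop :=
  ∀ (E : QuiverRep.{u, v, w} k Q)
    (f : ∀ i, M.space i →ₗ[k] E.space i) (g : ∀ i, E.space i →ₗ[k] M.space i),
    IsShortExact f g →
    ∃ s : ∀ i, M.space i →ₗ[k] E.space i, IsMorphism s ∧ ∀ i, g i ∘ₗ s i = LinearMap.id

/-- Exceptional modules: the indecomposables without self-extensions. -/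
def IsExceptional {k : Type u} [Field k] {Q : Type w} [Quiver.{0} Q]
    (M : QuiverRep.{u, v, w} k Q) : Prop :=
  M.IsIndecomposable ∧ M.HasNoSelfExtensions

/-- The length `ℓ(M) = ∑ i, dim M_i`. -/
noncomputable def length {k : Type u} [Field k] {Q : Type w} [Quiver.{0} Q] [Fintype Q]
    (M : QuiverRep.{u, v, w} k Q) : ℕ :=
  ∑ i, Module.finrank k (M.space i)

/-- The entry in row `y` and column `x` of the matrix of `M.map α` in the basis `B`. -/
noncomputable def coeff {k : Type u} [Field k] {Q : Type w} [Quiver.{0} Q]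
    (M : QuiverRep.{u, v, w} k Q) {ι : Q → Type} (B : ∀ i, Module.Basis (ι i) k (M.space i))
    {i j : Q} (α : i ⟶ j) (y : ι j) (x : ι i) : k :=
  (B j).repr (M.map α (B i x)) y

/-- In the basis `B` all the matrices of `M` consist of zeros and ones only, and the total number
of nonzero entries is `ℓ(M) - 1`. -/
def IsTreeBasis {k : Type u} [Field k] {Q : Type w} [Quiver.{0} Q] [Fintype Q]
    (M : QuiverRep.{u, v, w} k Q) {ι : Q → Type}
    (B : ∀ i, Module.Basis (ι i) k (M.space i)) : Prop :=
  (∀ {i j : Q} (α : i ⟶ j) (y : ι j) (x : ι i), M.coeff B α y x = 0 ∨ M.coeff B α y x = 1) ∧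
  Set.encard {p : Σ (i j : Q) (_ : i ⟶ j), ι j × ι i |
    M.coeff B p.2.2.1 p.2.2.2.1 p.2.2.2.2 ≠ 0} + 1 = (M.length : ℕ∞)

/-- Tree modules. -/
def IsTreeModule {k : Type u} [Field k] {Q : Type w} [Quiver.{0} Q] [Fintype Q]
    (M : QuiverRep.{u, v, w} k Q) : Prop :=
  M.IsIndecomposable ∧
  ∃ B : ∀ i, Module.Basis (Fin (Module.finrank k (M.space i))) k (M.space i), M.IsTreeBasis B

/-- The underlying graph of the coefficient quiver of `M` with respect to the basis `B`: the
vertices are the basis elements, and `x` in `M_i` is joined to `y` in `M_j` if the matrix of some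
arrow `i ⟶ j` has a nonzero entry at `(y, x)`. (It is used below for a quiver without loops and
without multiple arrows, so that no edge is lost or identified with another one.) -/
def coefficientGraph {k : Type u} [Field k] {Q : Type w} [Quiver.{0} Q]
    (M : QuiverRep.{u, v, w} k Q) {ι : Q → Type}
    (B : ∀ i, Module.Basis (ι i) k (M.space i)) : SimpleGraph (Σ i, ι i) :=
  SimpleGraph.fromRel fun x y => ∃ α : x.1 ⟶ y.1, M.coeff B α y.2 x.2 ≠ 0

end QuiverRep

/-! ## Formal matrix representations -/

/-- A dimension vector together with an integer matrix of the right size for each arrow. -/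
structure MatrixRep (Q : Type w) [Quiver.{0} Q] where
  dim : Q → ℕ
  mat : ∀ {i j : Q}, (i ⟶ j) → Matrix (Fin (dim j)) (Fin (dim i)) ℤ

namespace MatrixRep

/-- The representation over the field `k` with formally the same matrices. -/
def overField {Q : Type w} [Quiver.{0} Q] (F : MatrixRep Q) (k : Type u) [Field k] :
    QuiverRep.{u, u, w} k Q where
  space i := Fin (F.dim i) → k
  map α := Matrix.toLin' ((F.mat α).map (fun z : ℤ => (z : k)))

/-- The field independent tree property: all the entries are `0` or `1`, and over every field the
representation with formally these matrices is an exceptional indecomposable and a tree module;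
moreover its coefficient quiver with respect to the canonical basis is a tree. -/
def HasFieldIndependentTreeProperty {Q : Type w} [Quiver.{0} Q] [Fintype Q]
    (F : MatrixRep Q) : Prop :=
  (∀ {i j : Q} (α : i ⟶ j) (r : Fin (F.dim j)) (c : Fin (F.dim i)),
    F.mat α r c = 0 ∨ F.mat α r c = 1) ∧
  ∀ (k : Type u) [Field k],
    (F.overField k).IsExceptional ∧
    (F.overField k).IsTreeModule ∧
    (F.overField k).IsTreeBasis (fun i => Pi.basisFun k (Fin (F.dim i))) ∧
    ((F.overField k).coefficientGraph (fun i => Pi.basisFun k (Fin (F.dim i)))).IsTree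

end MatrixRep

/-! ## The canonically oriented quiver `D̃₆`

```
    1               6
     ↖             ↙
       3 ← 4 ← 5
     ↙             ↖
    2               7
```
-/

namespace D6

inductive Vertex : Type
  | v1 | v2 | v3 | v4 | v5 | v6 | v7
  deriving DecidableEq

instance : Fintype Vertex where
  elems := {.v1, .v2, .v3, .v4, .v5, .v6, .v7}
  complete x := by cases x <;> decide

inductive Arrow : Vertex → Vertex → Type
  | a31 : Arrow .v3 .v1
  | a32 : Arrow .v3 .v2
  | a43 : Arrow .v4 .v3
  | a54 : Arrow .v5 .v4
  | a65 : Arrow .v6 .v5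
  | a75 : Arrow .v7 .v5

instance : Quiver.{0} Vertex where
  Hom := Arrow

/-- Data for a matrix representation in which the maps `5 → 4` and `4 → 3` have the matrices with
ones at the places `(i, i)` and zeros elsewhere. `m31 r c` is the entry of the matrix of `3 → 1`
in row `r` and column `c`, and so on; rows and columns are counted from `0`, and only the values
with `r` and `c` in range are used. -/
structure Pattern where
  (d1 d2 d3 d4 d5 d6 d7 : ℕ)
  (m31 m32 m65 m75 : ℕ → ℕ → ℤ)

namespace Pattern

def toMatrixRep (P : Pattern) : MatrixRep Vertex where
  dim
    | .v1 => P.d1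
    | .v2 => P.d2
    | .v3 => P.d3
    | .v4 => P.d4
    | .v5 => P.d5
    | .v6 => P.d6
    | .v7 => P.d7
  mat := fun {i j} (α : Arrow i j) => match i, j, α with
    | _, _, .a31 => Matrix.of fun r c => P.m31 r c
    | _, _, .a32 => Matrix.of fun r c => P.m32 r c
    | _, _, .a43 => Matrix.of fun r c => if (r : ℕ) = c then 1 else 0
    | _, _, .a54 => Matrix.of fun r c => if (r : ℕ) = c then 1 else 0
    | _, _, .a65 => Matrix.of fun r c => P.m65 r c
    | _, _, .a75 => Matrix.of fun r c => P.m75 r c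

/-- Exchange the roles of the vertices `1` and `2`. -/
def swap12 (P : Pattern) : Pattern :=
  { P with d1 := P.d2, d2 := P.d1, m31 := P.m32, m32 := P.m31 }

/-- Exchange the roles of the vertices `6` and `7`. -/
def swap67 (P : Pattern) : Pattern :=
  { P with d6 := P.d7, d7 := P.d6, m65 := P.m75, m75 := P.m65 }

/-- Transpose all the matrices, along the identification of the opposite quiver with the quiver
itself that exchanges `1 ↔ 6`, `2 ↔ 7`, `3 ↔ 5` and fixes `4`. -/
def transpose (P : Pattern) : Pattern where
  d1 := P.d6
  d2 := P.d7
  d3 := P.d5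
  d4 := P.d4
  d5 := P.d3
  d6 := P.d1
  d7 := P.d2
  m31 r c := P.m65 c r
  m32 r c := P.m75 c r
  m65 r c := P.m31 c r
  m75 r c := P.m32 c r

end Pattern

/-- Dimension vector `(n+1, n, 2n+[e≥1], 2n+[e≥2], 2n+[e≥3], n, n)`. -/
def patternA (e : Fin 4) (n : ℕ) : Pattern where
  d1 := n + 1
  d2 := n
  d3 := 2 * n + if 1 ≤ (e : ℕ) then 1 else 0
  d4 := 2 * n + if 2 ≤ (e : ℕ) then 1 else 0
  d5 := 2 * n + if 3 ≤ (e : ℕ) then 1 else 0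
  d6 := n
  d7 := n
  m31 r c := if (r = 0 ∧ c = 0) ∨ c + 1 = 2 * r then 1 else 0
  m32 r c := if c = 2 * r + 1 ∨ c = 2 * r + 2 then 1 else 0
  m65 r c := if r = 2 * c + 1 then 1 else 0
  m75 r c := if r = 2 * c ∨ r = 2 * c + 1 then 1 else 0

/-- Dimension vector `(n+1, n+1, 2n+1+[e≥1], 2n+1+[e≥2], 2n+1+[e≥3], n+1, n)`. -/
def patternB (e : Fin 4) (n : ℕ) : Pattern where
  d1 := n + 1
  d2 := n + 1
  d3 := 2 * n + 1 + if 1 ≤ (e : ℕ) then 1 else 0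
  d4 := 2 * n + 1 + if 2 ≤ (e : ℕ) then 1 else 0
  d5 := 2 * n + 1 + if 3 ≤ (e : ℕ) then 1 else 0
  d6 := n + 1
  d7 := n
  m31 r c := if c = 2 * r then 1 else 0
  m32 r c := if c = 2 * r ∨ c = 2 * r + 1 then 1 else 0
  m65 r c := if r = 2 * c then 1 else 0
  m75 r c := if r = 2 * c + 1 ∨ r = 2 * c + 2 then 1 else 0

/-- The column `λ(r)` of `patternC`. -/
def leftIndex (n r : ℕ) : ℕ := if r = 0 then 2 * n else 2 * r - 1

/-- The column `ρ(r)` of `patternC`. -/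
def rightIndex (n r : ℕ) : ℕ := if r = n then 2 * n + 1 else 2 * r

/-- Dimension vector `(n+1, n+1, 2n+t₁, 2n+t₂, 2n+t₃, n, n)` with `t_q = [e≥q] + [e'≥q]`. -/
def patternC (e e' : Fin 4) (n : ℕ) : Pattern where
  d1 := n + 1
  d2 := n + 1
  d3 := 2 * n + (if 1 ≤ (e : ℕ) then 1 else 0) + (if 1 ≤ (e' : ℕ) then 1 else 0)
  d4 := 2 * n + (if 2 ≤ (e : ℕ) then 1 else 0) + (if 2 ≤ (e' : ℕ) then 1 else 0)
  d5 := 2 * n + (if 3 ≤ (e : ℕ) then 1 else 0) + (if 3 ≤ (e' : ℕ) then 1 else 0)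
  d6 := n
  d7 := n
  m31 r c := if c = (if n ≤ 2 * r then leftIndex n r else rightIndex n r) then 1 else 0
  m32 r c := if c = leftIndex n r ∨ c = rightIndex n r then 1 else 0
  m65 r c := if r = (if n ≤ 2 * c + 1 then 2 * c + 1 else 2 * c) then 1 else 0
  m75 r c := if r = 2 * c ∨ r = 2 * c + 1 then 1 else 0

/-- Dimension one at the vertices `3 + t` with `a ≤ t ≤ b`, and zero elsewhere. -/
def patternI (a b : Fin 3) : Pattern where
  d1 := 0
  d2 := 0
  d3 := if a ≤ 0 ∧ 0 ≤ b then 1 else 0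
  d4 := if a ≤ 1 ∧ 1 ≤ b then 1 else 0
  d5 := if a ≤ 2 ∧ 2 ≤ b then 1 else 0
  d6 := 0
  d7 := 0
  m31 _ _ := 1
  m32 _ _ := 1
  m65 _ _ := 1
  m75 _ _ := 1

/-- Dimension vector `(1, 0, 1, 1, 1, 1, 0)`, all maps between nonzero spaces being the identity. -/
def patternT : Pattern where
  d1 := 1
  d2 := 0
  d3 := 1
  d4 := 1
  d5 := 1
  d6 := 1
  d7 := 0
  m31 _ _ := 1
  m32 _ _ := 1
  m65 _ _ := 1
  m75 _ _ := 1

/-- Dimension vector `(1, 1, 1+x, 1+y, 1+z, 1, 1)`. -/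
def patternW (x y z : Bool) : Pattern where
  d1 := 1
  d2 := 1
  d3 := 1 + x.toNat
  d4 := 1 + y.toNat
  d5 := 1 + z.toNat
  d6 := 1
  d7 := 1
  m31 _ c := if c = 0 then 1 else 0
  m32 _ _ := 1
  m65 r _ := if r = 0 then 1 else 0
  m75 _ _ := 1

/-- The 22 families of preprojective modules; by transposition they also give the 22 families of
preinjective modules. -/
inductive Family : Type
  | a (e : Fin 4) (swap : Bool)
  | b (e : Fin 4) (swap : Bool)
  | c (e e' : Fin 4) (h : e' < e)

def Family.pattern (n : ℕ) : Family → Pattern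
  | .a e false => patternA e n
  | .a e true => (patternA e n).swap12
  | .b e false => patternB e n
  | .b e true => (patternB e n).swap67
  | .c e e' _ => patternC e e' n

/-- The 16 exceptional regular modules. -/
inductive Regular : Type
  | i (a b : Fin 3) (h : a ≤ b)
  | t (swap12 swap67 : Bool)
  | w (x y z : Bool) (h : y = true → x ≠ z)

def Regular.pattern : Regular → Pattern
  | .i a b _ => patternI a b
  | .t false false => patternT
  | .t true false => patternT.swap12
  | .t false true => patternT.swap67
  | .t true true => patternT.swap12.swap67
  | .w x y z _ => patternW x y z

/-- The labels of the representations in the list. -/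
inductive Label : Type
  | preprojective (f : Family) (n : ℕ)
  | preinjective (f : Family) (n : ℕ)
  | regular (r : Regular)

/-- The complete list of tree representations for the canonically oriented quiver `D̃₆`. -/
def treeList : Label → MatrixRep Vertex
  | .preprojective f n => (f.pattern n).toMatrixRep
  | .preinjective f n => (f.pattern n).transpose.toMatrixRep
  | .regular r => r.pattern.toMatrixRep

end D6

-- For representations X and Y, the differential `coboundary X Y` has kernel Hom(X, Y) and cokernel
-- Ext¹(X, Y). Hence dim Hom - dim Ext¹ is the Euler form ⟨dim X, dim Y⟩, and the whole argument is
-- finite dimensional linear algebra over an arbitrary field.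
--
-- The listed modules have the tree property because each is a brick whose dimension vector d
-- satisfies ⟨d, d⟩ = 1, which leaves no room for Ext¹. In the preprojective families the
-- coefficient quiver arranges the basis at vertex 3 along a path. An endomorphism is determined by
-- its matrix at vertex 3; the maps that link two basis vectors carry matrix entries along
-- diagonals, and the ends of the path kill the entries off the main diagonal. Transposition gives
-- the preinjective families. A brick is indecomposable, so its coefficient quiver is connected, and
-- ℓ(M) - 1 edges make it a tree.
--
-- For completeness let M be exceptional. By the lemma of Happel and Ringel, End M is a division
-- algebra of some dimension e. All M_i are modules over it, so e² divides both parts of the Euler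
-- form, whose difference is e; hence e = 1 and ⟨dim M, dim M⟩ = 1. Four times the quadratic form is
-- a sum of squares of coordinates modulo the radical vector δ, so a finite enumeration shows that
-- dim M is the dimension vector of a listed N, or dim N + mδ with N regular and m > 0.
--
-- Both cases use one recognition lemma. A rigid M is generic in its dimension vector
-- (`ExtVanish.of_finrank_eq`), so Ext¹(N, M) = 0 as soon as Ext¹(N, N ⊕ R) = 0 for some R with dim
-- M = dim N + dim R. The Euler form gives nonzero maps M → N and N → M, and Happel-Ringel turns the
-- first one into an isomorphism. For listed dimension vectors R = 0. In the other case R consists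
-- of m copies of the sum of the two quasi-simples of a tube of rank two not containing N; then M ≅
-- N contradicts m > 0. Uniqueness holds because the dimension vectors in the list are distinct.

universe v''

/-! ## Cochains of representations -/

namespace QuiverRep

section Cochains

variable {k : Type u} [Field k] {Q : Type w} [Quiver.{0} Q]

/-- Families of linear maps, one for each vertex. -/
abbrev VertexMaps (X : QuiverRep.{u, v, w} k Q) (Y : QuiverRep.{u, v', w} k Q) :=
  ∀ i, X.space i →ₗ[k] Y.space i

/-- Families of linear maps, one for each arrow. -/
abbrev ArrowMaps (X : QuiverRep.{u, v, w} k Q) (Y : QuiverRep.{u, v', w} k Q) :=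
  ∀ i j, (i ⟶ j) → X.space i →ₗ[k] Y.space j

/-- The differential whose kernel is `Hom(X, Y)` and whose cokernel is `Ext¹(X, Y)`. -/
def coboundary (X : QuiverRep.{u, v, w} k Q) (Y : QuiverRep.{u, v', w} k Q) :
    VertexMaps X Y →ₗ[k] ArrowMaps X Y where
  toFun h i j α := Y.map α ∘ₗ h i - h j ∘ₗ X.map α
  map_add' f g := by
    funext i j α
    simp only [Pi.add_apply, LinearMap.comp_add, LinearMap.add_comp]
    abel
  map_smul' a f := by
    funext i j α
    simp only [Pi.smul_apply, LinearMap.comp_smul, LinearMap.smul_comp, RingHom.id_apply, smul_sub]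

theorem coboundary_apply {X : QuiverRep.{u, v, w} k Q} {Y : QuiverRep.{u, v', w} k Q}
    (h : VertexMaps X Y) {i j : Q} (α : i ⟶ j) :
    coboundary X Y h i j α = Y.map α ∘ₗ h i - h j ∘ₗ X.map α := rfl

/-- `Ext¹(X, Y) = 0`. -/
def ExtVanish (X : QuiverRep.{u, v, w} k Q) (Y : QuiverRep.{u, v', w} k Q) : Prop :=
  Function.Surjective (coboundary X Y)

/-- The families of linear maps that are homomorphisms (with the spaces in any universes). -/
def IsHom {X : QuiverRep.{u, v, w} k Q} {Y : QuiverRep.{u, v', w} k Q} (f : VertexMaps X Y) :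
    Prop :=
  coboundary X Y f = 0

theorem isHom_iff {X : QuiverRep.{u, v, w} k Q} {Y : QuiverRep.{u, v', w} k Q}
    {f : VertexMaps X Y} :
    IsHom f ↔ ∀ {i j : Q} (α : i ⟶ j), Y.map α ∘ₗ f i = f j ∘ₗ X.map α := by
  constructor
  · intro h i j α
    exact sub_eq_zero.1 (congrFun (congrFun (congrFun h i) j) α)
  · intro h
    funext i j α
    exact sub_eq_zero.2 (h α)

theorem IsHom.map_apply {X : QuiverRep.{u, v, w} k Q} {Y : QuiverRep.{u, v', w} k Q}
    {f : VertexMaps X Y} (hf : IsHom f) {i j : Q} (α : i ⟶ j) (x : X.space i) :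
    Y.map α (f i x) = f j (X.map α x) :=
  LinearMap.congr_fun (isHom_iff.1 hf α) x

theorem IsHom.comp {X : QuiverRep.{u, v, w} k Q} {Y : QuiverRep.{u, v', w} k Q}
    {Z : QuiverRep.{u, v'', w} k Q} {g : VertexMaps Y Z} {f : VertexMaps X Y}
    (hg : IsHom g) (hf : IsHom f) : IsHom (X := X) (Y := Z) fun i => g i ∘ₗ f i :=
  isHom_iff.2 fun α => by
    ext x
    simp [hg.map_apply, hf.map_apply]

/-- A family of maps on the arrows is the same thing as an extension structure on M ⊕ M, and it is a
coboundary exactly when the extension splits. This replaces exact sequences by surjectivity of one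
linear map. -/
theorem hasNoSelfExtensions_iff_extVanish (M : QuiverRep.{u, v, w} k Q) :
    M.HasNoSelfExtensions ↔ ExtVanish M M := by
  constructor
  · intro H c
    -- The extension with upper triangular maps whose off-diagonal entry is `c`; minus the first
    -- component of a splitting is a preimage of `c`.
    let E : QuiverRep.{u, v, w} k Q :=
      { space := fun i => M.space i × M.space i
        map := fun {i j} α =>
          LinearMap.prod (M.map α ∘ₗ LinearMap.fst k _ _ + c i j α ∘ₗ LinearMap.snd k _ _)
            (M.map α ∘ₗ LinearMap.snd k _ _) }
    obtain ⟨s, hs, hgs⟩ := H E (fun i => LinearMap.inl k _ _) (fun i => LinearMap.snd k _ _) (by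
      refine ⟨fun α => ?_, fun α => ?_, fun i => ⟨LinearMap.inl_injective, ?_, ?_⟩⟩
      · ext x <;> simp [E]
      · ext x <;> simp [E]
      · exact LinearMap.exact_iff.2 (LinearMap.range_inl k _ _).symm
      · exact LinearMap.snd_surjective)
    refine ⟨fun i => - (LinearMap.fst k _ _ ∘ₗ s i), ?_⟩
    funext i j α
    ext x
    have h1 := congrArg Prod.fst (LinearMap.congr_fun (hs α) x)
    have h2 : (s i x).2 = x := LinearMap.congr_fun (hgs i) x
    have h3 : M.map α (s i x).1 + c i j α (s i x).2 = (s j (M.map α x)).1 := h1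
    rw [h2] at h3
    simp only [coboundary_apply, LinearMap.sub_apply, LinearMap.comp_apply, LinearMap.neg_apply,
      LinearMap.fst_apply, map_neg]
    rw [← h3]
    abel
  · rintro H E f g ⟨hf, hg, hex⟩
    choose σ hσ using fun i => LinearMap.exists_rightInverse_of_surjective (g i)
      (LinearMap.range_eq_top.2 (hex i).2.2)
    choose ρ hρ using fun i => LinearMap.exists_leftInverse_of_injective (f i)
      (LinearMap.ker_eq_bot.2 (hex i).1)
    have key : ∀ {i j : Q} (α : i ⟶ j) (x : M.space i),
        f j (ρ j (E.map α (σ i x) - σ j (M.map α x))) = E.map α (σ i x) - σ j (M.map α x) := by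
      intro i j α x
      have h0 : g j (E.map α (σ i x) - σ j (M.map α x)) = 0 := by
        have h1 := LinearMap.congr_fun (hg α) (σ i x)
        have h2 := LinearMap.congr_fun (hσ i) x
        have h3 := LinearMap.congr_fun (hσ j) (M.map α x)
        simp only [LinearMap.comp_apply, LinearMap.id_apply] at h1 h2 h3
        rw [map_sub, ← h1, h2, h3, sub_self]
      obtain ⟨y, hy⟩ := ((hex j).2.1 _).1 h0
      have h4 := LinearMap.congr_fun (hρ j) y
      simp only [LinearMap.comp_apply, LinearMap.id_apply] at h4
      rw [← hy, h4]
    -- The failure of the linear sections `σ` to commute with the arrows takes values in the image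
    -- of `f`, hence is a family of maps M → M. Writing it as a coboundary corrects `σ` to a
    -- morphism.
    obtain ⟨h, hh⟩ := H fun i j α => ρ j ∘ₗ (E.map α ∘ₗ σ i - σ j ∘ₗ M.map α)
    refine ⟨fun i => σ i - f i ∘ₗ h i, ?_, fun i => ?_⟩
    · intro i j α
      ext x
      have h1 := LinearMap.congr_fun (congrFun (congrFun (congrFun hh i) j) α) x
      have h2 := key α x
      have h3 := LinearMap.congr_fun (hf α) (h i x)
      simp only [coboundary_apply, LinearMap.sub_apply, LinearMap.comp_apply] at h1 h3 ⊢
      rw [← h1, map_sub, ← h3] at h2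
      rw [map_sub, sub_eq_sub_iff_sub_eq_sub, ← h2]
    · ext x
      have h1 := LinearMap.congr_fun (hσ i) x
      simp only [LinearMap.comp_apply, LinearMap.id_apply, LinearMap.sub_apply, map_sub] at h1 ⊢
      rw [h1, (hex i).2.1.apply_apply_eq_zero, sub_zero]

/-! ## Fitting's lemma and the lemma of Happel and Ringel -/

theorem IsHom.pow_map {X : QuiverRep.{u, v, w} k Q} {f : VertexMaps X X} (hf : IsHom f)
    (n : ℕ) {i j : Q} (α : i ⟶ j) (x : X.space i) :
    X.map α ((f i ^ n) x) = (f j ^ n) (X.map α x) := by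
  induction n with
  | zero => rfl
  | succ n ih => rw [pow_succ', pow_succ', Module.End.mul_apply, Module.End.mul_apply,
      hf.map_apply, ih]

/-- Fitting's lemma: the stable kernels and the stable ranges of the `f i` are complementary
subrepresentations, so one of the two families is zero. -/
theorem IsIndecomposable.bijective_or_nilpotent {X : QuiverRep.{u, v, w} k Q}
    (hX : X.IsIndecomposable) {f : VertexMaps X X} (hf : IsHom f) :
    (∀ i, Function.Bijective (f i)) ∨ ∀ i, IsNilpotent (f i) := by
  rcases hX.2 (fun i => ⨆ n, LinearMap.ker (f i ^ n)) (fun i => ⨅ n, LinearMap.range (f i ^ n))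
    (fun {i j} α => iSup_le fun n x hx => Submodule.mem_comap.2
      (Submodule.mem_iSup_of_mem n (by
        rw [LinearMap.mem_ker] at hx ⊢
        rw [← hf.pow_map, hx, map_zero])))
    (fun {i j} α x hx => Submodule.mem_comap.2 ((Submodule.mem_iInf _).2 fun n => by
      obtain ⟨y, rfl⟩ := (Submodule.mem_iInf _).1 hx n
      exact ⟨X.map α y, (hf.pow_map n α y).symm⟩))
    (fun i => LinearMap.isCompl_iSup_ker_pow_iInf_range_pow (f i)) with h | h
  · left
    intro i
    have hinj : Function.Injective (f i) := by
      rw [← LinearMap.ker_eq_bot, eq_bot_iff, ← h i]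
      exact le_iSup_of_le 1 (by rw [pow_one])
    exact ⟨hinj, LinearMap.injective_iff_surjective.1 hinj⟩
  · right
    intro i
    obtain ⟨n, hn⟩ := Filter.eventually_atTop.1
      (LinearMap.eventually_iInf_range_pow_eq (f i))
    refine ⟨n, LinearMap.range_eq_bot.1 ?_⟩
    rw [← hn n le_rfl, h i]

theorem exists_generalized_inverse {V W : Type*} [AddCommGroup V] [AddCommGroup W] [Module k V]
    [Module k W] (f : V →ₗ[k] W) : ∃ s : W →ₗ[k] V, ∀ x, f (s (f x)) = f x := by
  obtain ⟨g, hg⟩ := LinearMap.exists_rightInverse_of_surjective f.rangeRestrict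
    f.range_rangeRestrict
  obtain ⟨p, hp⟩ := LinearMap.exists_leftInverse_of_injective (LinearMap.range f).subtype
    (Submodule.ker_subtype _)
  refine ⟨g ∘ₗ p, fun x => ?_⟩
  have h1 : p (f x) = f.rangeRestrict x := LinearMap.congr_fun hp (f.rangeRestrict x)
  have h2 : f (g (f.rangeRestrict x)) = f x :=
    congrArg Subtype.val (LinearMap.congr_fun hg (f.rangeRestrict x))
  rw [LinearMap.comp_apply, h1, h2]

/-- The lemma of Happel and Ringel. -/
theorem injective_or_surjective_of_extVanish {X : QuiverRep.{u, v, w} k Q}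
    {Y : QuiverRep.{u, v', w} k Q} (hX : X.IsIndecomposable) (hY : Y.IsIndecomposable)
    (hYX : ExtVanish Y X) {f : VertexMaps X Y} (hf : IsHom f) (hne : ∃ i, f i ≠ 0) :
    (∀ i, Function.Injective (f i)) ∨ ∀ i, Function.Surjective (f i) := by
  choose s hs using fun i => exists_generalized_inverse (f i)
  -- The cocycle vanishes on the image of `f`, so `h ∘ f` is an endomorphism of X; and `f ∘ (s + h)`
  -- is an endomorphism of Y, the correction `h` repairing the non-naturality of `f ∘ s`.
  -- Bijectivity of the former makes `f` injective, of the latter surjective.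
  obtain ⟨h, hh⟩ := hYX fun i j α => s j ∘ₗ Y.map α ∘ₗ (LinearMap.id - f i ∘ₗ s i)
  have hc : ∀ {i j : Q} (α : i ⟶ j) (y : Y.space i),
      X.map α (h i y) - h j (Y.map α y) = s j (Y.map α (y - f i (s i y))) := fun {i j} α y =>
    LinearMap.congr_fun (congrFun (congrFun (congrFun hh i) j) α) y
  have hu : IsHom (X := X) (Y := X) fun i => h i ∘ₗ f i := isHom_iff.2 fun {i j} α => by
    ext x
    have h1 := hc α (f i x)
    rw [hs, sub_self, map_zero, map_zero, sub_eq_zero, hf.map_apply] at h1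
    exact h1
  have he : IsHom (X := Y) (Y := Y) fun i => f i ∘ₗ (s i + h i) := isHom_iff.2 fun {i j} α => by
    ext y
    have h1 := congrArg (f j) (hc α y)
    rw [map_sub, ← hf.map_apply, map_sub, map_sub, map_sub, hf.map_apply α (s i y), hs,
      ← hf.map_apply] at h1
    simp only [LinearMap.comp_apply, LinearMap.add_apply, map_add]
    rw [sub_eq_sub_iff_add_eq_add] at h1
    rw [add_comm, h1]
  rcases hX.bijective_or_nilpotent hu with h1 | h1
  · left
    intro i
    exact Function.Injective.of_comp (f := h i) (h1 i).1
  · right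
    have hv : ∀ i, IsUnit (1 + h i ∘ₗ f i) := fun i => (h1 i).isUnit_one_add
    rcases hY.bijective_or_nilpotent he with h2 | h2
    · intro i
      exact Function.Surjective.of_comp (g := s i + h i) (h2 i).2
    · exfalso
      obtain ⟨i, hi⟩ := hne
      obtain ⟨n, hn⟩ := h2 i
      -- If both endomorphisms are nilpotent, then `f ∘ s ∘ f = f` gives e ∘ f = f ∘ (1 + h ∘ f) for
      -- e = f ∘ (s + h). A high power of e is zero while 1 + h ∘ f is invertible, which forces `f i
      -- = 0`.
      have hef : ∀ m : ℕ, ((f i ∘ₗ (s i + h i)) ^ m) ∘ₗ f i = f i ∘ₗ (1 + h i ∘ₗ f i) ^ m := by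
        intro m
        induction m with
        | zero => rfl
        | succ m ih =>
          rw [pow_succ', Module.End.mul_eq_comp, LinearMap.comp_assoc, ih, pow_succ',
            Module.End.mul_eq_comp]
          ext x
          simp only [LinearMap.comp_apply, LinearMap.add_apply, map_add, hs, Module.End.one_apply]
      have h3 := hef n
      rw [hn, LinearMap.zero_comp] at h3
      obtain ⟨t, ht⟩ := ((hv i).pow n).exists_right_inv
      apply hi
      have h4 : f i = (f i ∘ₗ (1 + h i ∘ₗ f i) ^ n) ∘ₗ t := by
        rw [LinearMap.comp_assoc, ← Module.End.mul_eq_comp, ht]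
        rfl
      rw [h4, ← h3, LinearMap.zero_comp]

/-! ## Generic vanishing of extensions -/

/-- If `M` has no self-extensions, then it is generic among the representations of its dimension
vector: `Ext¹(N, Y) = 0` for one of them implies `Ext¹(N, M) = 0`. -/
theorem ExtVanish.of_finrank_eq [Finite Q] [∀ i j : Q, Finite (i ⟶ j)]
    {M : QuiverRep.{u, v, w} k Q} {Y : QuiverRep.{u, v', w} k Q} {N : QuiverRep.{u, v'', w} k Q}
    (hM : ExtVanish M M) (hNY : ExtVanish N Y)
    (hdim : ∀ i, Module.finrank k (M.space i) = Module.finrank k (Y.space i)) :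
    ExtVanish N M := by
  have e : ∀ i, M.space i ≃ₗ[k] Y.space i := fun i => LinearEquiv.ofFinrankEq _ _ (hdim i)
  -- Consider the line of representations M + tΔ on the spaces of M: it is M at t = 0 and a copy of
  -- Y at t = 1. The differential from N along this line is `coboundary N M + t S1`, which is
  -- surjective at t = 1.
  let Δ : ArrowMaps M M := fun i j α =>
    (e j).symm.toLinearMap ∘ₗ Y.map α ∘ₗ (e i).toLinearMap - M.map α
  let S1 : VertexMaps N M →ₗ[k] ArrowMaps N M :=
    { toFun := fun g i j α => Δ i j α ∘ₗ g i
      map_add' := fun f g => by funext i j α; exact LinearMap.comp_add _ _ _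
      map_smul' := fun a f => by funext i j α; exact LinearMap.comp_smul _ _ _ }
  have hS : Function.Surjective (coboundary N M + S1) := by
    intro c
    obtain ⟨h, hh⟩ := hNY fun i j α => (e j).toLinearMap ∘ₗ c i j α
    refine ⟨fun i => (e i).symm.toLinearMap ∘ₗ h i, ?_⟩
    funext i j α
    ext x
    have h1 := congrArg (e j).symm
      (LinearMap.congr_fun (congrFun (congrFun (congrFun hh i) j) α) x)
    simp only [coboundary_apply, LinearMap.sub_apply, LinearMap.comp_apply, LinearEquiv.coe_coe,
      LinearEquiv.symm_apply_apply, map_sub] at h1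
    simp [S1, Δ, coboundary_apply, ← h1]
  obtain ⟨R, hR⟩ := LinearMap.exists_rightInverse_of_surjective _ (LinearMap.range_eq_top.2 hS)
  set D : Module.End k (ArrowMaps N M) := coboundary N M ∘ₗ R with hD
  have hD1 : S1 ∘ₗ R = 1 - D := by
    -- With `R` a right inverse at t = 1, the differential along the line composed with `R` is D +
    -- t(1 - D).
    rw [LinearMap.add_comp] at hR
    rw [eq_sub_iff_add_eq, add_comm]
    exact hR
  by_contra hcon
  have hlt : LinearMap.range (coboundary N M) < ⊤ :=
    lt_top_iff_ne_top.2 fun h => hcon (LinearMap.range_eq_top.1 h)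
  obtain ⟨φ, hφ0, hφ⟩ := Submodule.exists_le_ker_of_lt_top _ hlt
  have hφ' : ∀ g, φ (coboundary N M g) = 0 := fun g => hφ ⟨g, rfl⟩
  -- The coefficients of a formal isomorphism ψ = ∑ ψ_l t^l from M + tΔ to M with ψ_0 = id. They
  -- exist by recursion since M has no self-extensions.
  let ψ : ℕ → VertexMaps M M := fun l => Nat.rec (fun _ => LinearMap.id)
    (fun _ p => Function.surjInv hM fun i j α => p j ∘ₗ Δ i j α) l
  have hψ : ∀ l, coboundary M M (ψ (l + 1)) = fun i j α => ψ l j ∘ₗ Δ i j α := fun l =>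
    Function.surjInv_eq hM _
  let P : ℕ → ArrowMaps N M →ₗ[k] ArrowMaps N M := fun l =>
    { toFun := fun c i j α => ψ l j ∘ₗ c i j α
      map_add' := fun f g => by funext i j α; exact LinearMap.comp_add _ _ _
      map_smul' := fun a f => by funext i j α; exact LinearMap.comp_smul _ _ _ }
  let U : ℕ → ArrowMaps N M →ₗ[k] k := fun l => φ ∘ₗ P l
  have hU0 : U 0 ∘ₗ D = 0 := by
    ext c
    exact hφ' (R c)
  -- The functional φ vanishes on coboundaries into M; pulled back along ψ, it is a power series ∑
  -- U_l t^l of functionals vanishing on the image of `coboundary N M + t S1`. This is the vanishing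
  -- of its coefficients.
  have hrec : ∀ l g, U (l + 1) (coboundary N M g) + U l (S1 g) = 0 := by
    intro l g
    have h1 : P (l + 1) (coboundary N M g) + P l (S1 g)
        = coboundary N M fun i => ψ (l + 1) i ∘ₗ g i := by
      funext i j α
      ext x
      have h2 := LinearMap.congr_fun
        (congrFun (congrFun (congrFun (hψ l) i) j) α) (g i x)
      simp only [coboundary_apply, LinearMap.sub_apply, LinearMap.comp_apply] at h2
      simp only [P, S1, LinearMap.coe_mk, AddHom.coe_mk, Pi.add_apply, coboundary_apply,
        LinearMap.add_apply, LinearMap.comp_apply, LinearMap.sub_apply, map_sub, ← h2]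
      abel
    have h3 := hφ' fun i => ψ (l + 1) i ∘ₗ g i
    rw [← h1, map_add] at h3
    exact h3
  have hU : ∀ l, U l = U l ∘ₗ D - U (l + 1) ∘ₗ D := by
    intro l
    ext c
    have h1 := hrec l (R c)
    have h2 : S1 (R c) = c - D c := LinearMap.congr_fun hD1 c
    rw [h2, map_sub] at h1
    simp only [LinearMap.sub_apply, LinearMap.comp_apply]
    rw [eq_sub_iff_add_eq, add_comm, ← sub_eq_zero, ← h1]
    simp only [hD, LinearMap.comp_apply]
    abel
  -- Iterating U_l = (U_l - U_{l+1}) ∘ D shows that every U_l factors through every power of D.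
  have hpow : ∀ m l, ∃ t : ArrowMaps N M →ₗ[k] k, U l = t ∘ₗ (D ^ m) := by
    intro m
    induction m with
    | zero => exact fun l => ⟨U l, rfl⟩
    | succ m ih =>
      intro l
      obtain ⟨t1, h1⟩ := ih l
      obtain ⟨t2, h2⟩ := ih (l + 1)
      refine ⟨t1 - t2, ?_⟩
      rw [hU l, h1, h2, pow_succ, LinearMap.sub_comp]
      rfl
  apply hφ0
  -- Fitting decomposition of D: φ = U_0 kills the nilpotent part because it factors through a high
  -- power of D, and kills the range of D because this consists of coboundaries. So φ = 0, a
  -- contradiction.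
  have hcompl := LinearMap.isCompl_iSup_ker_pow_iInf_range_pow D
  obtain ⟨n, hn⟩ := Filter.eventually_atTop.1 (LinearMap.eventually_iSup_ker_pow_eq D)
  ext c
  have hc : c ∈ (⨆ n, LinearMap.ker (D ^ n)) ⊔ ⨅ n, LinearMap.range (D ^ n) := by
    rw [hcompl.sup_eq_top]
    trivial
  obtain ⟨a, ha, b, hb, rfl⟩ := Submodule.mem_sup.1 hc
  rw [hn n le_rfl] at ha
  obtain ⟨b', rfl⟩ := (Submodule.mem_iInf _).1 hb 1
  obtain ⟨t, ht⟩ := hpow n 0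
  have hφU : φ = U 0 := rfl
  have hb0 : φ ((D ^ 1) b') = 0 := by
    rw [pow_one]
    exact hφ' (R b')
  have ha0 : φ a = 0 := by
    rw [hφU, ht, LinearMap.comp_apply, LinearMap.mem_ker.1 ha, map_zero]
  rw [map_add, ha0, hb0, add_zero, LinearMap.zero_apply]

end Cochains

section Bricks

variable {k : Type u} [Field k] {Q : Type w} [Quiver.{0} Q]

/-! ## Bricks and the Euler form -/

/-- A brick: a nonzero representation all of whose endomorphisms are scalars. -/
def IsBrick (X : QuiverRep.{u, v, w} k Q) : Prop :=
  (∃ i, Nontrivial (X.space i)) ∧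
    ∀ f : VertexMaps X X, IsHom f → ∃ a : k, ∀ i, f i = a • LinearMap.id

/-- The projection onto a direct summand is an endomorphism, hence a scalar, and it is the identity
on one summand and zero on the other. -/
theorem IsBrick.isIndecomposable {X : QuiverRep.{u, v, w} k Q} (hX : X.IsBrick) :
    X.IsIndecomposable := by
  refine ⟨hX.1, fun U W hU hW hUW => ?_⟩
  obtain ⟨a, ha⟩ := hX.2 (fun i => Submodule.projection _ _ (hUW i)) (isHom_iff.2 fun {i j} α => by
    ext x
    obtain ⟨y, hy, z, hz, rfl⟩ : ∃ y ∈ U i, ∃ z ∈ W i, y + z = x := by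
      rw [← Submodule.mem_sup, (hUW i).sup_eq_top]
      trivial
    have h1 : Submodule.projection _ _ (hUW i) (y + z) = y := by
      rw [map_add, Submodule.projection_apply_of_mem_left _ hy,
        Submodule.projection_apply_of_mem_right _ hz, add_zero]
    have h2 : Submodule.projection _ _ (hUW j) (X.map α y + X.map α z) = X.map α y := by
      rw [map_add, Submodule.projection_apply_of_mem_left (p := U j) _ (hU α hy),
        Submodule.projection_apply_of_mem_right (q := W j) _ (hW α hz), add_zero]
    rw [LinearMap.comp_apply, LinearMap.comp_apply, h1, map_add, h2])
  by_cases h0 : a = 0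
  · left
    intro i
    rw [eq_bot_iff]
    intro x hx
    have h1 := LinearMap.congr_fun (ha i) x
    rw [Submodule.projection_apply_of_mem_left _ hx, h0, zero_smul] at h1
    exact h1
  · right
    intro i
    rw [eq_bot_iff]
    intro x hx
    have h1 := LinearMap.congr_fun (ha i) x
    rw [Submodule.projection_apply_of_mem_right _ hx] at h1
    exact (smul_eq_zero.1 h1.symm).resolve_left h0

/-- The dimension vector. -/
noncomputable def dimVector (X : QuiverRep.{u, v, w} k Q) (i : Q) : ℕ :=
  Module.finrank k (X.space i)

/-- Happel-Ringel with X = Y, where injective and surjective coincide for dimension reasons: the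
endomorphism ring is a division ring. -/
theorem IsIndecomposable.bijective_of_ne_zero {X : QuiverRep.{u, v, w} k Q}
    (hX : X.IsIndecomposable) (hXX : ExtVanish X X) {f : VertexMaps X X} (hf : IsHom f)
    (hne : ∃ i, f i ≠ 0) (i : Q) : Function.Bijective (f i) := by
  rcases injective_or_surjective_of_extVanish hX hX hXX hf hne with h | h
  · exact ⟨h i, LinearMap.injective_iff_surjective.1 (h i)⟩
  · exact ⟨LinearMap.injective_iff_surjective.2 (h i), h i⟩

/-- The direct sum of two representations. -/
def prod (X : QuiverRep.{u, v, w} k Q) (Y : QuiverRep.{u, v', w} k Q) :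
    QuiverRep.{u, max v v', w} k Q where
  space i := X.space i × Y.space i
  map α := (X.map α).prodMap (Y.map α)

theorem dimVector_prod (X : QuiverRep.{u, v, w} k Q) (Y : QuiverRep.{u, v', w} k Q) (i : Q) :
    (X.prod Y).dimVector i = X.dimVector i + Y.dimVector i :=
  Module.finrank_prod

theorem ExtVanish.prod {N : QuiverRep.{u, v, w} k Q} {X : QuiverRep.{u, v', w} k Q}
    {Y : QuiverRep.{u, v'', w} k Q} (hX : ExtVanish N X) (hY : ExtVanish N Y) :
    ExtVanish N (X.prod Y) := by
  intro c
  obtain ⟨f, hf⟩ := hX fun i j α => LinearMap.fst k _ _ ∘ₗ c i j α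
  obtain ⟨g, hg⟩ := hY fun i j α => LinearMap.snd k _ _ ∘ₗ c i j α
  refine ⟨fun i => (f i).prod (g i), ?_⟩
  funext i j α
  refine LinearMap.ext fun x => Prod.ext ?_ ?_
  · exact LinearMap.congr_fun (congrFun (congrFun (congrFun hf i) j) α) x
  · exact LinearMap.congr_fun (congrFun (congrFun (congrFun hg i) j) α) x

theorem IsIsomorphic.dimVector_eq {M : QuiverRep.{u, v, w} k Q} {N : QuiverRep.{u, v', w} k Q}
    (h : M.IsIsomorphic N) : M.dimVector = N.dimVector := by
  obtain ⟨e, -⟩ := h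
  exact funext fun i => (e i).finrank_eq

end Bricks

section Euler

variable {k : Type u} [Field k] {Q : Type w} [Quiver.{0} Q] [Fintype Q]

/-- The contribution of the vertices to the Euler form. -/
def eulerVertex (d e : Q → ℕ) : ℕ := ∑ i, d i * e i

theorem finrank_vertexMaps (X : QuiverRep.{u, v, w} k Q) (Y : QuiverRep.{u, v', w} k Q) :
    Module.finrank k (VertexMaps X Y) = eulerVertex X.dimVector Y.dimVector := by
  rw [Module.finrank_pi_fintype]
  exact Finset.sum_congr rfl fun i _ => Module.finrank_linearMap _ _ _ _

variable [∀ i j : Q, Fintype (i ⟶ j)]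

/-- The contribution of the arrows to the Euler form. -/
def eulerArrow (d e : Q → ℕ) : ℕ := ∑ i, ∑ j, Fintype.card (i ⟶ j) * (d i * e j)

theorem finrank_arrowMaps (X : QuiverRep.{u, v, w} k Q) (Y : QuiverRep.{u, v', w} k Q) :
    Module.finrank k (ArrowMaps X Y) = eulerArrow X.dimVector Y.dimVector := by
  rw [Module.finrank_pi_fintype]
  refine Finset.sum_congr rfl fun i _ => ?_
  rw [Module.finrank_pi_fintype]
  refine Finset.sum_congr rfl fun j _ => ?_
  rw [Module.finrank_pi_fintype, Finset.sum_const, Module.finrank_linearMap]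
  rfl

theorem exists_isHom_ne_zero {X : QuiverRep.{u, v, w} k Q} {Y : QuiverRep.{u, v', w} k Q}
    (h : eulerArrow X.dimVector Y.dimVector < eulerVertex X.dimVector Y.dimVector) :
    ∃ f : VertexMaps X Y, IsHom f ∧ ∃ i, f i ≠ 0 := by
  rw [← finrank_vertexMaps, ← finrank_arrowMaps] at h
  obtain ⟨f, hf, hne⟩ := Submodule.exists_mem_ne_zero_of_ne_bot
    (LinearMap.ker_ne_bot_of_finrank_lt (f := coboundary X Y) h)
  exact ⟨f, hf, Function.ne_iff.1 hne⟩

theorem ExtVanish.finrank_ker {X : QuiverRep.{u, v, w} k Q} {Y : QuiverRep.{u, v', w} k Q}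
    (h : ExtVanish X Y) :
    eulerArrow X.dimVector Y.dimVector + Module.finrank k (LinearMap.ker (coboundary X Y)) =
      eulerVertex X.dimVector Y.dimVector := by
  rw [← finrank_vertexMaps, ← finrank_arrowMaps,
    ← LinearMap.finrank_range_add_finrank_ker (coboundary X Y), LinearMap.range_eq_top.2 h,
    finrank_top]

/-- Here dim Hom(X, X) ≤ 1 = ⟨dim X, dim X⟩, so the rank of the differential is the full dimension
of its target. -/
theorem IsBrick.extVanish {X : QuiverRep.{u, v, w} k Q} (hX : X.IsBrick)
    (hq : eulerVertex X.dimVector X.dimVector = eulerArrow X.dimVector X.dimVector + 1) :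
    ExtVanish X X := by
  have h1 : Module.finrank k (LinearMap.ker (coboundary X X)) ≤ 1 := by
    let one : LinearMap.ker (coboundary X X) := ⟨fun i => LinearMap.id, isHom_iff.2 fun α => rfl⟩
    refine finrank_le_one one fun f => ?_
    obtain ⟨a, ha⟩ := hX.2 f.1 f.2
    exact ⟨a, Subtype.ext (funext fun i => (ha i).symm)⟩
  have h2 := LinearMap.finrank_range_add_finrank_ker (coboundary X X)
  rw [finrank_vertexMaps, hq, ← finrank_arrowMaps] at h2
  have h3 := (LinearMap.range (coboundary X X)).finrank_le
  exact LinearMap.range_eq_top.1 (Submodule.eq_top_of_finrank_eq (by omega))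

/-- The endomorphism ring. -/
def endSubalgebra (X : QuiverRep.{u, v, w} k Q) : Subalgebra k (∀ i, Module.End k (X.space i)) where
  carrier := {f | IsHom (X := X) (Y := X) f}
  mul_mem' := fun {f g} hf hg => IsHom.comp (X := X) (Y := X) (Z := X) hf hg
  add_mem' := fun {f g} hf hg => (LinearMap.ker (coboundary X X)).add_mem hf hg
  algebraMap_mem' := fun a => isHom_iff.2 fun {i j} α => by
    ext x
    exact map_smul (X.map α) a x

theorem IsIndecomposable.euler_of_extVanish {X : QuiverRep.{u, v, w} k Q}
    (hX : X.IsIndecomposable) (hXX : ExtVanish X X) :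
    eulerVertex X.dimVector X.dimVector = eulerArrow X.dimVector X.dimVector + 1 := by
  obtain ⟨i₀, hi₀⟩ := hX.1
  let E := X.endSubalgebra
  have hE : Nontrivial E := ⟨0, 1, fun h => by
    obtain ⟨x, hx⟩ := exists_ne (0 : X.space i₀)
    exact hx (LinearMap.congr_fun (congrFun (congrArg Subtype.val h) i₀) x).symm⟩
  have hunit : ∀ f : E, IsUnit f ∨ f = 0 := by
    intro f
    by_cases h0 : f = 0
    · exact Or.inr h0
    left
    have hne : ∃ i, f.1 i ≠ 0 := Function.ne_iff.1 fun h => h0 (Subtype.ext h)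
    have hb := hX.bijective_of_ne_zero hXX f.2 hne
    let e := fun i => LinearEquiv.ofBijective (f.1 i) (hb i)
    have hfe : ∀ i x, f.1 i ((e i).symm x) = x := fun i x => (e i).apply_symm_apply x
    have hef : ∀ i x, (e i).symm (f.1 i x) = x := fun i x => (e i).symm_apply_apply x
    let g : E := ⟨fun i => (e i).symm.toLinearMap, isHom_iff.2 fun {i j} α => by
      ext x
      apply (hb j).1
      change f.1 j (X.map α ((e i).symm x)) = f.1 j ((e j).symm (X.map α x))
      rw [hfe, ← IsHom.map_apply f.2, hfe]⟩
    exact ⟨⟨f, g, Subtype.ext (funext fun i => LinearMap.ext (hfe i)),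
      Subtype.ext (funext fun i => LinearMap.ext (hef i))⟩, rfl⟩
  -- The endomorphism algebra is a division ring acting on every space, so its dimension divides
  -- every entry of the dimension vector.
  let : DivisionRing E := DivisionRing.ofIsUnitOrEqZero hunit
  let (i : Q) : Module E (X.space i) :=
    Module.compHom (X.space i) ((Pi.evalRingHom (fun i => Module.End k (X.space i)) i).comp
      E.val.toRingHom)
  have (i : Q) : IsScalarTower k E (X.space i) := ⟨fun a f x => rfl⟩
  have hdim : ∀ i, X.dimVector i = Module.finrank k E * Module.finrank E (X.space i) := fun i =>
    (Module.finrank_mul_finrank k E (X.space i)).symm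
  have h1 := hXX.finrank_ker
  have h2 : Module.finrank k (LinearMap.ker (coboundary X X)) = Module.finrank k E := rfl
  rw [h2] at h1
  suffices h : Module.finrank k E = 1 by rw [← h1, h]
  -- With d = dim E, the Euler form of X equals d, while d² divides both its vertex part and its
  -- arrow part. So d² divides d.
  have h3 : Module.finrank k E ∣ 1 := by
    have hpos : 0 < Module.finrank k E := Module.finrank_pos
    set d := Module.finrank k E
    have hA : d * d ∣ eulerArrow X.dimVector X.dimVector :=
      Finset.dvd_sum fun i _ => Finset.dvd_sum fun j _ => by
        rw [hdim, hdim]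
        exact Dvd.dvd.mul_left (mul_dvd_mul (dvd_mul_right _ _) (dvd_mul_right _ _)) _
    have hV : d * d ∣ eulerVertex X.dimVector X.dimVector :=
      Finset.dvd_sum fun i _ => by
        rw [hdim]
        exact mul_dvd_mul (dvd_mul_right _ _) (dvd_mul_right _ _)
    rw [← h1, Nat.dvd_add_right hA] at hV
    exact Nat.dvd_of_mul_dvd_mul_left hpos (by rwa [mul_one])
  exact Nat.dvd_one.1 h3

/-! ## Recognition by dimension vectors -/

/-- If an exceptional representation `M` has the dimension vector of `N ⊕ R`, where `N` is a
rigid indecomposable with `Ext¹(N, R) = 0`, then `M` is isomorphic to `N` as soon as the Euler form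
yields nonzero homomorphisms in both directions. -/
theorem isIsomorphic_of_dimVector_eq {M : QuiverRep.{u, v, w} k Q} {N : QuiverRep.{u, v', w} k Q}
    {R : QuiverRep.{u, v'', w} k Q} (hM : M.IsIndecomposable) (hMM : ExtVanish M M)
    (hN : N.IsIndecomposable) (hNN : ExtVanish N N) (hNR : ExtVanish N R)
    (hdim : ∀ i, M.dimVector i = N.dimVector i + R.dimVector i)
    (hMN : eulerArrow M.dimVector N.dimVector < eulerVertex M.dimVector N.dimVector)
    (hNM : eulerArrow N.dimVector M.dimVector < eulerVertex N.dimVector M.dimVector) :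
    M.IsIsomorphic N := by
  -- Genericity of M, compared with N ⊕ R.
  have hext : ExtVanish N M := hMM.of_finrank_eq (hNN.prod hNR) fun i => by
    have := hdim i
    rw [← dimVector_prod] at this
    exact this
  obtain ⟨g, hg, hg0⟩ := exists_isHom_ne_zero hMN
  obtain ⟨f, hf, i₀, hf0⟩ := exists_isHom_ne_zero hNM
  -- If `g` is injective, then dim M = dim N + dim R leaves no room for R and `g` is bijective; so
  -- it is surjective in either case.
  have hsurj : ∀ i, Function.Surjective (g i) := by
    rcases injective_or_surjective_of_extVanish hM hN hext hg hg0 with h | h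
    · intro i
      have h1 := LinearMap.finrank_le_finrank_of_injective (h i)
      have h2 := hdim i
      have h3 : Module.finrank k (M.space i) = Module.finrank k (N.space i) := by
        simp only [dimVector] at h2
        omega
      exact (LinearMap.injective_iff_surjective_of_finrank_eq_finrank h3).1 (h i)
    · exact h
  -- As `g` is onto and `f ≠ 0`, the endomorphism `f ∘ g` of M is nonzero, hence bijective.
  have hinj : ∀ i, Function.Injective (g i) := fun i => by
    have hb := hM.bijective_of_ne_zero hMM (hf.comp hg) ⟨i₀, fun h => hf0 (by
      ext y
      obtain ⟨x, rfl⟩ := hsurj i₀ y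
      exact LinearMap.congr_fun h x)⟩ i
    exact Function.Injective.of_comp (f := f i) hb.1
  exact ⟨fun i => LinearEquiv.ofBijective (g i) ⟨hinj i, hsurj i⟩,
    fun α x => hg.map_apply α x⟩

end Euler

end QuiverRep

/-! ## Coefficient quivers of indecomposable representations -/

namespace QuiverRep

section CoefficientQuiver

variable {k : Type u} [Field k] {Q : Type w} [Quiver.{0} Q]

/-- The coefficient quiver of an indecomposable representation is connected. -/
theorem IsIndecomposable.connected_coefficientGraph {M : QuiverRep.{u, v, w} k Q}
    (hM : M.IsIndecomposable) {ι : Q → Type} [∀ i, Fintype (ι i)]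
    (B : ∀ i, Module.Basis (ι i) k (M.space i)) : (M.coefficientGraph B).Connected := by
  obtain ⟨i₀, hi₀⟩ := hM.1
  obtain ⟨x₀⟩ : Nonempty (ι i₀) := (B i₀).index_nonempty
  set G := M.coefficientGraph B
  -- The basis vectors in the component of a chosen one, and the remaining ones, span complementary
  -- subrepresentations.
  let C : ∀ i, Set (ι i) := fun i => {x | G.Reachable ⟨i₀, x₀⟩ ⟨i, x⟩}
  have hreach : ∀ {i j : Q} (α : i ⟶ j) (y : ι j) (x : ι i), M.coeff B α y x ≠ 0 →
      G.Reachable ⟨i, x⟩ ⟨j, y⟩ := by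
    intro i j α y x h
    by_cases heq : (⟨i, x⟩ : Σ i, ι i) = ⟨j, y⟩
    · rw [heq]
    · exact SimpleGraph.Adj.reachable ((SimpleGraph.fromRel_adj _ _ _).2 ⟨heq, Or.inl ⟨α, h⟩⟩)
  have hspan : ∀ (D : ∀ i, Set (ι i)), (∀ {i j : Q} (α : i ⟶ j) (y : ι j) (x : ι i),
      M.coeff B α y x ≠ 0 → x ∈ D i → y ∈ D j) → ∀ {i j : Q} (α : i ⟶ j),
      Submodule.span k (B i '' D i) ≤ (Submodule.span k (B j '' D j)).comap (M.map α) := by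
    intro D hD i j α
    rw [Submodule.span_le]
    rintro _ ⟨x, hx, rfl⟩
    change M.map α (B i x) ∈ Submodule.span k (B j '' D j)
    rw [← (B j).sum_repr (M.map α (B i x))]
    refine Submodule.sum_mem _ fun y _ => ?_
    by_cases h : M.coeff B α y x = 0
    · have h' : (B j).repr (M.map α (B i x)) y = 0 := h
      rw [h', zero_smul]
      exact Submodule.zero_mem _
    · exact Submodule.smul_mem _ _ (Submodule.subset_span ⟨y, hD α y x h hx, rfl⟩)
  have hC := hM.2 (fun i => Submodule.span k (B i '' C i)) (fun i => Submodule.span k (B i '' (C i)ᶜ))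
    (hspan C fun α y x h hx => hx.trans (hreach α y x h))
    (hspan (fun i => (C i)ᶜ) fun α y x h hx hy => hx (hy.trans (hreach α y x h).symm))
    (fun i => by
      refine ⟨(B i).linearIndependent.disjoint_span_image disjoint_compl_right, ?_⟩
      rw [codisjoint_iff, ← Submodule.span_union, ← Set.image_union, Set.union_compl_self,
        Set.image_univ, (B i).span_eq])
  have hall : ∀ i x, x ∈ C i := by
    rcases hC with h | h
    · exfalso
      have h1 : B i₀ x₀ ∈ Submodule.span k (B i₀ '' C i₀) :=
        Submodule.subset_span ⟨x₀, SimpleGraph.Reachable.refl _, rfl⟩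
      rw [h, Submodule.mem_bot] at h1
      exact (B i₀).ne_zero x₀ h1
    · intro i x
      by_contra hx
      have h1 : B i x ∈ Submodule.span k (B i '' (C i)ᶜ) := Submodule.subset_span ⟨x, hx, rfl⟩
      rw [h, Submodule.mem_bot] at h1
      exact (B i).ne_zero x h1
  exact { preconnected := fun a b => (hall a.1 a.2).symm.trans (hall b.1 b.2)
          nonempty := ⟨⟨i₀, x₀⟩⟩ }

/-- The coefficient quiver of an indecomposable representation with `ℓ(M) - 1` nonzero
coefficients is a tree. -/
theorem IsIndecomposable.isTree_coefficientGraph [Fintype Q] {M : QuiverRep.{u, v, w} k Q}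
    (hM : M.IsIndecomposable) {ι : Q → Type} [∀ i, Fintype (ι i)]
    {B : ∀ i, Module.Basis (ι i) k (M.space i)} (hB : M.IsTreeBasis B) :
    (M.coefficientGraph B).IsTree := by
  classical
  have hconn := hM.connected_coefficientGraph B
  have hV : Nat.card (Σ i, ι i) = M.length := by
    rw [Nat.card_eq_fintype_card, Fintype.card_sigma]
    exact Finset.sum_congr rfl fun i _ => (Module.finrank_eq_card_basis (B i)).symm
  rw [SimpleGraph.isTree_iff_connected_and_card]
  refine ⟨hconn, le_antisymm ?_ hconn.card_vert_le_card_edgeSet_add_one⟩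
  set S := {p : Σ (i j : Q) (_ : i ⟶ j), ι j × ι i | M.coeff B p.2.2.1 p.2.2.2.1 p.2.2.2.2 ≠ 0}
  have hS : S.encard + 1 = (M.length : ℕ∞) := hB.2
  have hfin : S.Finite := by
    refine Set.encard_lt_top_iff.1 (lt_of_le_of_lt le_self_add (?_ : S.encard + 1 < ⊤))
    rw [hS]
    exact ENat.natCast_lt_top _
  have := hfin.to_subtype
  -- Every edge comes from a nonzero coefficient, so there are at most ℓ(M) - 1 edges; connectedness
  -- requires at least that many.
  have hle : Nat.card (M.coefficientGraph B).edgeSet ≤ Nat.card S := by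
    have hex : ∀ e : (M.coefficientGraph B).edgeSet, ∃ p : S,
        s((⟨p.1.1, p.1.2.2.2.2⟩ : Σ i, ι i), ⟨p.1.2.1, p.1.2.2.2.1⟩) = e.1 := by
      rintro ⟨e, he⟩
      induction e using Sym2.ind with
      | _ a b =>
        have he' : (M.coefficientGraph B).Adj a b := he
        rw [coefficientGraph, SimpleGraph.fromRel_adj] at he'
        rcases he'.2 with ⟨α, h⟩ | ⟨α, h⟩
        · exact ⟨⟨⟨a.1, b.1, α, b.2, a.2⟩, h⟩, rfl⟩
        · exact ⟨⟨⟨b.1, a.1, α, a.2, b.2⟩, h⟩, Sym2.eq_swap⟩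
    choose p hp using hex
    exact Nat.card_le_card_of_injective p fun e e' h => Subtype.ext (by rw [← hp e, h, hp e'])
  rw [← hfin.cast_ncard_eq] at hS
  have hS' : S.ncard + 1 = M.length := by exact_mod_cast hS
  rw [hV, ← hS']
  exact Nat.add_le_add_right hle 1

theorem IsTreeBasis.reindex [Fintype Q] {M : QuiverRep.{u, v, w} k Q} {ι ι' : Q → Type}
    {B : ∀ i, Module.Basis (ι i) k (M.space i)} (hB : M.IsTreeBasis B) (e : ∀ i, ι i ≃ ι' i) :
    M.IsTreeBasis fun i => (B i).reindex (e i) := by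
  have hcoeff : ∀ {i j : Q} (α : i ⟶ j) (y : ι' j) (x : ι' i),
      M.coeff (fun i => (B i).reindex (e i)) α y x = M.coeff B α ((e j).symm y) ((e i).symm x) := by
    intro i j α y x
    simp [coeff]
  refine ⟨fun α y x => by rw [hcoeff]; exact hB.1 α _ _, ?_⟩
  rw [← hB.2]
  congr 1
  let E : (Σ (i j : Q) (_ : i ⟶ j), ι j × ι i) ≃ (Σ (i j : Q) (_ : i ⟶ j), ι' j × ι' i) :=
    Equiv.sigmaCongrRight fun i => Equiv.sigmaCongrRight fun j => Equiv.sigmaCongrRight fun _ =>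
      Equiv.prodCongr (e j) (e i)
  rw [← Set.encard_preimage_of_bijective E.symm.bijective]
  congr 1
  ext ⟨i, j, α, y, x⟩
  simp only [Set.mem_ofPred_eq, hcoeff]
  rfl

end CoefficientQuiver

end QuiverRep

namespace D6

/-! ## The arrows of the quiver -/

instance (i j : Vertex) : Fintype (i ⟶ j) := by
  cases i <;> cases j <;> first
    | exact ⟨{Arrow.a31}, fun α : Arrow _ _ => by cases α; exact Finset.mem_singleton_self _⟩
    | exact ⟨{Arrow.a32}, fun α : Arrow _ _ => by cases α; exact Finset.mem_singleton_self _⟩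
    | exact ⟨{Arrow.a43}, fun α : Arrow _ _ => by cases α; exact Finset.mem_singleton_self _⟩
    | exact ⟨{Arrow.a54}, fun α : Arrow _ _ => by cases α; exact Finset.mem_singleton_self _⟩
    | exact ⟨{Arrow.a65}, fun α : Arrow _ _ => by cases α; exact Finset.mem_singleton_self _⟩
    | exact ⟨{Arrow.a75}, fun α : Arrow _ _ => by cases α; exact Finset.mem_singleton_self _⟩
    | exact ⟨∅, fun α : Arrow _ _ => by cases α⟩

theorem sum_vertex {A : Type*} [AddCommMonoid A] (f : Vertex → A) :
    ∑ i, f i = f .v1 + f .v2 + f .v3 + f .v4 + f .v5 + f .v6 + f .v7 := by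
  have : (Finset.univ : Finset Vertex) = {.v1, .v2, .v3, .v4, .v5, .v6, .v7} := rfl
  rw [this]
  simp [add_assoc]

theorem sum_arrow {A : Type*} [AddCommMonoid A] (f : ∀ i j : Vertex, (i ⟶ j) → A) :
    ∑ i, ∑ j, ∑ α, f i j α = f _ _ Arrow.a31 + f _ _ Arrow.a32 + f _ _ Arrow.a43 +
      f _ _ Arrow.a54 + f _ _ Arrow.a65 + f _ _ Arrow.a75 := by
  have h0 : ∀ i j (h : ∀ α : i ⟶ j, False), ∑ α, f i j α = 0 := fun i j h =>
    Finset.sum_eq_zero fun α _ => (h α).elim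
  have h31 : ∑ α, f .v3 .v1 α = f _ _ Arrow.a31 := Finset.sum_singleton _ _
  have h32 : ∑ α, f .v3 .v2 α = f _ _ Arrow.a32 := Finset.sum_singleton _ _
  have h43 : ∑ α, f .v4 .v3 α = f _ _ Arrow.a43 := Finset.sum_singleton _ _
  have h54 : ∑ α, f .v5 .v4 α = f _ _ Arrow.a54 := Finset.sum_singleton _ _
  have h65 : ∑ α, f .v6 .v5 α = f _ _ Arrow.a65 := Finset.sum_singleton _ _
  have h75 : ∑ α, f .v7 .v5 α = f _ _ Arrow.a75 := Finset.sum_singleton _ _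
  simp only [sum_vertex, h31, h32, h43, h54, h65, h75]
  repeat rw [h0 _ _ (fun α : Arrow _ _ => by cases α)]
  simp only [add_zero, zero_add, add_assoc]

theorem eulerVertex_eq (d e : Vertex → ℕ) : QuiverRep.eulerVertex d e =
    d .v1 * e .v1 + d .v2 * e .v2 + d .v3 * e .v3 + d .v4 * e .v4 + d .v5 * e .v5 +
      d .v6 * e .v6 + d .v7 * e .v7 :=
  sum_vertex _

theorem eulerArrow_eq (d e : Vertex → ℕ) : QuiverRep.eulerArrow d e =
    d .v3 * e .v1 + d .v3 * e .v2 + d .v4 * e .v3 + d .v5 * e .v4 + d .v6 * e .v5 +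
      d .v7 * e .v5 := by
  rw [← sum_arrow fun i j _ => d i * e j]
  refine Finset.sum_congr rfl fun i _ => Finset.sum_congr rfl fun j _ => ?_
  rw [Finset.sum_const, smul_eq_mul]
  rfl

namespace Pattern

/-! ## Endomorphisms of patterns -/

/-- The dimension vector of a pattern. -/
abbrev dim (P : Pattern) : Vertex → ℕ := P.toMatrixRep.dim

/-- The matrices of an endomorphism of the representation over `k` given by a pattern, extended by
zero outside their ranges. -/
structure IsEndo (P : Pattern) {k : Type u} [Field k] (f : Vertex → ℕ → ℕ → k) : Prop where
  zero : ∀ i r c, P.dim i ≤ r ∨ P.dim i ≤ c → f i r c = 0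
  comm31 : ∀ r < P.d1, ∀ c < P.d3, ∑ x ∈ Finset.range P.d3, (P.m31 r x : k) * f .v3 x c =
    ∑ y ∈ Finset.range P.d1, f .v1 r y * (P.m31 y c : k)
  comm32 : ∀ r < P.d2, ∀ c < P.d3, ∑ x ∈ Finset.range P.d3, (P.m32 r x : k) * f .v3 x c =
    ∑ y ∈ Finset.range P.d2, f .v2 r y * (P.m32 y c : k)
  comm43 : ∀ r < P.d3, ∀ c < P.d4, f .v4 r c = f .v3 r c
  comm54 : ∀ r < P.d4, ∀ c < P.d5, f .v5 r c = f .v4 r c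
  comm65 : ∀ r < P.d5, ∀ c < P.d6, ∑ x ∈ Finset.range P.d6, (P.m65 r x : k) * f .v6 x c =
    ∑ y ∈ Finset.range P.d5, f .v5 r y * (P.m65 y c : k)
  comm75 : ∀ r < P.d5, ∀ c < P.d7, ∑ x ∈ Finset.range P.d7, (P.m75 r x : k) * f .v7 x c =
    ∑ y ∈ Finset.range P.d5, f .v5 r y * (P.m75 y c : k)

/-- Over every field the endomorphisms of the representation given by the pattern are scalars. -/
def IsBrick (P : Pattern) : Prop :=
  ∀ (k : Type u) [Field k] (f : Vertex → ℕ → ℕ → k), P.IsEndo f →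
    ∃ a : k, ∀ i, ∀ r < P.dim i, ∀ c < P.dim i, f i r c = if r = c then a else 0

/-- The sum of the entries of the matrices of a pattern. -/
def entrySum (P : Pattern) : ℤ :=
  ∑ r ∈ Finset.range P.d1, ∑ c ∈ Finset.range P.d3, P.m31 r c +
  ∑ r ∈ Finset.range P.d2, ∑ c ∈ Finset.range P.d3, P.m32 r c +
  min P.d3 P.d4 + min P.d4 P.d5 +
  ∑ r ∈ Finset.range P.d5, ∑ c ∈ Finset.range P.d6, P.m65 r c +
  ∑ r ∈ Finset.range P.d5, ∑ c ∈ Finset.range P.d7, P.m75 r c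

/-- The properties of a pattern that yield the field independent tree property. -/
structure IsTreeBrick (P : Pattern) : Prop where
  bit31 : ∀ r c, P.m31 r c = 0 ∨ P.m31 r c = 1
  bit32 : ∀ r c, P.m32 r c = 0 ∨ P.m32 r c = 1
  bit65 : ∀ r c, P.m65 r c = 0 ∨ P.m65 r c = 1
  bit75 : ∀ r c, P.m75 r c = 0 ∨ P.m75 r c = 1
  brick : IsBrick.{u} P
  root : P.d1 * P.d1 + P.d2 * P.d2 + P.d3 * P.d3 + P.d4 * P.d4 + P.d5 * P.d5 + P.d6 * P.d6 +
    P.d7 * P.d7 = P.d3 * P.d1 + P.d3 * P.d2 + P.d4 * P.d3 + P.d5 * P.d4 + P.d6 * P.d5 +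
      P.d7 * P.d5 + 1
  entries : P.entrySum + 1 = P.d1 + P.d2 + P.d3 + P.d4 + P.d5 + P.d6 + P.d7

theorem IsTreeBrick.swap12 {P : Pattern} (hP : IsTreeBrick.{u} P) : IsTreeBrick.{u} P.swap12 where
  bit31 := hP.bit32
  bit32 := hP.bit31
  bit65 := hP.bit65
  bit75 := hP.bit75
  brick := by
    intro k _ f hf
    let σ : Vertex → Vertex := fun | .v1 => .v2 | .v2 => .v1 | i => i
    obtain ⟨a, ha⟩ := hP.brick k (fun i => f (σ i))
      { zero := fun
          | .v1 => hf.zero .v2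
          | .v2 => hf.zero .v1
          | .v3 => hf.zero .v3
          | .v4 => hf.zero .v4
          | .v5 => hf.zero .v5
          | .v6 => hf.zero .v6
          | .v7 => hf.zero .v7
        comm31 := hf.comm32
        comm32 := hf.comm31
        comm43 := hf.comm43
        comm54 := hf.comm54
        comm65 := hf.comm65
        comm75 := hf.comm75 }
    exact ⟨a, fun
          | .v1 => ha .v2
          | .v2 => ha .v1
          | .v3 => ha .v3
          | .v4 => ha .v4
          | .v5 => ha .v5
          | .v6 => ha .v6
          | .v7 => ha .v7⟩
  root := by
    have := hP.root
    simp only [Pattern.swap12]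
    linarith
  entries := by
    have := hP.entries
    simp only [Pattern.swap12, entrySum] at this ⊢
    linarith

theorem IsTreeBrick.swap67 {P : Pattern} (hP : IsTreeBrick.{u} P) : IsTreeBrick.{u} P.swap67 where
  bit31 := hP.bit31
  bit32 := hP.bit32
  bit65 := hP.bit75
  bit75 := hP.bit65
  brick := by
    intro k _ f hf
    let σ : Vertex → Vertex := fun | .v6 => .v7 | .v7 => .v6 | i => i
    obtain ⟨a, ha⟩ := hP.brick k (fun i => f (σ i))
      { zero := fun
          | .v1 => hf.zero .v1
          | .v2 => hf.zero .v2
          | .v3 => hf.zero .v3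
          | .v4 => hf.zero .v4
          | .v5 => hf.zero .v5
          | .v6 => hf.zero .v7
          | .v7 => hf.zero .v6
        comm31 := hf.comm31
        comm32 := hf.comm32
        comm43 := hf.comm43
        comm54 := hf.comm54
        comm65 := hf.comm75
        comm75 := hf.comm65 }
    exact ⟨a, fun
          | .v1 => ha .v1
          | .v2 => ha .v2
          | .v3 => ha .v3
          | .v4 => ha .v4
          | .v5 => ha .v5
          | .v6 => ha .v7
          | .v7 => ha .v6⟩
  root := by
    have := hP.root
    simp only [Pattern.swap67]
    linarith
  entries := by
    have := hP.entries
    simp only [Pattern.swap67, entrySum] at this ⊢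
    linarith

/-- Transposing matrices turns endomorphisms of the transposed pattern into endomorphisms of the
pattern itself, each commutation relation becoming the one of the opposite arrow. -/
theorem IsTreeBrick.transpose {P : Pattern} (hP : IsTreeBrick.{u} P) :
    IsTreeBrick.{u} P.transpose where
  bit31 := fun r c => hP.bit65 c r
  bit32 := fun r c => hP.bit75 c r
  bit65 := fun r c => hP.bit31 c r
  bit75 := fun r c => hP.bit32 c r
  brick := by
    intro k _ f hf
    let σ : Vertex → Vertex := fun
      | .v1 => .v6 | .v2 => .v7 | .v3 => .v5 | .v4 => .v4 | .v5 => .v3 | .v6 => .v1 | .v7 => .v2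
    obtain ⟨a, ha⟩ := hP.brick k (fun i r c => f (σ i) c r)
      { zero := fun
          | .v1 => fun r c h => hf.zero .v6 c r h.symm
          | .v2 => fun r c h => hf.zero .v7 c r h.symm
          | .v3 => fun r c h => hf.zero .v5 c r h.symm
          | .v4 => fun r c h => hf.zero .v4 c r h.symm
          | .v5 => fun r c h => hf.zero .v3 c r h.symm
          | .v6 => fun r c h => hf.zero .v1 c r h.symm
          | .v7 => fun r c h => hf.zero .v2 c r h.symm
        comm31 := fun r hr c hc =>
          (Finset.sum_congr rfl fun _ _ => mul_comm _ _).trans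
            ((hf.comm65 c hc r hr).symm.trans (Finset.sum_congr rfl fun _ _ => mul_comm _ _))
        comm32 := fun r hr c hc =>
          (Finset.sum_congr rfl fun _ _ => mul_comm _ _).trans
            ((hf.comm75 c hc r hr).symm.trans (Finset.sum_congr rfl fun _ _ => mul_comm _ _))
        comm43 := fun r hr c hc => (hf.comm54 c hc r hr).symm
        comm54 := fun r hr c hc => (hf.comm43 c hc r hr).symm
        comm65 := fun r hr c hc =>
          (Finset.sum_congr rfl fun _ _ => mul_comm _ _).trans
            ((hf.comm31 c hc r hr).symm.trans (Finset.sum_congr rfl fun _ _ => mul_comm _ _))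
        comm75 := fun r hr c hc =>
          (Finset.sum_congr rfl fun _ _ => mul_comm _ _).trans
            ((hf.comm32 c hc r hr).symm.trans (Finset.sum_congr rfl fun _ _ => mul_comm _ _)) }
    refine ⟨a, fun i r hr c hc => ?_⟩
    simp only [eq_comm (a := r)]
    cases i
    · exact ha .v6 c hc r hr
    · exact ha .v7 c hc r hr
    · exact ha .v5 c hc r hr
    · exact ha .v4 c hc r hr
    · exact ha .v3 c hc r hr
    · exact ha .v1 c hc r hr
    · exact ha .v2 c hc r hr
  root := by
    have := hP.root
    simp only [Pattern.transpose]
    linarith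
  entries := by
    have := hP.entries
    simp only [Pattern.transpose, entrySum] at this ⊢
    rw [Finset.sum_comm (s := Finset.range P.d6), Finset.sum_comm (s := Finset.range P.d7),
      Finset.sum_comm (s := Finset.range P.d3), Finset.sum_comm (s := Finset.range P.d3),
      min_comm P.d5, min_comm P.d4 P.d3]
    linarith

end Pattern

namespace Pattern

/-! ## From patterns to representations -/

/-- The entries of the matrix of an arrow. -/
def entry (P : Pattern) : ∀ {i j : Vertex}, Arrow i j → ℕ → ℕ → ℤ
  | _, _, .a31 => P.m31
  | _, _, .a32 => P.m32
  | _, _, .a43 => fun r c => if r = c then 1 else 0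
  | _, _, .a54 => fun r c => if r = c then 1 else 0
  | _, _, .a65 => P.m65
  | _, _, .a75 => P.m75

theorem toMatrixRep_mat (P : Pattern) {i j : Vertex} (α : Arrow i j) (r : Fin (P.dim j))
    (c : Fin (P.dim i)) : P.toMatrixRep.mat (i := i) (j := j) α r c = P.entry α r c := by
  cases α <;> rfl

theorem dimVector_overField (F : MatrixRep Vertex) (k : Type u) [Field k] :
    (F.overField k).dimVector = F.dim :=
  funext fun _ => Module.finrank_fin_fun k

theorem coeff_overField (F : MatrixRep Vertex) (k : Type u) [Field k] {i j : Vertex} (α : i ⟶ j)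
    (r : Fin (F.dim j)) (c : Fin (F.dim i)) :
    (F.overField k).coeff (fun i => Pi.basisFun k (Fin (F.dim i))) α r c = (F.mat α r c : k) := by
  change (Pi.basisFun k (Fin (F.dim j))).repr (Matrix.toLin' ((F.mat α).map (fun z : ℤ => (z : k)))
    (Pi.basisFun k (Fin (F.dim i)) c)) r = _
  rw [Pi.basisFun_apply, Pi.basisFun_repr, Matrix.toLin'_apply, Matrix.mulVec_single_one]
  rfl

section Endomorphisms

variable {P : Pattern} {k : Type u} [Field k]
  (g : QuiverRep.VertexMaps (P.toMatrixRep.overField k) (P.toMatrixRep.overField k))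

/-- The matrix of a linear map `g i`. -/
def endMatrix (i : Vertex) : Matrix (Fin (P.dim i)) (Fin (P.dim i)) k :=
  LinearMap.toMatrix' (g i : (Fin (P.dim i) → k) →ₗ[k] (Fin (P.dim i) → k))

/-- The entries of the matrices of `g`, extended by zero. -/
def endEntry (i : Vertex) (r c : ℕ) : k :=
  if h : r < P.dim i ∧ c < P.dim i then endMatrix g i ⟨r, h.1⟩ ⟨c, h.2⟩ else 0

variable {g}

theorem endMatrix_eq (i : Vertex) (r c : Fin (P.dim i)) : endMatrix g i r c = endEntry g i r c := by
  simp [endEntry]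

theorem endEntry_comm (hg : QuiverRep.IsHom g) {i j : Vertex} (α : i ⟶ j) (r : ℕ)
    (hr : r < P.dim j) (c : ℕ) (hc : c < P.dim i) :
    ∑ x ∈ Finset.range (P.dim i), (P.entry α r x : k) * endEntry g i x c =
      ∑ y ∈ Finset.range (P.dim j), endEntry g j r y * (P.entry α y c : k) := by
  have h1 : (P.toMatrixRep.mat α).map (fun z : ℤ => (z : k)) * endMatrix g i =
      endMatrix g j * (P.toMatrixRep.mat α).map (fun z : ℤ => (z : k)) := by
    let G : ∀ i, (Fin (P.dim i) → k) →ₗ[k] (Fin (P.dim i) → k) := g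
    have h2 : Matrix.toLin' ((P.toMatrixRep.mat α).map (fun z : ℤ => (z : k))) ∘ₗ G i =
      G j ∘ₗ Matrix.toLin' ((P.toMatrixRep.mat α).map (fun z : ℤ => (z : k))) :=
      QuiverRep.isHom_iff.1 hg α
    have h4 := congrArg LinearMap.toMatrix' h2
    rw [LinearMap.toMatrix'_comp, LinearMap.toMatrix'_comp, LinearMap.toMatrix'_toLin'] at h4
    exact h4
  have h3 := congrFun (congrFun h1 ⟨r, hr⟩) ⟨c, hc⟩
  rw [Matrix.mul_apply, Matrix.mul_apply] at h3
  simp only [Matrix.map_apply, toMatrixRep_mat, endMatrix_eq] at h3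
  rw [Fin.sum_univ_eq_sum_range (fun x => (P.entry α r x : k) * endEntry g i x c),
    Fin.sum_univ_eq_sum_range (fun y => endEntry g j r y * (P.entry α y c : k))] at h3
  exact h3

theorem isEndo_endEntry (hg : QuiverRep.IsHom g) : P.IsEndo (endEntry g) := by
  have hz : ∀ i r c, P.dim i ≤ r ∨ P.dim i ≤ c → endEntry g i r c = 0 := fun i r c h =>
    dif_neg (by omega)
  refine
    { zero := hz
      comm31 := endEntry_comm hg Arrow.a31
      comm32 := endEntry_comm hg Arrow.a32
      comm43 := fun r hr c hc => ?_
      comm54 := fun r hr c hc => ?_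
      comm65 := endEntry_comm hg Arrow.a65
      comm75 := endEntry_comm hg Arrow.a75 }
  · have h := endEntry_comm hg Arrow.a43 r hr c hc
    simp only [entry, Int.cast_ite, Int.cast_one, Int.cast_zero, ite_mul, one_mul, zero_mul,
      mul_ite, mul_one, mul_zero, Finset.sum_ite_eq, Finset.sum_ite_eq', Finset.mem_range] at h
    split_ifs at h with h1 h2 h2
    · exact h
    · rw [h, hz _ _ _ (Or.inr (not_lt.1 h2))]
    · rw [hz _ _ _ (Or.inl (not_lt.1 h1)), h]
    · rw [hz _ _ _ (Or.inl (not_lt.1 h1)), hz _ _ _ (Or.inr (not_lt.1 h2))]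
  · have h := endEntry_comm hg Arrow.a54 r hr c hc
    simp only [entry, Int.cast_ite, Int.cast_one, Int.cast_zero, ite_mul, one_mul, zero_mul,
      mul_ite, mul_one, mul_zero, Finset.sum_ite_eq, Finset.sum_ite_eq', Finset.mem_range] at h
    split_ifs at h with h1 h2 h2
    · exact h
    · rw [h, hz _ _ _ (Or.inr (not_lt.1 h2))]
    · rw [hz _ _ _ (Or.inl (not_lt.1 h1)), h]
    · rw [hz _ _ _ (Or.inl (not_lt.1 h1)), hz _ _ _ (Or.inr (not_lt.1 h2))]

end Endomorphisms

variable {P : Pattern}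

theorem IsTreeBrick.isBrick_overField (hP : IsTreeBrick.{u} P) (k : Type u) [Field k] :
    (P.toMatrixRep.overField k).IsBrick := by
  constructor
  · by_contra hcon
    have h0 : ∀ i, P.dim i = 0 := by
      intro i
      by_contra hi
      have : Nonempty (Fin (P.dim i)) := ⟨⟨0, Nat.pos_of_ne_zero hi⟩⟩
      exact hcon ⟨i, (inferInstance : Nontrivial (Fin (P.dim i) → k))⟩
    have hr := hP.root
    have h1 : P.d1 = 0 := h0 .v1
    have h2 : P.d2 = 0 := h0 .v2
    have h3 : P.d3 = 0 := h0 .v3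
    have h4 : P.d4 = 0 := h0 .v4
    have h5 : P.d5 = 0 := h0 .v5
    have h6 : P.d6 = 0 := h0 .v6
    have h7 : P.d7 = 0 := h0 .v7
    simp [h1, h2, h3, h4, h5, h6, h7] at hr
  · intro g hg
    obtain ⟨a, ha⟩ := hP.brick k _ (isEndo_endEntry hg)
    refine ⟨a, fun i => ?_⟩
    apply (LinearMap.toMatrix' (R := k) (m := Fin (P.dim i)) (n := Fin (P.dim i))).injective
    change endMatrix g i = _
    ext r c
    rw [endMatrix_eq, ha i r r.2 c c.2]
    change _ = LinearMap.toMatrix' (a • (LinearMap.id : (Fin (P.dim i) → k) →ₗ[k] _)) r c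
    rw [map_smul, LinearMap.toMatrix'_id, Matrix.smul_apply, Matrix.one_apply, smul_eq_mul,
      mul_ite, mul_one, mul_zero]
    simp only [Fin.ext_iff]

theorem IsTreeBrick.euler (hP : IsTreeBrick.{u} P) :
    QuiverRep.eulerVertex P.dim P.dim = QuiverRep.eulerArrow P.dim P.dim + 1 := by
  rw [eulerVertex_eq, eulerArrow_eq]
  exact hP.root

theorem IsTreeBrick.isExceptional_overField (hP : IsTreeBrick.{u} P) (k : Type u) [Field k] :
    (P.toMatrixRep.overField k).IsExceptional :=
  ⟨(hP.isBrick_overField k).isIndecomposable,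
    (QuiverRep.hasNoSelfExtensions_iff_extVanish _).2 ((hP.isBrick_overField k).extVanish (by
      rw [dimVector_overField]
      exact hP.euler))⟩

theorem IsTreeBrick.entry_bit (hP : IsTreeBrick.{u} P) {i j : Vertex} (α : Arrow i j) (r c : ℕ) :
    P.entry α r c = 0 ∨ P.entry α r c = 1 := by
  cases α
  · exact hP.bit31 r c
  · exact hP.bit32 r c
  · exact (ite_eq_or_eq _ _ _).symm
  · exact (ite_eq_or_eq _ _ _).symm
  · exact hP.bit65 r c
  · exact hP.bit75 r c

theorem sum_identity (a b : ℕ) :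
    ∑ r ∈ Finset.range a, ∑ c ∈ Finset.range b, (if r = c then (1 : ℤ) else 0) = min a b := by
  simp only [Finset.sum_ite_eq, Finset.mem_range, Finset.sum_boole]
  have : (Finset.range a).filter (· < b) = Finset.range (min a b) := by
    ext x
    simp
  rw [this, Finset.card_range]

theorem IsTreeBrick.encard_entries (hP : IsTreeBrick.{u} P) (k : Type u) [Field k] :
    Set.encard {p : Σ (i j : Vertex) (_ : i ⟶ j), Fin (P.dim j) × Fin (P.dim i) |
      (P.toMatrixRep.overField k).coeff (fun i => Pi.basisFun k (Fin (P.dim i))) p.2.2.1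
        p.2.2.2.1 p.2.2.2.2 ≠ 0} + 1 =
      ((P.toMatrixRep.overField k).length : ℕ∞) := by
  classical
  -- Since all entries are 0 or 1, being nonzero in k does not depend on the characteristic.
  have hset : {p : Σ (i j : Vertex) (_ : i ⟶ j), Fin (P.dim j) × Fin (P.dim i) |
      (P.toMatrixRep.overField k).coeff (fun i => Pi.basisFun k (Fin (P.dim i))) p.2.2.1
        p.2.2.2.1 p.2.2.2.2 ≠ 0} = ((Finset.univ.filter fun p => P.entry p.2.2.1 p.2.2.2.1 p.2.2.2.2 = 1 :
          Finset (Σ (i j : Vertex) (_ : i ⟶ j), Fin (P.dim j) × Fin (P.dim i))) : Set _) := by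
    ext ⟨i, j, α, r, c⟩
    rw [Set.mem_ofPred_eq, coeff_overField, toMatrixRep_mat, Finset.coe_filter]
    rcases hP.entry_bit α r c with h | h <;> simp [h]
  have hsum : ∀ {i j : Vertex} (α : i ⟶ j),
      ∑ p : Fin (P.dim j) × Fin (P.dim i), (if P.entry α p.1 p.2 = 1 then (1 : ℤ) else 0) =
        ∑ r ∈ Finset.range (P.dim j), ∑ c ∈ Finset.range (P.dim i), P.entry α r c := by
    intro i j α
    rw [Fintype.sum_prod_type, ← Fin.sum_univ_eq_sum_range
      (fun r => ∑ c ∈ Finset.range (P.dim i), P.entry α r c)]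
    refine Finset.sum_congr rfl fun r _ => ?_
    rw [← Fin.sum_univ_eq_sum_range (fun c => P.entry α r c)]
    refine Finset.sum_congr rfl fun c _ => ?_
    rcases hP.entry_bit α r c with h | h <;> simp [h]
  have hcard : ((Finset.univ.filter fun p => P.entry p.2.2.1 p.2.2.2.1 p.2.2.2.2 = 1 :
      Finset (Σ (i j : Vertex) (_ : i ⟶ j), Fin (P.dim j) × Fin (P.dim i))).card : ℤ) =
        P.entrySum := by
    rw [Finset.card_filter, Nat.cast_sum, Fintype.sum_sigma]
    simp only [Fintype.sum_sigma, Nat.cast_ite, Nat.cast_one, Nat.cast_zero]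
    rw [sum_arrow fun i j α => ∑ p : Fin (P.dim j) × Fin (P.dim i),
      (if P.entry α p.1 p.2 = 1 then (1 : ℤ) else 0)]
    simp only [hsum]
    rw [entrySum, ← sum_identity, ← sum_identity]
    rfl
  have hlen : (P.toMatrixRep.overField k).length =
      P.d1 + P.d2 + P.d3 + P.d4 + P.d5 + P.d6 + P.d7 := by
    have h1 : ∀ i, Module.finrank k ((P.toMatrixRep.overField k).space i) = P.dim i :=
      congrFun (dimVector_overField P.toMatrixRep k)
    rw [QuiverRep.length, sum_vertex]
    simp only [h1]
    rfl
  rw [hset, Set.encard_coe_eq_coe_finsetCard, hlen]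
  have h2 := hP.entries
  rw [← hcard] at h2
  exact_mod_cast h2

theorem IsTreeBrick.hasFieldIndependentTreeProperty (hP : IsTreeBrick.{u} P) :
    P.toMatrixRep.HasFieldIndependentTreeProperty.{u, 0} := by
  refine ⟨fun α r c => ?_, fun k _ => ?_⟩
  · rw [toMatrixRep_mat]
    exact hP.entry_bit α r c
  have hex := hP.isExceptional_overField k
  have htree : (P.toMatrixRep.overField k).IsTreeBasis
      (fun i => Pi.basisFun k (Fin (P.dim i))) := by
    refine ⟨fun α r c => ?_, hP.encard_entries k⟩
    rw [coeff_overField, toMatrixRep_mat]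
    rcases hP.entry_bit α r c with h | h <;> simp [h]
  refine ⟨hex, ⟨hex.1, _, htree.reindex fun i =>
    finCongr (congrFun (dimVector_overField P.toMatrixRep k) i).symm⟩, htree,
    hex.1.isTree_coefficientGraph htree⟩

end Pattern

/-! ## Endomorphisms of patterns that consist of picks and links -/

section Sums

variable {k : Type u} [Field k]

theorem sum_pick_mul {n : ℕ} {g : ℕ → k} (hg : ∀ x, n ≤ x → g x = 0) (a : ℕ) :
    ∑ x ∈ Finset.range n, ((if x = a then 1 else 0 : ℤ) : k) * g x = g a := by
  simp only [Int.cast_ite, Int.cast_one, Int.cast_zero, ite_mul, one_mul, zero_mul,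
    Finset.sum_ite_eq', Finset.mem_range]
  split_ifs with h
  · rfl
  · exact (hg a (not_lt.1 h)).symm

theorem sum_link_mul {n : ℕ} {g : ℕ → k} (hg : ∀ x, n ≤ x → g x = 0) {a b : ℕ} (hab : a ≠ b) :
    ∑ x ∈ Finset.range n, ((if x = a ∨ x = b then 1 else 0 : ℤ) : k) * g x = g a + g b := by
  rw [← sum_pick_mul hg a, ← sum_pick_mul hg b, ← Finset.sum_add_distrib]
  refine Finset.sum_congr rfl fun x _ => ?_
  by_cases h1 : x = a
  · have h2 : x ≠ b := fun h => hab (h1.symm.trans h)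
    simp [h1, hab]
  · simp [h1]

theorem sum_mul_indicator_eq {n : ℕ} {g : ℕ → k} {p : ℕ → Prop} [DecidablePred p] {y : ℕ}
    (hy : y < n) (hp : ∀ x < n, p x ↔ x = y) :
    ∑ x ∈ Finset.range n, g x * ((if p x then 1 else 0 : ℤ) : k) = g y := by
  rw [Finset.sum_eq_single y]
  · simp [(hp y hy).2 rfl]
  · intro x hx hxy
    have : ¬ p x := fun h => hxy ((hp x (Finset.mem_range.1 hx)).1 h)
    simp [this]
  · exact fun h => (h (Finset.mem_range.2 hy)).elim

theorem sum_mul_indicator_eq_zero {n : ℕ} {g : ℕ → k} {p : ℕ → Prop} [DecidablePred p]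
    (hp : ∀ x < n, ¬ p x) :
    ∑ x ∈ Finset.range n, g x * ((if p x then 1 else 0 : ℤ) : k) = 0 :=
  Finset.sum_eq_zero fun x hx => by simp [hp x (Finset.mem_range.1 hx)]

end Sums

namespace Pattern

/-- The shape of a pattern with `d5 ≤ d4 ≤ d3`: the maps `3 → 1` and `6 → 5` pick basis vectors,
the maps `3 → 2` and `7 → 5` link two basis vectors for each basis vector of the vertices `2`
and `7`. -/
structure IsLinkPattern (P : Pattern) (pick1 left2 right2 pick6 left7 right7 : ℕ → ℕ) : Prop where
  le54 : P.d5 ≤ P.d4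
  le43 : P.d4 ≤ P.d3
  m31 : ∀ r c, P.m31 r c = if c = pick1 r then 1 else 0
  m32 : ∀ r c, P.m32 r c = if c = left2 r ∨ c = right2 r then 1 else 0
  m65 : ∀ r c, P.m65 r c = if r = pick6 c then 1 else 0
  m75 : ∀ r c, P.m75 r c = if r = left7 c ∨ r = right7 c then 1 else 0
  pick1_lt : ∀ r < P.d1, pick1 r < P.d3
  left2_lt : ∀ r < P.d2, left2 r < P.d3
  pick6_lt : ∀ c < P.d6, pick6 c < P.d5
  left7_lt : ∀ c < P.d7, left7 c < P.d5
  right7_lt : ∀ c < P.d7, right7 c < P.d5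
  pick1_inj : ∀ r < P.d1, ∀ y < P.d1, pick1 r = pick1 y → r = y
  left2_inj : ∀ r < P.d2, ∀ y < P.d2, left2 r = left2 y → r = y
  right2_inj : ∀ r < P.d2, ∀ y < P.d2, right2 r = right2 y → r = y
  left2_ne_right2 : ∀ r < P.d2, ∀ y < P.d2, left2 r ≠ right2 y
  pick6_inj : ∀ r < P.d6, ∀ y < P.d6, pick6 r = pick6 y → r = y
  left7_inj : ∀ r < P.d7, ∀ y < P.d7, left7 r = left7 y → r = y
  right7_inj : ∀ r < P.d7, ∀ y < P.d7, right7 r = right7 y → r = y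
  left7_ne_right7 : ∀ r < P.d7, ∀ y < P.d7, left7 r ≠ right7 y

/-- The conditions on the matrix at the vertex `3` of an endomorphism of a link pattern. -/
structure IsLinkEndo (P : Pattern) (pick1 left2 right2 pick6 left7 right7 : ℕ → ℕ)
    {k : Type u} [Field k] (F : ℕ → ℕ → k) : Prop where
  zero : ∀ r c, P.d3 ≤ r ∨ P.d3 ≤ c → F r c = 0
  flag4 : ∀ r c, P.d4 ≤ r → c < P.d4 → F r c = 0
  flag5 : ∀ r c, P.d5 ≤ r → c < P.d5 → F r c = 0
  pick1 : ∀ r < P.d1, ∀ c < P.d3, (∀ y < P.d1, c ≠ pick1 y) → F (pick1 r) c = 0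
  link2 : ∀ r < P.d2, ∀ y < P.d2, right2 y < P.d3 →
    F (left2 r) (left2 y) + F (right2 r) (left2 y) =
      F (left2 r) (right2 y) + F (right2 r) (right2 y)
  unlink2 : ∀ r < P.d2, ∀ c < P.d3, (∀ y < P.d2, c ≠ left2 y ∧ c ≠ right2 y) →
    F (left2 r) c + F (right2 r) c = 0
  pick6 : ∀ r, ∀ c < P.d6, (∀ x < P.d6, r ≠ pick6 x) → F r (pick6 c) = 0
  link7 : ∀ x < P.d7, ∀ c < P.d7, F (left7 x) (left7 c) + F (left7 x) (right7 c) =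
    F (right7 x) (left7 c) + F (right7 x) (right7 c)
  unlink7 : ∀ r, ∀ c < P.d7, (∀ x < P.d7, r ≠ left7 x ∧ r ≠ right7 x) →
    F r (left7 c) + F r (right7 c) = 0

/-- The maps 5 → 4 → 3 are inclusions of coordinate subspaces, so the matrix F at vertex 3 restricts
to those at 4 and 5; the matrices at 1, 2, 6 and 7 are read off from F at the picked and linked
indices. It therefore suffices that F is scalar. -/
theorem IsLinkPattern.isBrick {P : Pattern} {pick1 left2 right2 pick6 left7 right7 : ℕ → ℕ}
    (hP : P.IsLinkPattern pick1 left2 right2 pick6 left7 right7)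
    (hF : ∀ (k : Type u) [Field k] (F : ℕ → ℕ → k),
      P.IsLinkEndo pick1 left2 right2 pick6 left7 right7 F →
        ∃ a : k, ∀ r < P.d3, ∀ c < P.d3, F r c = if r = c then a else 0) :
    IsBrick.{u} P := by
  intro k _ f hf
  have z1 : ∀ r c, P.d1 ≤ r ∨ P.d1 ≤ c → f .v1 r c = 0 := hf.zero .v1
  have z2 : ∀ r c, P.d2 ≤ r ∨ P.d2 ≤ c → f .v2 r c = 0 := hf.zero .v2
  have z3 : ∀ r c, P.d3 ≤ r ∨ P.d3 ≤ c → f .v3 r c = 0 := hf.zero .v3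
  have z4 : ∀ r c, P.d4 ≤ r ∨ P.d4 ≤ c → f .v4 r c = 0 := hf.zero .v4
  have z5 : ∀ r c, P.d5 ≤ r ∨ P.d5 ≤ c → f .v5 r c = 0 := hf.zero .v5
  have z6 : ∀ r c, P.d6 ≤ r ∨ P.d6 ≤ c → f .v6 r c = 0 := hf.zero .v6
  have z7 : ∀ r c, P.d7 ≤ r ∨ P.d7 ≤ c → f .v7 r c = 0 := hf.zero .v7
  have h43 := hP.le43
  have h54 := hP.le54
  have e4 : ∀ r, ∀ c < P.d4, f .v4 r c = f .v3 r c := fun r c hc => by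
    by_cases hr : r < P.d3
    · exact hf.comm43 r hr c hc
    · rw [z3 r c (Or.inl (by omega)), z4 r c (Or.inl (by omega))]
  have flag4 : ∀ r c, P.d4 ≤ r → c < P.d4 → f .v3 r c = 0 := fun r c hr hc => by
    rw [← e4 r c hc, z4 r c (Or.inl hr)]
  have e5 : ∀ r, ∀ c < P.d5, f .v5 r c = f .v3 r c := fun r c hc => by
    by_cases hr : r < P.d4
    · rw [hf.comm54 r hr c hc, e4 r c (by omega)]
    · rw [flag4 r c (by omega) (by omega), z5 r c (Or.inl (by omega))]
  have flag5 : ∀ r c, P.d5 ≤ r → c < P.d5 → f .v3 r c = 0 := fun r c hr hc => by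
    rw [← e5 r c hc, z5 r c (Or.inl hr)]
  have c31 : ∀ r < P.d1, ∀ c < P.d3, f .v3 (pick1 r) c = ∑ y ∈ Finset.range P.d1,
      f .v1 r y * ((if c = pick1 y then 1 else 0 : ℤ) : k) := fun r hr c hc => by
    have h := hf.comm31 r hr c hc
    simp only [hP.m31] at h
    rwa [sum_pick_mul fun x hx => z3 x c (Or.inl hx)] at h
  have c32 : ∀ r < P.d2, ∀ c < P.d3, f .v3 (left2 r) c + f .v3 (right2 r) c =
      ∑ y ∈ Finset.range P.d2,
        f .v2 r y * ((if c = left2 y ∨ c = right2 y then 1 else 0 : ℤ) : k) := fun r hr c hc => by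
    have h := hf.comm32 r hr c hc
    simp only [hP.m32] at h
    rwa [sum_link_mul (fun x hx => z3 x c (Or.inl hx)) (hP.left2_ne_right2 r hr r hr)] at h
  have c65 : ∀ r < P.d5, ∀ c < P.d6, f .v3 r (pick6 c) = ∑ x ∈ Finset.range P.d6,
      f .v6 x c * ((if r = pick6 x then 1 else 0 : ℤ) : k) := fun r hr c hc => by
    have h := hf.comm65 r hr c hc
    simp only [hP.m65, mul_comm _ (f _ _ _)] at h
    simp only [mul_comm (f .v5 _ _)] at h
    rw [sum_pick_mul fun x hx => z5 r x (Or.inr hx), e5 r _ (hP.pick6_lt c hc)] at h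
    exact h.symm
  have c75 : ∀ r < P.d5, ∀ c < P.d7, f .v3 r (left7 c) + f .v3 r (right7 c) =
      ∑ x ∈ Finset.range P.d7,
        f .v7 x c * ((if r = left7 x ∨ r = right7 x then 1 else 0 : ℤ) : k) := fun r hr c hc => by
    have h := hf.comm75 r hr c hc
    simp only [hP.m75, mul_comm _ (f _ _ _)] at h
    simp only [mul_comm (f .v5 _ _)] at h
    rw [sum_link_mul (fun x hx => z5 r x (Or.inr hx)) (hP.left7_ne_right7 c hc c hc),
      e5 r _ (hP.left7_lt c hc), e5 r _ (hP.right7_lt c hc)] at h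
    exact h.symm
  have v1 : ∀ r < P.d1, ∀ y < P.d1, f .v3 (pick1 r) (pick1 y) = f .v1 r y := fun r hr y hy => by
    rw [c31 r hr _ (hP.pick1_lt y hy)]
    exact sum_mul_indicator_eq hy fun x hx =>
      ⟨fun h => (hP.pick1_inj y hy x hx h).symm, fun h => by rw [h]⟩
  have v2l : ∀ r < P.d2, ∀ y < P.d2,
      f .v3 (left2 r) (left2 y) + f .v3 (right2 r) (left2 y) = f .v2 r y := fun r hr y hy => by
    rw [c32 r hr _ (hP.left2_lt y hy)]
    exact sum_mul_indicator_eq hy fun x hx =>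
      ⟨fun h => h.elim (fun h => (hP.left2_inj y hy x hx h).symm)
        fun h => (hP.left2_ne_right2 y hy x hx h).elim, fun h => by rw [h]; exact Or.inl rfl⟩
  -- The right end of a link at vertex 2 may lie beyond the last basis vector of vertex 3; such a
  -- link has one nonzero entry only.
  have v2r : ∀ r < P.d2, ∀ y < P.d2, right2 y < P.d3 →
      f .v3 (left2 r) (right2 y) + f .v3 (right2 r) (right2 y) = f .v2 r y :=
    fun r hr y hy hlt => by
      rw [c32 r hr _ hlt]
      exact sum_mul_indicator_eq hy fun x hx =>
        ⟨fun h => h.elim (fun h => (hP.left2_ne_right2 x hx y hy h.symm).elim)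
          fun h => (hP.right2_inj y hy x hx h).symm, fun h => by rw [h]; exact Or.inr rfl⟩
  have v6 : ∀ r < P.d6, ∀ c < P.d6, f .v3 (pick6 r) (pick6 c) = f .v6 r c := fun r hr c hc => by
    rw [c65 _ (hP.pick6_lt r hr) c hc]
    exact sum_mul_indicator_eq (g := fun x => f .v6 x c) hr fun x hx =>
      ⟨fun h => (hP.pick6_inj r hr x hx h).symm, fun h => by rw [h]⟩
  have v7l : ∀ r < P.d7, ∀ c < P.d7,
      f .v3 (left7 r) (left7 c) + f .v3 (left7 r) (right7 c) = f .v7 r c := fun r hr c hc => by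
    rw [c75 _ (hP.left7_lt r hr) c hc]
    exact sum_mul_indicator_eq (g := fun x => f .v7 x c) hr fun x hx =>
      ⟨fun h => h.elim (fun h => (hP.left7_inj r hr x hx h).symm)
        fun h => (hP.left7_ne_right7 r hr x hx h).elim, fun h => by rw [h]; exact Or.inl rfl⟩
  have v7r : ∀ r < P.d7, ∀ c < P.d7,
      f .v3 (right7 r) (left7 c) + f .v3 (right7 r) (right7 c) = f .v7 r c := fun r hr c hc => by
    rw [c75 _ (hP.right7_lt r hr) c hc]
    exact sum_mul_indicator_eq (g := fun x => f .v7 x c) hr fun x hx =>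
      ⟨fun h => h.elim (fun h => (hP.left7_ne_right7 x hx r hr h.symm).elim)
        fun h => (hP.right7_inj r hr x hx h).symm, fun h => by rw [h]; exact Or.inr rfl⟩
  obtain ⟨a, ha⟩ := hF k (f .v3)
    { zero := z3
      flag4 := flag4
      flag5 := flag5
      pick1 := fun r hr c hc h => by
        rw [c31 r hr c hc]
        exact sum_mul_indicator_eq_zero h
      link2 := fun r hr y hy hlt => by rw [v2l r hr y hy, v2r r hr y hy hlt]
      unlink2 := fun r hr c hc h => by
        rw [c32 r hr c hc]
        exact sum_mul_indicator_eq_zero fun y hy => not_or.2 (h y hy)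
      pick6 := fun r c hc h => by
        by_cases hr : r < P.d5
        · rw [c65 r hr c hc]
          exact sum_mul_indicator_eq_zero (g := fun x => f .v6 x c) h
        · exact flag5 r _ (not_lt.1 hr) (hP.pick6_lt c hc)
      link7 := fun x hx c hc => by rw [v7l x hx c hc, v7r x hx c hc]
      unlink7 := fun r c hc h => by
        by_cases hr : r < P.d5
        · rw [c75 r hr c hc]
          exact sum_mul_indicator_eq_zero (g := fun x => f .v7 x c) fun x hx => not_or.2 (h x hx)
        · rw [flag5 r _ (not_lt.1 hr) (hP.left7_lt c hc),
            flag5 r _ (not_lt.1 hr) (hP.right7_lt c hc), add_zero] }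
  have ha' : ∀ r, ∀ c < P.d3, f .v3 r c = if r = c then a else 0 := fun r c hc => by
    by_cases hr : r < P.d3
    · exact ha r hr c hc
    · rw [z3 r c (Or.inl (not_lt.1 hr)), if_neg (by omega)]
  refine ⟨a, ?_⟩
  rintro (_ | _ | _ | _ | _ | _ | _) r hr c hc
  · rw [← v1 r hr c hc, ha' _ _ (hP.pick1_lt c hc)]
    exact if_congr ⟨hP.pick1_inj r hr c hc, fun h => by rw [h]⟩ rfl rfl
  · rw [← v2l r hr c hc, ha' _ _ (hP.left2_lt c hc), ha' _ _ (hP.left2_lt c hc),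
      if_neg (hP.left2_ne_right2 c hc r hr).symm, add_zero]
    exact if_congr ⟨hP.left2_inj r hr c hc, fun h => by rw [h]⟩ rfl rfl
  · exact ha r hr c hc
  · rw [e4 r c hc]
    exact ha' r c (lt_of_lt_of_le hc h43)
  · rw [e5 r c hc]
    exact ha' r c (lt_of_lt_of_le hc (h54.trans h43))
  · rw [← v6 r hr c hc, ha' _ _ (lt_of_lt_of_le (hP.pick6_lt c hc) (h54.trans h43))]
    exact if_congr ⟨hP.pick6_inj r hr c hc, fun h => by rw [h]⟩ rfl rfl
  · rw [← v7l r hr c hc, ha' _ _ (lt_of_lt_of_le (hP.left7_lt c hc) (h54.trans h43)),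
      ha' _ _ (lt_of_lt_of_le (hP.right7_lt c hc) (h54.trans h43)),
      if_neg (hP.left7_ne_right7 r hr c hc), add_zero]
    exact if_congr ⟨hP.left7_inj r hr c hc, fun h => by rw [h]⟩ rfl rfl

end Pattern

/-! ## Matrices that are constant along rays -/

section Rays

variable {k : Type u} [Field k]

/-- An entry above the diagonal is moved back to row 0, one below the diagonal forward to row X. The
bound on X keeps the second movement inside the range of `shift`; column 0 is never reached. -/
theorem eq_zero_of_ray {g : ℕ → ℕ → k} {X Y : ℕ} (hXY : X ≤ Y + 1)
    (shift : ∀ x y, x < X → 1 ≤ y → y < Y → g x y = g (x + 1) (y + 1))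
    (zero_left : ∀ y, 1 ≤ y → y ≤ Y → g 0 y = 0)
    (zero_right : ∀ y, 1 ≤ y → y < X → g X y = 0) {x y : ℕ} (hx : x ≤ X) (hy1 : 1 ≤ y)
    (hy : y ≤ Y) (hne : x ≠ y) : g x y = 0 := by
  rcases lt_or_gt_of_ne hne with h | h
  · induction x generalizing y with
    | zero => exact zero_left y hy1 hy
    | succ x ih =>
      obtain ⟨y, rfl⟩ : ∃ z, y = z + 1 := ⟨y - 1, by omega⟩
      rw [← shift x y (by omega) (by omega) (by omega)]
      exact ih (by omega) (by omega) (by omega) (by omega) (by omega)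
  · obtain ⟨m, rfl⟩ : ∃ m, X = x + m := ⟨X - x, by omega⟩
    clear hx hne
    induction m generalizing x y with
    | zero => exact zero_right y hy1 h
    | succ m ih =>
      rw [shift x y (by omega) hy1 (by omega)]
      have he : x + 1 + m = x + (m + 1) := by omega
      exact ih (by omega) (by omega) (by omega) (by rwa [he]) (by rwa [he]) (by rwa [he])

theorem eq_of_ray {A : Type*} {g : ℕ → ℕ → A} {X Y : ℕ}
    (shift : ∀ x y, x < X → 1 ≤ y → y < Y → g x y = g (x + 1) (y + 1)) {x : ℕ} (hx1 : 1 ≤ x)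
    (hx : x ≤ X) (hy : x ≤ Y) : g x x = g 1 1 := by
  induction x, hx1 using Nat.le_induction with
  | base => rfl
  | succ x hx1 ih => rw [← shift x x (by omega) hx1 (by omega), ih (by omega) (by omega)]

/-- Used for the one column not covered by the ray argument, where the equations relate neighbouring
entries only up to sign. -/
theorem eq_zero_of_alternating {h : ℕ → k} {X : ℕ}
    (step : ∀ x, 1 ≤ x → x < X → h x = h (x + 1) ∨ h x = - h (x + 1)) (hX : h X = 0) {x : ℕ}
    (hx1 : 1 ≤ x) (hx : x ≤ X) : h x = 0 := by
  obtain ⟨m, rfl⟩ : ∃ m, X = x + m := ⟨X - x, by omega⟩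
  clear hx
  induction m generalizing x with
  | zero => exact hX
  | succ m ih =>
    have he : x + 1 + m = x + (m + 1) := by omega
    have h0 : h (x + 1) = 0 := ih (by omega) (by rwa [he]) (by rwa [he])
    rcases step x hx1 (by omega) with h1 | h1
    · rw [h1, h0]
    · rw [h1, h0, neg_zero]

end Rays

section Families

/-! ## The families `A` and `B` -/

/-- Truncated subtraction gives `2 * 0 - 1 = 0`, so one formula covers the exceptional first pick.
The excluded case is the simple module at vertex 1, where there is nothing to pick. -/
theorem patternA_isLinkPattern (e : Fin 4) (n : ℕ) (h : 0 < n ∨ 1 ≤ (e : ℕ)) :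
    (patternA e n).IsLinkPattern (fun r => 2 * r - 1) (fun r => 2 * r + 1) (fun r => 2 * r + 2)
      (fun c => 2 * c + 1) (fun c => 2 * c) (fun c => 2 * c + 1) where
  le54 := by simp only [patternA]; split_ifs <;> omega
  le43 := by simp only [patternA]; split_ifs <;> omega
  m31 r c := by simp only [patternA]; exact if_congr (by omega) rfl rfl
  m32 r c := rfl
  m65 r c := rfl
  m75 r c := rfl
  pick1_lt := by simp only [patternA]; intro r hr; split_ifs <;> omega
  left2_lt := by simp only [patternA]; intro r hr; split_ifs <;> omega
  pick6_lt := by simp only [patternA]; intro r hr; split_ifs <;> omega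
  left7_lt := by simp only [patternA]; intro r hr; split_ifs <;> omega
  right7_lt := by simp only [patternA]; intro r hr; split_ifs <;> omega
  pick1_inj := by intros; omega
  left2_inj := by intros; omega
  right2_inj := by intros; omega
  left2_ne_right2 := by intros; omega
  pick6_inj := by intros; omega
  left7_inj := by intros; omega
  right7_inj := by intros; omega
  left7_ne_right7 := by intros; omega

/-- The indices 0, 1, 2, … at vertex 3 form a path whose edges are alternately links of 7 and links
of 2. Vertices 1 and 6 both pick the odd indices, which kills the entries of mixed parity outside
column 0; the link equations then become equalities along diagonals. Index 0, also picked by 1, ends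
the path and lies in no link of 2. -/
theorem patternA_isBrick (e : Fin 4) (n : ℕ) : Pattern.IsBrick.{u} (patternA e n) := by
  by_cases h0 : 0 < n ∨ 1 ≤ (e : ℕ)
  · refine (patternA_isLinkPattern e n h0).isBrick fun k _ F hF => ?_
    obtain ⟨E, hE⟩ : ∃ E, E = (patternA e n).d3 := ⟨_, rfl⟩
    have hE' : E = 2 * n ∨ E = 2 * n + 1 := by
      rw [hE]; simp only [patternA]; split_ifs <;> omega
    have hE1 : 1 ≤ E := by
      rw [hE]; simp only [patternA]; split_ifs <;> omega
    rw [← hE]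
    have mis1 : ∀ p q, p < 2 * n → q < E → (p = 0 ∨ p % 2 = 1) → q ≠ 0 → q % 2 = 0 →
        F p q = 0 := fun p q hp hq hp1 hq0 hq1 => by
      have := hF.pick1 ((p + 1) / 2) (show (p + 1) / 2 < n + 1 by omega) q (hE ▸ hq)
        (fun y _ => by omega)
      rwa [show 2 * ((p + 1) / 2) - 1 = p by omega] at this
    have mis6 : ∀ p q, q < 2 * n → p % 2 = 0 → q % 2 = 1 → F p q = 0 := fun p q hq hp1 hq1 => by
      have := hF.pick6 p (q / 2) (show q / 2 < n by omega) (fun x _ => by omega)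
      rwa [show 2 * (q / 2) + 1 = q by omega] at this
    have link2 : ∀ p q, p < 2 * n → q + 1 < E → p % 2 = 1 → q % 2 = 1 →
        F p q + F (p + 1) q = F p (q + 1) + F (p + 1) (q + 1) := fun p q hp hq hp1 hq1 => by
      have := hF.link2 (p / 2) (show p / 2 < n by omega) (q / 2) (show q / 2 < n by omega)
        (by rw [← hE]; omega)
      rwa [show 2 * (p / 2) + 1 = p by omega, show 2 * (q / 2) + 1 = q by omega,
        show 2 * (p / 2) + 2 = p + 1 by omega, show 2 * (q / 2) + 2 = q + 1 by omega] at this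
    have unlink2 : ∀ p, p < 2 * n → p % 2 = 1 → F p 0 + F (p + 1) 0 = 0 := fun p hp hp1 => by
      have := hF.unlink2 (p / 2) (show p / 2 < n by omega) 0 (by rw [← hE]; omega)
        (fun y _ => by omega)
      rwa [show 2 * (p / 2) + 1 = p by omega, show 2 * (p / 2) + 2 = p + 1 by omega] at this
    have link7 : ∀ p q, p < 2 * n → q < 2 * n → p % 2 = 0 → q % 2 = 0 →
        F p q + F p (q + 1) = F (p + 1) q + F (p + 1) (q + 1) := fun p q hp hq hp1 hq1 => by
      have := hF.link7 (p / 2) (show p / 2 < n by omega) (q / 2) (show q / 2 < n by omega)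
      rwa [show 2 * (p / 2) = p by omega, show 2 * (q / 2) = q by omega] at this
    have unlink7 : ∀ q, q < 2 * n → q % 2 = 0 → F (2 * n) q + F (2 * n) (q + 1) = 0 :=
      fun q hq hq1 => by
        have := hF.unlink7 (2 * n) (q / 2) (show q / 2 < n by omega)
          (fun x (hx : x < n) => by omega)
        rwa [show 2 * (q / 2) = q by omega] at this
    have mis : ∀ p q, p ≤ 2 * n → q < E → q ≠ 0 → p % 2 ≠ q % 2 → F p q = 0 :=
      fun p q hp hq hq0 hpq => by
        by_cases h1 : p % 2 = 0
        · exact mis6 p q (by omega) h1 (by omega)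
        · exact mis1 p q (by omega) hq (by omega) hq0 (by omega)
    have row0 : ∀ q, 1 ≤ q → q < E → F 0 q = 0 := fun q hq1 hq => by
      by_cases h1 : q % 2 = 0
      · exact mis1 0 q (by omega) hq (Or.inl rfl) (by omega) h1
      · exact mis 0 q (by omega) hq (by omega) (by omega)
    -- No link of 7 contains 2n, so the two entries of this row at a link sum to zero, and the pick
    -- at 6 kills the odd one. If the matrix has size 2n, this row is zero by convention.
    have last : ∀ q, q < 2 * n → F (2 * n) q = 0 := fun q hq => by
      by_cases h1 : q % 2 = 0
      · have := unlink7 q hq h1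
        rwa [mis6 (2 * n) (q + 1) (by omega) (by omega) (by omega), add_zero] at this
      · exact mis6 (2 * n) q hq (by omega) (by omega)
    have shift : ∀ x y, x < 2 * n → 1 ≤ y → y < E - 1 → F x y = F (x + 1) (y + 1) := by
      intro x y hx hy1 hy
      by_cases hxy : x % 2 = y % 2
      · have m1 : F (x + 1) y = 0 := mis _ _ (by omega) (by omega) (by omega) (by omega)
        have m2 : F x (y + 1) = 0 := mis _ _ (by omega) (by omega) (by omega) (by omega)
        by_cases h1 : x % 2 = 0
        · have := link7 x y hx (by omega) h1 (by omega)
          rwa [m1, m2, add_zero, zero_add] at this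
        · have := link2 x y hx (by omega) (by omega) (by omega)
          rwa [m1, m2, add_zero, zero_add] at this
      · rw [mis _ _ (by omega) (by omega) (by omega) hxy,
          mis _ _ (by omega) (by omega) (by omega) (by omega)]
    have ray : ∀ p q, p ≤ 2 * n → 1 ≤ q → q < E → p ≠ q → F p q = 0 := fun p q hp hq1 hq hne =>
      eq_zero_of_ray (X := 2 * n) (Y := E - 1) (by omega) shift
        (fun y h1 h2 => row0 y h1 (by omega)) (fun y _ h2 => last y h2) hp hq1 (by omega) hne
    -- Column 0 meets the links of 7 with equality and those of 2 with a change of sign.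
    have col0 : ∀ p, 1 ≤ p → p ≤ 2 * n → F p 0 = 0 := fun p hp1 hp =>
      eq_zero_of_alternating (h := fun p => F p 0) (X := 2 * n) (fun x h1 h2 => by
        by_cases hx : x % 2 = 0
        · left
          have := link7 x 0 h2 (by omega) hx rfl
          rwa [ray x (0 + 1) (by omega) (by omega) (by omega) (by omega),
            ray (x + 1) (0 + 1) (by omega) (by omega) (by omega) (by omega), add_zero,
            add_zero] at this
        · right
          exact eq_neg_of_add_eq_zero_left (unlink2 x h2 (by omega)))
        (last 0 (by omega)) hp1 hp
    refine ⟨F 0 0, fun r hr c hc => ?_⟩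
    split_ifs with hrc
    · subst hrc
      by_cases hr0 : r = 0
      · rw [hr0]
      · rw [eq_of_ray (g := F) shift (x := r) (by omega) (by omega) (by omega)]
        have := link7 0 0 (by omega) (by omega) rfl rfl
        rw [row0 (0 + 1) (by omega) (by omega), col0 (0 + 1) (by omega) (by omega), add_zero,
          zero_add] at this
        exact this.symm
    · by_cases hc0 : c = 0
      · rw [hc0]
        exact col0 r (by omega) (by omega)
      · exact ray r c (by omega) (by omega) hc hrc
  · obtain ⟨rfl, he⟩ : n = 0 ∧ (e : ℕ) = 0 := by omega
    obtain rfl : e = 0 := Fin.ext he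
    intro k _ f hf
    refine ⟨f .v1 0 0, ?_⟩
    rintro (_ | _ | _ | _ | _ | _ | _) r hr c hc
    · change r < 1 at hr
      change c < 1 at hc
      obtain rfl : r = 0 := by omega
      obtain rfl : c = 0 := by omega
      rfl
    all_goals exact (Nat.not_lt_zero r hr).elim

theorem patternB_isLinkPattern (e : Fin 4) (n : ℕ) :
    (patternB e n).IsLinkPattern (fun r => 2 * r) (fun r => 2 * r) (fun r => 2 * r + 1)
      (fun c => 2 * c) (fun c => 2 * c + 1) (fun c => 2 * c + 2) where
  le54 := by simp only [patternB]; split_ifs <;> omega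
  le43 := by simp only [patternB]; split_ifs <;> omega
  m31 r c := rfl
  m32 r c := rfl
  m65 r c := rfl
  m75 r c := rfl
  pick1_lt := by simp only [patternB]; intro r hr; split_ifs <;> omega
  left2_lt := by simp only [patternB]; intro r hr; split_ifs <;> omega
  pick6_lt := by simp only [patternB]; intro r hr; split_ifs <;> omega
  left7_lt := by simp only [patternB]; intro r hr; split_ifs <;> omega
  right7_lt := by simp only [patternB]; intro r hr; split_ifs <;> omega
  pick1_inj := by intros; omega
  left2_inj := by intros; omega
  right2_inj := by intros; omega
  left2_ne_right2 := by intros; omega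
  pick6_inj := by intros; omega
  left7_inj := by intros; omega
  right7_inj := by intros; omega
  left7_ne_right7 := by intros; omega

/-- As for the family A, with links of 2 starting at index 0 and both 1 and 6 picking the even
indices. Here column 0 takes part in the links on the same footing as the other columns. -/
theorem patternB_isBrick (e : Fin 4) (n : ℕ) : Pattern.IsBrick.{u} (patternB e n) := by
  refine (patternB_isLinkPattern e n).isBrick fun k _ F hF => ?_
  obtain ⟨E, hE⟩ : ∃ E, E = (patternB e n).d3 := ⟨_, rfl⟩
  have hE' : E = 2 * n + 1 ∨ E = 2 * n + 2 := by
    rw [hE]; simp only [patternB]; split_ifs <;> omega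
  rw [← hE]
  have mis : ∀ p q, p ≤ 2 * n + 1 → q < E → p % 2 ≠ q % 2 → F p q = 0 := fun p q hp hq hpq => by
    by_cases h1 : p % 2 = 0
    · have := hF.pick1 (p / 2) (show p / 2 < n + 1 by omega) q (hE ▸ hq) (fun y _ => by omega)
      rwa [show 2 * (p / 2) = p by omega] at this
    · have := hF.pick6 p (q / 2) (show q / 2 < n + 1 by omega) (fun x _ => by omega)
      rwa [show 2 * (q / 2) = q by omega] at this
  have link2 : ∀ p q, p ≤ 2 * n → q + 1 < E → p % 2 = 0 → q % 2 = 0 →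
      F p q + F (p + 1) q = F p (q + 1) + F (p + 1) (q + 1) := fun p q hp hq hp1 hq1 => by
    have := hF.link2 (p / 2) (show p / 2 < n + 1 by omega) (q / 2) (show q / 2 < n + 1 by omega)
      (by rw [← hE]; omega)
    rwa [show 2 * (p / 2) = p by omega, show 2 * (q / 2) = q by omega] at this
  have link7 : ∀ p q, p < 2 * n → q < 2 * n → p % 2 = 1 → q % 2 = 1 →
      F p q + F p (q + 1) = F (p + 1) q + F (p + 1) (q + 1) := fun p q hp hq hp1 hq1 => by
    have := hF.link7 (p / 2) (show p / 2 < n by omega) (q / 2) (show q / 2 < n by omega)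
    rwa [show 2 * (p / 2) + 1 = p by omega, show 2 * (q / 2) + 1 = q by omega,
      show 2 * (p / 2) + 2 = p + 1 by omega, show 2 * (q / 2) + 2 = q + 1 by omega] at this
  have unlink7 : ∀ p q, p = 0 ∨ p = 2 * n + 1 → q < 2 * n → q % 2 = 1 →
      F p q + F p (q + 1) = 0 := fun p q hp hq hq1 => by
    have := hF.unlink7 p (q / 2) (show q / 2 < n by omega) (fun x (hx : x < n) => by omega)
    rwa [show 2 * (q / 2) + 1 = q by omega, show 2 * (q / 2) + 2 = q + 1 by omega] at this
  -- The rows 0 and 2n + 1 lie in no link of 7, and in each linked pair of columns one has the wrong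
  -- parity.
  have ends : ∀ p q, p = 0 ∨ p = 2 * n + 1 → 1 ≤ q → q ≤ 2 * n → F p q = 0 :=
    fun p q hp hq1 hq => by
      by_cases hpq : p % 2 = q % 2
      · by_cases h1 : q % 2 = 1
        · have := unlink7 p q hp (by omega) h1
          rwa [mis p (q + 1) (by omega) (by omega) (by omega), add_zero] at this
        · obtain ⟨q, rfl⟩ : ∃ z, q = z + 1 := ⟨q - 1, by omega⟩
          have := unlink7 p q hp (by omega) (by omega)
          rwa [mis p q (by omega) (by omega) (by omega), zero_add] at this
      · exact mis p q (by omega) (by omega) hpq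
  have row0 : ∀ q, 1 ≤ q → q < E → F 0 q = 0 := fun q hq1 hq => by
    by_cases h1 : q = 2 * n + 1
    · exact mis 0 q (by omega) hq (by omega)
    · exact ends 0 q (Or.inl rfl) hq1 (by omega)
  have last : ∀ q, q ≤ 2 * n → F (2 * n + 1) q = 0 := fun q hq => by
    by_cases h1 : q = 0
    · exact mis _ q le_rfl (by omega) (by omega)
    · exact ends _ q (Or.inr rfl) (by omega) (by omega)
  have shift : ∀ x y, x ≤ 2 * n → y + 1 < E → F x y = F (x + 1) (y + 1) := by
    intro x y hx hy
    by_cases hxy : x % 2 = y % 2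
    · have m1 : F (x + 1) y = 0 := mis _ _ (by omega) (by omega) (by omega)
      have m2 : F x (y + 1) = 0 := mis _ _ (by omega) (by omega) (by omega)
      by_cases h1 : x % 2 = 0
      · have := link2 x y hx (by omega) h1 (by omega)
        rwa [m1, m2, add_zero, zero_add] at this
      · have := link7 x y (by omega) (by omega) (by omega) (by omega)
        rwa [m1, m2, add_zero, zero_add] at this
    · rw [mis _ _ (by omega) (by omega) hxy, mis _ _ (by omega) (by omega) (by omega)]
  -- Moving both indices by one and adding a zero row makes column 0 available to the ray lemmas,
  -- which start at column 1.
  let g : ℕ → ℕ → k := fun x y => if x = 0 then 0 else F (x - 1) (y - 1)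
  have hg : ∀ x y, g (x + 1) (y + 1) = F x y := fun x y => rfl
  have gshift : ∀ x y, x < 2 * n + 2 → 1 ≤ y → y < E → g x y = g (x + 1) (y + 1) := by
    intro x y hx hy1 hy
    obtain ⟨y, rfl⟩ : ∃ z, y = z + 1 := ⟨y - 1, by omega⟩
    rcases x with _ | x
    · exact (row0 (y + 1) (by omega) hy).symm
    · exact shift x y (by omega) hy
  refine ⟨F 0 0, fun r hr c hc => ?_⟩
  rw [← hg r c]
  split_ifs with hrc
  · subst hrc
    exact eq_of_ray gshift (by omega) (by omega) (by omega)
  · exact eq_zero_of_ray (X := 2 * n + 2) (Y := E) (by omega) gshift (fun y _ _ => rfl)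
      (fun y h1 h2 => last (y - 1) (by omega)) (by omega) (by omega) (by omega) (by omega)

end Families

section FamilyC

/-! ## The family `C` -/

/-- The position `p` along the coefficient quiver of `patternC` belongs to the basis vector with
this index. -/
def pathIndex (n p : ℕ) : ℕ :=
  if p = 0 then 2 * n else if p = 2 * n + 1 then 2 * n + 1 else p - 1

theorem pathIndex_inj {n p q : ℕ} (hp : p ≤ 2 * n + 1) (hq : q ≤ 2 * n + 1)
    (h : pathIndex n p = pathIndex n q) : p = q := by
  unfold pathIndex at h
  split_ifs at h <;> omega

theorem leftIndex_eq {n r : ℕ} (hr : r ≤ n) : leftIndex n r = pathIndex n (2 * r) := by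
  unfold leftIndex pathIndex
  split_ifs <;> first | contradiction | omega

theorem rightIndex_eq (n r : ℕ) : rightIndex n r = pathIndex n (2 * r + 1) := by
  unfold rightIndex pathIndex
  split_ifs <;> first | contradiction | omega

/-- A matrix in positions along the path with center `n` is a scalar if it satisfies the conditions
imposed by the links, and if the center separates the picks. -/
theorem exists_scalar_of_center {k : Type u} [Field k] {G : ℕ → ℕ → k} {n E : ℕ}
    (hE : E = 2 * n + 1 ∨ E = 2 * n + 2)
    (mis : ∀ p q, p ≤ 2 * n + 1 → q < E → p ≠ n → q ≠ n →
      ((p < n ↔ q < n) ↔ p % 2 ≠ q % 2) → G p q = 0)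
    (center : ∀ q, q < E → q ≠ n → G n q = 0)
    (even : ∀ p q, p ≤ 2 * n → q + 1 < E → p % 2 = 0 → q % 2 = 0 →
      G p q + G (p + 1) q = G p (q + 1) + G (p + 1) (q + 1))
    (odd : ∀ p q, p < 2 * n → q < 2 * n → p % 2 = 1 → q % 2 = 1 →
      G p q + G p (q + 1) = G (p + 1) q + G (p + 1) (q + 1))
    (first : ∀ q, q < 2 * n → q % 2 = 1 → G 0 q + G 0 (q + 1) = 0)
    (last : ∀ q, q ≤ 2 * n → G (2 * n + 1) q = 0) :
    ∀ p < E, ∀ q < E, G p q = if p = q then G n n else 0 := by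
  -- Of two linked columns exactly one is mismatched with position 0, or is the center when the
  -- other is; the vanishing sum kills both.
  have first' : ∀ q, 1 ≤ q → q ≤ 2 * n → G 0 q = 0 := by
    have key : ∀ q, q < 2 * n → q % 2 = 1 → G 0 q = 0 ∧ G 0 (q + 1) = 0 := fun q hq hq1 => by
      have h := first q hq hq1
      by_cases h1 : q < n
      · have h2 : G 0 q = 0 := mis _ _ (by omega) (by omega) (by omega) (by omega) (by omega)
        rw [h2, zero_add] at h
        exact ⟨h2, h⟩
      · have h2 : G 0 (q + 1) = 0 :=
          mis _ _ (by omega) (by omega) (by omega) (by omega) (by omega)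
        rw [h2, add_zero] at h
        exact ⟨h, h2⟩
    intro q hq1 hq
    by_cases h1 : q % 2 = 1
    · exact (key q (by omega) h1).1
    · obtain ⟨q, rfl⟩ : ∃ z, q = z + 1 := ⟨q - 1, by omega⟩
      exact (key q (by omega) (by omega)).2
  -- On one side of the center the picks alternate with the parity, so the mixed terms of a link
  -- equation vanish and entries move along diagonals.
  have same : ∀ p q, p ≤ 2 * n → q + 1 < E → (n ≤ p ∧ n ≤ q ∨ p < n ∧ q < n) →
      (n ≤ p → n < q) → (p < n → q + 1 < n) → G p q = G (p + 1) (q + 1) := by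
    intro p q hp hq hside hr hl
    have z : ∀ a b, a ≤ 2 * n + 1 → b < E → b ≠ n → (a = n ∨ ((a < n ↔ b < n) ↔ a % 2 ≠ b % 2)) →
        G a b = 0 := fun a b ha hb hbn h => by
      by_cases han : a = n
      · rw [han]; exact center b hb hbn
      · exact mis a b ha hb han hbn (h.resolve_left han)
    by_cases hpq : p % 2 = q % 2
    · have m1 : G (p + 1) q = 0 := z _ _ (by omega) (by omega) (by omega) (by omega)
      have m2 : G p (q + 1) = 0 := z _ _ (by omega) (by omega) (by omega) (by omega)
      by_cases h1 : p % 2 = 0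
      · have := even p q hp hq h1 (by omega)
        rwa [m1, m2, add_zero, zero_add] at this
      · have := odd p q (by omega) (by omega) (by omega) (by omega)
        rwa [m1, m2, add_zero, zero_add] at this
    · rw [z p q (by omega) (by omega) (by omega) (by omega),
        z (p + 1) (q + 1) (by omega) (by omega) (by omega) (by omega)]
  -- The parity of the picked positions changes at the center, so between opposite sides the
  -- diagonal terms vanish and entries move along antidiagonals.
  have cross : ∀ p q, p ≤ 2 * n → q + 1 < E → (n ≤ p ∧ q + 1 < n ∨ p < n ∧ n < q) →
      G p (q + 1) = G (p + 1) q := by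
    intro p q hp hq hside
    have z : ∀ a b, a ≤ 2 * n + 1 → b < E → b ≠ n → (a = n ∨ ((a < n ↔ b < n) ↔ a % 2 ≠ b % 2)) →
        G a b = 0 := fun a b ha hb hbn h => by
      by_cases han : a = n
      · rw [han]; exact center b hb hbn
      · exact mis a b ha hb han hbn (h.resolve_left han)
    by_cases hpq : p % 2 = q % 2
    · have m1 : G p q = 0 := z _ _ (by omega) (by omega) (by omega) (by omega)
      have m2 : G (p + 1) (q + 1) = 0 := z _ _ (by omega) (by omega) (by omega) (by omega)
      by_cases h1 : p % 2 = 0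
      · have := even p q hp hq h1 (by omega)
        rw [m1, m2, add_zero, zero_add] at this
        exact this.symm
      · have := odd p q (by omega) (by omega) (by omega) (by omega)
        rwa [m1, m2, add_zero, zero_add] at this
    · rw [z p (q + 1) (by omega) (by omega) (by omega) (by omega),
        z (p + 1) q (by omega) (by omega) (by omega) (by omega)]
  have shiftRR : ∀ x y, x < n + 1 → 1 ≤ y → y < E - 1 - n →
      G (n + x) (n + y) = G (n + (x + 1)) (n + (y + 1)) := fun x y hx hy1 hy =>
    same (n + x) (n + y) (by omega) (by omega) (by omega) (by omega) (by omega)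
  have shiftLL : ∀ x y, x < n → 1 ≤ y → y < n →
      G (n - x) (n - y) = G (n - (x + 1)) (n - (y + 1)) := fun x y hx hy1 hy => by
    have := same (n - (x + 1)) (n - (y + 1)) (by omega) (by omega) (by omega) (by omega) (by omega)
    rw [this, show n - (x + 1) + 1 = n - x by omega, show n - (y + 1) + 1 = n - y by omega]
  have shiftRL : ∀ x y, x < n + 1 → 1 ≤ y → y < n →
      G (n + x) (n - y) = G (n + (x + 1)) (n - (y + 1)) := fun x y hx hy1 hy => by
    have := cross (n + x) (n - (y + 1)) (by omega) (by omega) (by omega)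
    rwa [show n - (y + 1) + 1 = n - y by omega] at this
  have shiftLR : ∀ x y, x < n → 1 ≤ y → y < E - 1 - n →
      G (n - x) (n + y) = G (n - (x + 1)) (n + (y + 1)) := fun x y hx hy1 hy => by
    have := cross (n - (x + 1)) (n + y) (by omega) (by omega) (by omega)
    rw [show n - (x + 1) + 1 = n - x by omega] at this
    exact this.symm
  -- In terms of distances x, y from the center, entries in all four quadrants are constant along
  -- rays, which run into the center row or into an end row. Between opposite sides even the entries
  -- with x = y vanish, by mismatch.
  have right_right : ∀ x y, x ≤ n + 1 → 1 ≤ y → n + y < E → x ≠ y → G (n + x) (n + y) = 0 :=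
    fun x y hx hy1 hy hne =>
      eq_zero_of_ray (g := fun x y => G (n + x) (n + y)) (X := n + 1) (Y := E - 1 - n) (by omega)
        shiftRR (fun y h1 h2 => center _ (by omega) (by omega))
        (fun y h1 h2 => by
          have := last (n + y) (by omega)
          rwa [show 2 * n + 1 = n + (n + 1) by omega] at this) hx hy1 (by omega) hne
  have left_left : ∀ x y, x ≤ n → 1 ≤ y → y ≤ n → x ≠ y → G (n - x) (n - y) = 0 :=
    fun x y hx hy1 hy hne =>
      eq_zero_of_ray (g := fun x y => G (n - x) (n - y)) (X := n) (Y := n) (by omega)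
        shiftLL (fun y h1 h2 => center _ (by omega) (by omega))
        (fun y h1 h2 => by
          have := first' (n - y) (by omega) (by omega)
          rwa [show 0 = n - n by omega] at this) hx hy1 hy hne
  have right_left : ∀ x y, x ≤ n + 1 → 1 ≤ y → y ≤ n → G (n + x) (n - y) = 0 :=
    fun x y hx hy1 hy => by
      by_cases hne : x = y
      · exact mis _ _ (by omega) (by omega) (by omega) (by omega) (by omega)
      exact eq_zero_of_ray (g := fun x y => G (n + x) (n - y)) (X := n + 1) (Y := n) (by omega)
        shiftRL (fun y h1 h2 => center _ (by omega) (by omega))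
        (fun y h1 h2 => by
          have := last (n - y) (by omega)
          rwa [show 2 * n + 1 = n + (n + 1) by omega] at this) hx hy1 hy hne
  have left_right : ∀ x y, x ≤ n → 1 ≤ y → n + y < E → G (n - x) (n + y) = 0 :=
    fun x y hx hy1 hy => by
      by_cases hne : x = y
      · by_cases hx0 : x = 0
        · omega
        exact mis _ _ (by omega) (by omega) (by omega) (by omega) (by omega)
      exact eq_zero_of_ray (g := fun x y => G (n - x) (n + y)) (X := n) (Y := E - 1 - n) (by omega)
        shiftLR (fun y h1 h2 => center _ (by omega) (by omega))
        (fun y h1 h2 => by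
          have := first' (n + y) (by omega) (by omega)
          rwa [show 0 = n - n by omega] at this) hx hy1 (by omega) hne
  -- The center column follows the links outwards up to sign, until it reaches an end row.
  have right_center : ∀ x, 1 ≤ x → x ≤ n + 1 → G (n + x) n = 0 := fun x hx1 hx =>
    eq_zero_of_alternating (h := fun x => G (n + x) n) (X := n + 1) (fun x h1 h2 => by
      have hn : 1 ≤ n := by omega
      by_cases hx : (n + x) % 2 = 0
      · right
        apply eq_neg_of_add_eq_zero_left
        by_cases hn2 : n % 2 = 0
        · have := even (n + x) n (by omega) (by omega) hx hn2
          rw [right_right x 1 (by omega) le_rfl (by omega) (by omega), add_assoc n x 1,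
            right_right (x + 1) 1 (by omega) le_rfl (by omega) (by omega), add_zero] at this
          exact this
        · have := even (n + x) (n - 1) (by omega) (by omega) hx (by omega)
          rw [right_left x 1 (by omega) le_rfl hn, add_assoc n x 1,
            right_left (x + 1) 1 (by omega) le_rfl hn, zero_add, Nat.sub_add_cancel hn] at this
          exact this.symm
      · left
        by_cases hn2 : n % 2 = 0
        · have := odd (n + x) (n - 1) (by omega) (by omega) (by omega) (by omega)
          rw [right_left x 1 (by omega) le_rfl hn, add_assoc n x 1,
            right_left (x + 1) 1 (by omega) le_rfl hn, zero_add, zero_add,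
            Nat.sub_add_cancel hn] at this
          exact this
        · have := odd (n + x) n (by omega) (by omega) (by omega) (by omega)
          rw [right_right x 1 (by omega) le_rfl (by omega) (by omega), add_assoc n x 1,
            right_right (x + 1) 1 (by omega) le_rfl (by omega) (by omega), add_zero,
            add_zero] at this
          exact this)
      (by
        have := last n (by omega)
        rwa [show 2 * n + 1 = n + (n + 1) by omega] at this) hx1 hx
  have left_center : ∀ x, 1 ≤ x → x ≤ n → G (n - x) n = 0 := fun x hx1 hx =>
    eq_zero_of_alternating (h := fun x => G (n - x) n) (X := n) (fun x h1 h2 => by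
      have hx' : n - (x + 1) + 1 = n - x := by omega
      by_cases hx : (n - (x + 1)) % 2 = 0
      · right
        apply eq_neg_of_add_eq_zero_right
        by_cases hn2 : n % 2 = 0
        · have := even (n - (x + 1)) n (by omega) (by omega) hx hn2
          rw [hx', left_right x 1 (by omega) le_rfl (by omega),
            left_right (x + 1) 1 (by omega) le_rfl (by omega), add_zero] at this
          exact this
        · have := even (n - (x + 1)) (n - 1) (by omega) (by omega) hx (by omega)
          rw [hx', left_left x 1 (by omega) le_rfl (by omega) (by omega),
            left_left (x + 1) 1 (by omega) le_rfl (by omega) (by omega), zero_add,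
            Nat.sub_add_cancel (by omega)] at this
          exact this.symm
      · left
        by_cases hn2 : n % 2 = 0
        · have := odd (n - (x + 1)) (n - 1) (by omega) (by omega) (by omega) (by omega)
          rw [hx', left_left x 1 (by omega) le_rfl (by omega) (by omega),
            left_left (x + 1) 1 (by omega) le_rfl (by omega) (by omega), zero_add, zero_add,
            Nat.sub_add_cancel (by omega)] at this
          exact this.symm
        · have := odd (n - (x + 1)) n (by omega) (by omega) (by omega) (by omega)
          rw [hx', left_right x 1 (by omega) le_rfl (by omega),
            left_right (x + 1) 1 (by omega) le_rfl (by omega), add_zero, add_zero] at this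
          exact this.symm)
      (by
        by_cases hn : n = 0
        · omega
        have := first' n (by omega) (by omega)
        rwa [show 0 = n - n by omega] at this) hx1 hx
  -- The link on either side of the center carries the scalar across; beyond it the diagonal is
  -- constant.
  have diag_right : n + 1 < E → G (n + 1) (n + 1) = G n n := fun hlt => by
    have h1 := center (n + 1) hlt (by omega)
    have h2 := right_center 1 le_rfl (by omega)
    by_cases hn2 : n % 2 = 0
    · have := even n n (by omega) hlt hn2 hn2
      rw [h1, h2, add_zero, zero_add] at this
      exact this.symm
    · have := odd n n (by omega) (by omega) (by omega) (by omega)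
      rw [h1, h2, add_zero, zero_add] at this
      exact this.symm
  have diag_left : 1 ≤ n → G (n - 1) (n - 1) = G n n := fun hn => by
    have h1 := center (n - 1) (by omega) (by omega)
    have h2 := left_center 1 le_rfl hn
    have h3 : n - 1 + 1 = n := by omega
    by_cases hn2 : n % 2 = 0
    · have := odd (n - 1) (n - 1) (by omega) (by omega) (by omega) (by omega)
      rwa [h3, h1, h2, add_zero, zero_add] at this
    · have := even (n - 1) (n - 1) (by omega) (by omega) (by omega) (by omega)
      rwa [h3, h1, h2, add_zero, zero_add] at this
  intro p hp q hq
  rcases lt_trichotomy q n with hqn | hqn | hqn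
  · obtain ⟨y, hy⟩ : ∃ y, q = n - y := ⟨n - q, by omega⟩
    obtain ⟨y, hy1, hyn, rfl⟩ : ∃ y, 1 ≤ y ∧ y ≤ n ∧ q = n - y :=
      ⟨n - q, by omega, by omega, by omega⟩
    rcases le_or_gt n p with hpn | hpn
    · obtain ⟨x, rfl⟩ : ∃ x, p = n + x := ⟨p - n, by omega⟩
      rw [if_neg (by omega)]
      exact right_left x y (by omega) hy1 hyn
    · obtain ⟨x, hx1, hxn, rfl⟩ : ∃ x, 1 ≤ x ∧ x ≤ n ∧ p = n - x :=
        ⟨n - p, by omega, by omega, by omega⟩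
      split_ifs with h
      · obtain rfl : x = y := by omega
        exact (eq_of_ray (g := fun x y => G (n - x) (n - y)) shiftLL hx1 hxn hyn).trans
          (diag_left (by omega))
      · exact left_left x y hxn hy1 hyn (by omega)
  · subst hqn
    rcases lt_trichotomy p q with hpn | hpn | hpn
    · obtain ⟨x, hx1, hxn, rfl⟩ : ∃ x, 1 ≤ x ∧ x ≤ q ∧ p = q - x :=
        ⟨q - p, by omega, by omega, by omega⟩
      rw [if_neg (by omega)]
      exact left_center x hx1 hxn
    · rw [if_pos hpn, hpn]
    · obtain ⟨x, rfl⟩ : ∃ x, p = q + x := ⟨p - q, by omega⟩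
      rw [if_neg (by omega)]
      exact right_center x (by omega) (by omega)
  · obtain ⟨y, rfl⟩ : ∃ y, q = n + y := ⟨q - n, by omega⟩
    rcases le_or_gt n p with hpn | hpn
    · obtain ⟨x, rfl⟩ : ∃ x, p = n + x := ⟨p - n, by omega⟩
      split_ifs with h
      · obtain rfl : x = y := by omega
        exact (eq_of_ray (g := fun x y => G (n + x) (n + y)) shiftRR (X := n + 1)
          (Y := E - 1 - n) (by omega) (by omega) (by omega)).trans (diag_right (by omega))
      · exact right_right x y (by omega) (by omega) hq (by omega)
    · obtain ⟨x, hx1, hxn, rfl⟩ : ∃ x, 1 ≤ x ∧ x ≤ n ∧ p = n - x :=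
        ⟨n - p, by omega, by omega, by omega⟩
      rw [if_neg (by omega)]
      exact left_right x y hxn (by omega) hq

end FamilyC

/-! ### The patterns of the family `C` are bricks -/

section FamilyC

theorem patternC_d3 {e e' : Fin 4} (h : e' < e) (n : ℕ) :
    (patternC e e' n).d3 = 2 * n + 1 ∨ (patternC e e' n).d3 = 2 * n + 2 := by
  have h' : (e' : ℕ) < e := h
  simp only [patternC]
  split_ifs <;> omega

theorem patternC_isLinkPattern {e e' : Fin 4} (h : e' < e) (n : ℕ) :
    (patternC e e' n).IsLinkPattern
      (fun r => if n ≤ 2 * r then leftIndex n r else rightIndex n r) (leftIndex n) (rightIndex n)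
      (fun c => if n ≤ 2 * c + 1 then 2 * c + 1 else 2 * c) (fun c => 2 * c)
      (fun c => 2 * c + 1) where
  le54 := by simp only [patternC]; split_ifs <;> omega
  le43 := by simp only [patternC]; split_ifs <;> omega
  m31 r c := rfl
  m32 r c := rfl
  m65 r c := rfl
  m75 r c := rfl
  pick1_lt := by
    intro r hr
    change r < n + 1 at hr
    have := patternC_d3 h n
    simp only [leftIndex, rightIndex]
    split_ifs <;> omega
  left2_lt := by
    intro r hr
    change r < n + 1 at hr
    have := patternC_d3 h n
    simp only [leftIndex]
    split_ifs <;> omega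
  pick6_lt := by simp only [patternC]; intro r hr; split_ifs <;> omega
  left7_lt := by simp only [patternC]; intro r hr; omega
  right7_lt := by simp only [patternC]; intro r hr; omega
  pick1_inj := by
    intro r hr y hy
    change r < n + 1 at hr
    change y < n + 1 at hy
    simp only [leftIndex, rightIndex]
    split_ifs <;> omega
  left2_inj := by
    intro r hr y hy
    change r < n + 1 at hr
    change y < n + 1 at hy
    simp only [leftIndex]
    split_ifs <;> omega
  right2_inj := by
    intro r hr y hy
    change r < n + 1 at hr
    change y < n + 1 at hy
    simp only [rightIndex]
    split_ifs <;> omega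
  left2_ne_right2 := by
    intro r hr y hy
    change r < n + 1 at hr
    change y < n + 1 at hy
    simp only [leftIndex, rightIndex]
    split_ifs <;> omega
  pick6_inj := by
    intro r _ y _
    split_ifs <;> omega
  left7_inj := by intros; omega
  right7_inj := by intros; omega
  left7_ne_right7 := by intros; omega

/-- In positions along the path, vertex 6 picks the odd positions left of n and the even ones right
of n; vertex 1 picks these and the center n. So only the center is treated differently by 1 and 6,
which isolates its row. -/
theorem patternC_isBrick {e e' : Fin 4} (h : e' < e) (n : ℕ) :
    Pattern.IsBrick.{u} (patternC e e' n) := by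
  refine (patternC_isLinkPattern h n).isBrick fun k _ F hF => ?_
  obtain ⟨E, hE⟩ : ∃ E, E = (patternC e e' n).d3 := ⟨_, rfl⟩
  have hE' : E = 2 * n + 1 ∨ E = 2 * n + 2 := hE ▸ patternC_d3 h n
  have hlt : ∀ q, q < E → pathIndex n q < (patternC e e' n).d3 := fun q hq => by
    rw [← hE]
    unfold pathIndex
    split_ifs <;> omega
  have mid : ∀ q, 1 ≤ q → q ≤ 2 * n → pathIndex n q = q - 1 := fun q hq1 hq => by
    unfold pathIndex
    split_ifs <;> omega
  have hpick1 : ∀ r, r ≤ n → (if n ≤ 2 * r then leftIndex n r else rightIndex n r) =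
      pathIndex n (if n ≤ 2 * r then 2 * r else 2 * r + 1) := fun r hr => by
    rw [leftIndex_eq hr, rightIndex_eq]
    split_ifs <;> rfl
  have hpick6 : ∀ c, c < n → (if n ≤ 2 * c + 1 then 2 * c + 1 else 2 * c) =
      pathIndex n (if n ≤ 2 * c + 1 then 2 * c + 2 else 2 * c + 1) := fun c hc => by
    split_ifs <;> rw [mid _ (by omega) (by omega)] <;> omega
  have mis1 : ∀ p q, p ≤ 2 * n + 1 → q < E → (n ≤ p ∧ p % 2 = 0 ∨ p ≤ n ∧ p % 2 = 1) →
      ¬ (n ≤ q ∧ q % 2 = 0 ∨ q ≤ n ∧ q % 2 = 1) →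
      F (pathIndex n p) (pathIndex n q) = 0 := fun p q hp hq hpS hqS => by
    have := hF.pick1 (p / 2) (show p / 2 < n + 1 by omega) (pathIndex n q) (hlt q hq)
      (fun y (hy : y < n + 1) hqy => by
        rw [hpick1 y (by omega)] at hqy
        have := pathIndex_inj (by omega) (by split_ifs <;> omega) hqy
        split_ifs at this <;> omega)
    rw [hpick1 _ (by omega)] at this
    rwa [show (if n ≤ 2 * (p / 2) then 2 * (p / 2) else 2 * (p / 2) + 1) = p by
      split_ifs <;> omega] at this
  have mis6 : ∀ p q, p ≤ 2 * n + 1 → q < E → (n < q ∧ q % 2 = 0 ∨ q < n ∧ q % 2 = 1) →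
      ¬ (n < p ∧ p % 2 = 0 ∨ p < n ∧ p % 2 = 1) →
      F (pathIndex n p) (pathIndex n q) = 0 := fun p q hp hq hqS hpS => by
    have := hF.pick6 (pathIndex n p) ((q - 1) / 2) (show (q - 1) / 2 < n by omega)
      (fun y (hy : y < n) hpy => by
        rw [hpick6 y hy] at hpy
        have := pathIndex_inj (by omega) (by split_ifs <;> omega) hpy
        split_ifs at this <;> omega)
    rw [hpick6 _ (by omega)] at this
    rwa [show (if n ≤ 2 * ((q - 1) / 2) + 1 then 2 * ((q - 1) / 2) + 2
      else 2 * ((q - 1) / 2) + 1) = q by split_ifs <;> omega] at this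
  -- As e' < e, some t_q equals 1, so one of the flag spaces at 3, 4, 5 is spanned by the basis
  -- vectors of index at most 2n. Invariance of this space kills the row 2n + 1 in these columns.
  have hflag : ∀ q, q ≤ 2 * n → F (2 * n + 1) (pathIndex n q) = 0 := fun q hq => by
    have hq' : pathIndex n q < 2 * n + 1 := by
      unfold pathIndex
      split_ifs <;> omega
    have hee : (e' : ℕ) < e := h
    by_cases h3 : (patternC e e' n).d3 = 2 * n + 1
    · exact hF.zero _ _ (Or.inl h3.le)
    by_cases h4 : (patternC e e' n).d4 = 2 * n + 1
    · exact hF.flag4 _ _ h4.le (h4 ▸ hq')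
    have h5 : (patternC e e' n).d5 = 2 * n + 1 := by
      simp only [patternC] at h3 h4 ⊢
      split_ifs at h3 h4 ⊢ <;> omega
    exact hF.flag5 _ _ h5.le (h5 ▸ hq')
  have hG := exists_scalar_of_center (G := fun p q => F (pathIndex n p) (pathIndex n q)) hE'
    (fun p q hp hq hpn hqn hpq => by
      by_cases hpS : n < p ∧ p % 2 = 0 ∨ p < n ∧ p % 2 = 1
      · exact mis1 p q hp hq (by omega) (by omega)
      · exact mis6 p q hp hq (by omega) (by omega))
    (fun q hq hqn => by
      by_cases hqS : n < q ∧ q % 2 = 0 ∨ q < n ∧ q % 2 = 1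
      · exact mis6 n q (by omega) hq hqS (by omega)
      · exact mis1 n q (by omega) hq (by omega) (by omega))
    (fun p q hp hq hp2 hq2 => by
      obtain ⟨r, rfl⟩ : ∃ r, p = 2 * r := ⟨p / 2, by omega⟩
      obtain ⟨y, rfl⟩ : ∃ y, q = 2 * y := ⟨q / 2, by omega⟩
      have hr : r ≤ n := by omega
      have hy : y ≤ n := by omega
      have := hF.link2 r (show r < n + 1 by omega) y (show y < n + 1 by omega)
        (by rw [rightIndex_eq]; exact hlt _ hq)
      rwa [leftIndex_eq hr, leftIndex_eq hy, rightIndex_eq, rightIndex_eq] at this)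
    (fun p q hp hq hp2 hq2 => by
      have := hF.link7 (p / 2) (show p / 2 < n by omega) (q / 2) (show q / 2 < n by omega)
      rw [mid p (by omega) (by omega), mid q (by omega) (by omega),
        mid (p + 1) (by omega) (by omega), mid (q + 1) (by omega) (by omega)]
      rwa [show 2 * (p / 2) = p - 1 by omega, show 2 * (q / 2) = q - 1 by omega,
        show p - 1 + 1 = p + 1 - 1 by omega, show q - 1 + 1 = q + 1 - 1 by omega] at this)
    (fun q hq hq2 => by
      have := hF.unlink7 (2 * n) (q / 2) (show q / 2 < n by omega)
        (fun x (hx : x < n) => by omega)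
      rw [mid q (by omega) (by omega), mid (q + 1) (by omega) (by omega)]
      rwa [show 2 * (q / 2) = q - 1 by omega, show q - 1 + 1 = q + 1 - 1 by omega] at this)
    (fun q hq => by
      have := hflag q hq
      rwa [show 2 * n + 1 = pathIndex n (2 * n + 1) by
        unfold pathIndex; split_ifs <;> first | contradiction | rfl] at this)
  have hsurj : ∀ r, r < E → ∃ p, p < E ∧ pathIndex n p = r := fun r hr => by
    by_cases h1 : r = 2 * n
    · exact ⟨0, by omega, h1 ▸ rfl⟩
    by_cases h2 : r = 2 * n + 1
    · refine ⟨r, hr, ?_⟩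
      unfold pathIndex
      split_ifs <;> omega
    · exact ⟨r + 1, by omega, by rw [mid _ (by omega) (by omega)]; omega⟩
  refine ⟨F (pathIndex n n) (pathIndex n n), fun r hr c hc => ?_⟩
  obtain ⟨p, hp, rfl⟩ := hsurj r (hE ▸ hr)
  obtain ⟨q, hq, rfl⟩ := hsurj c (hE ▸ hc)
  rw [hG p hp q hq]
  exact if_congr ⟨fun h => by rw [h], fun h => pathIndex_inj (by omega) (by omega) h⟩ rfl rfl

end FamilyC

section TreeBricks

/-! ## The representations of the list are tree bricks -/

theorem bit_ite (p : Prop) [Decidable p] : (if p then (1 : ℤ) else 0) = 0 ∨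
    (if p then (1 : ℤ) else 0) = 1 :=
  (ite_eq_or_eq _ _ _).symm

theorem sum_indicator_eq {n a : ℕ} (ha : a < n) :
    ∑ x ∈ Finset.range n, (if x = a then (1 : ℤ) else 0) = 1 := by
  rw [Finset.sum_ite_eq', if_pos (Finset.mem_range.2 ha)]

theorem sum_indicator_or {n a b : ℕ} (hab : a ≠ b) :
    ∑ x ∈ Finset.range n, (if x = a ∨ x = b then (1 : ℤ) else 0) =
      (if a < n then 1 else 0) + if b < n then 1 else 0 := by
  simp only [← Finset.mem_range, ← Finset.sum_ite_eq' (Finset.range n) _ (fun _ => (1 : ℤ))]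
  rw [← Finset.sum_add_distrib]
  refine Finset.sum_congr rfl fun x _ => ?_
  by_cases h1 : x = a
  · have h2 : x ≠ b := fun h => hab (h1.symm.trans h)
    simp [h1, hab]
  · simp [h1]

/-- A pick contributes one entry and a link two, except a link of 2 whose right end is out of range;
m counts the links of 2 inside the range. The tree count amounts to m + d₇ links joining the d₃
basis vectors of vertex 3 into a path. -/
theorem Pattern.IsLinkPattern.entries {P : Pattern} {pick1 left2 right2 pick6 left7 right7 : ℕ → ℕ}
    (hP : P.IsLinkPattern pick1 left2 right2 pick6 left7 right7) {m : ℕ} (hm : m ≤ P.d2)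
    (hright : ∀ r < P.d2, right2 r < P.d3 ↔ r < m) (hd3 : m + P.d7 + 1 = P.d3) :
    P.entrySum + 1 = P.d1 + P.d2 + P.d3 + P.d4 + P.d5 + P.d6 + P.d7 := by
  have s31 : ∑ r ∈ Finset.range P.d1, ∑ c ∈ Finset.range P.d3, P.m31 r c = P.d1 := by
    rw [Finset.sum_congr rfl fun r hr => ?_, Finset.sum_const, Finset.card_range, nsmul_one]
    simp only [hP.m31]
    exact sum_indicator_eq (hP.pick1_lt r (Finset.mem_range.1 hr))
  have s32 : ∑ r ∈ Finset.range P.d2, ∑ c ∈ Finset.range P.d3, P.m32 r c = P.d2 + m := by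
    have h1 : ∀ r ∈ Finset.range P.d2, ∑ c ∈ Finset.range P.d3, P.m32 r c =
        1 + if r < m then 1 else 0 := fun r hr => by
      have hr' := Finset.mem_range.1 hr
      simp only [hP.m32]
      rw [sum_indicator_or (hP.left2_ne_right2 r hr' r hr'), if_pos (hP.left2_lt r hr'),
        if_congr (hright r hr') rfl rfl]
    rw [Finset.sum_congr rfl h1, Finset.sum_add_distrib, Finset.sum_const, Finset.card_range,
      nsmul_one, Finset.sum_boole]
    have h2 : (Finset.range P.d2).filter (· < m) = Finset.range m := by
      ext x
      simp only [Finset.mem_filter, Finset.mem_range]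
      omega
    rw [h2, Finset.card_range]
  have s65 : ∑ r ∈ Finset.range P.d5, ∑ c ∈ Finset.range P.d6, P.m65 r c = P.d6 := by
    rw [Finset.sum_comm, Finset.sum_congr rfl fun r hr => ?_, Finset.sum_const, Finset.card_range,
      nsmul_one]
    simp only [hP.m65]
    exact sum_indicator_eq (hP.pick6_lt r (Finset.mem_range.1 hr))
  have s75 : ∑ r ∈ Finset.range P.d5, ∑ c ∈ Finset.range P.d7, P.m75 r c = P.d7 * 2 := by
    rw [Finset.sum_comm, Finset.sum_congr rfl fun r hr => ?_, Finset.sum_const, Finset.card_range,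
      nsmul_eq_mul]
    have hr' := Finset.mem_range.1 hr
    simp only [hP.m75]
    rw [sum_indicator_or (hP.left7_ne_right7 r hr' r hr'), if_pos (hP.left7_lt r hr'),
      if_pos (hP.right7_lt r hr')]
    rfl
  rw [Pattern.entrySum, s31, s32, s65, s75, min_eq_right hP.le43, min_eq_right hP.le54]
  have h3 : (m : ℤ) + P.d7 + 1 = P.d3 := by exact_mod_cast hd3
  linarith

theorem patternA_isTreeBrick (e : Fin 4) (n : ℕ) : Pattern.IsTreeBrick.{u} (patternA e n) where
  bit31 _ _ := bit_ite _
  bit32 _ _ := bit_ite _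
  bit65 _ _ := bit_ite _
  bit75 _ _ := bit_ite _
  brick := patternA_isBrick e n
  root := by
    fin_cases e <;> simp [patternA] <;> ring
  entries := by
    by_cases h0 : 0 < n ∨ 1 ≤ (e : ℕ)
    -- The right end 2r + 2 is in range for r < n - 1 if d₃ = 2n, and for r < n if d₃ = 2n + 1; the
    -- inner condition compensates the truncated `n - 1` at n = 0.
    · refine (patternA_isLinkPattern e n h0).entries (m := n - 1 + if 1 ≤ (e : ℕ) then
        (if 0 < n then 1 else 0) else 0) ?_ ?_ ?_ <;> simp only [patternA] <;> split_ifs <;> omega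
    · obtain ⟨rfl, he⟩ : n = 0 ∧ (e : ℕ) = 0 := by omega
      obtain rfl : e = 0 := Fin.ext he
      simp [patternA, Pattern.entrySum]

theorem patternB_isTreeBrick (e : Fin 4) (n : ℕ) : Pattern.IsTreeBrick.{u} (patternB e n) where
  bit31 _ _ := bit_ite _
  bit32 _ _ := bit_ite _
  bit65 _ _ := bit_ite _
  bit75 _ _ := bit_ite _
  brick := patternB_isBrick e n
  root := by
    fin_cases e <;> simp [patternB] <;> ring
  entries := by
    refine (patternB_isLinkPattern e n).entries (m := n + if 1 ≤ (e : ℕ) then 1 else 0) ?_ ?_ ?_ <;>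
      simp only [patternB] <;> split_ifs <;> omega

theorem patternC_isTreeBrick {e e' : Fin 4} (h : e' < e) (n : ℕ) :
    Pattern.IsTreeBrick.{u} (patternC e e' n) where
  bit31 _ _ := bit_ite _
  bit32 _ _ := bit_ite _
  bit65 _ _ := bit_ite _
  bit75 _ _ := bit_ite _
  brick := patternC_isBrick h n
  root := by
    fin_cases e <;> fin_cases e' <;> first | (exact absurd h (by decide)) |
      (simp [patternC]; ring)
  entries := by
    have h' : (e' : ℕ) < e := h
    refine (patternC_isLinkPattern h n).entries (m := n + if 1 ≤ (e' : ℕ) then 1 else 0) ?_ ?_ ?_ <;>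
      simp only [patternC, rightIndex]
    · split_ifs <;> omega
    · intro r hr
      split_ifs <;> omega
    · split_ifs <;> omega

theorem Family.isTreeBrick (f : Family) (n : ℕ) : Pattern.IsTreeBrick.{u} (f.pattern n) := by
  rcases f with ⟨e, _ | _⟩ | ⟨e, _ | _⟩ | ⟨e, e', h⟩
  · exact patternA_isTreeBrick e n
  · exact (patternA_isTreeBrick e n).swap12
  · exact patternB_isTreeBrick e n
  · exact (patternB_isTreeBrick e n).swap67
  · exact patternC_isTreeBrick h n

end TreeBricks

/-! ### The exceptional regular representations are tree bricks -/

section RegularTreeBricks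

theorem Pattern.forall_dim {P : Pattern} {p : Vertex → ℕ → ℕ → Prop}
    (h1 : ∀ r < P.d1, ∀ c < P.d1, p .v1 r c) (h2 : ∀ r < P.d2, ∀ c < P.d2, p .v2 r c)
    (h3 : ∀ r < P.d3, ∀ c < P.d3, p .v3 r c) (h4 : ∀ r < P.d4, ∀ c < P.d4, p .v4 r c)
    (h5 : ∀ r < P.d5, ∀ c < P.d5, p .v5 r c) (h6 : ∀ r < P.d6, ∀ c < P.d6, p .v6 r c)
    (h7 : ∀ r < P.d7, ∀ c < P.d7, p .v7 r c) : ∀ i, ∀ r < P.dim i, ∀ c < P.dim i, p i r c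
  | .v1 => h1
  | .v2 => h2
  | .v3 => h3
  | .v4 => h4
  | .v5 => h5
  | .v6 => h6
  | .v7 => h7

/-- A finite check with matrices of size at most two. The two excluded triples have Euler form 2 and
0. -/
theorem patternW_isBrick (x y z : Bool) (h : y = true → x ≠ z) :
    Pattern.IsBrick.{u} (patternW x y z) := by
  intro k _ f hf
  have z3 : ∀ r c, (patternW x y z).d3 ≤ r ∨ (patternW x y z).d3 ≤ c → f .v3 r c = 0 := hf.zero .v3
  have z4 : ∀ r c, (patternW x y z).d4 ≤ r ∨ (patternW x y z).d4 ≤ c → f .v4 r c = 0 := hf.zero .v4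
  have z5 : ∀ r c, (patternW x y z).d5 ≤ r ∨ (patternW x y z).d5 ≤ c → f .v5 r c = 0 := hf.zero .v5
  have a0 := hf.comm31 0 Nat.one_pos 0
  have a1 := hf.comm31 0 Nat.one_pos 1
  have b0 := hf.comm32 0 Nat.one_pos 0
  have b1 := hf.comm32 0 Nat.one_pos 1
  have c0 := fun h h' => hf.comm43 0 h 0 h'
  have c1 := fun h h' => hf.comm43 0 h 1 h'
  have c2 := fun h h' => hf.comm43 1 h 0 h'
  have c3 := fun h h' => hf.comm43 1 h 1 h'
  have d0 := fun h h' => hf.comm54 0 h 0 h'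
  have d1 := fun h h' => hf.comm54 0 h 1 h'
  have d2 := fun h h' => hf.comm54 1 h 0 h'
  have d3 := fun h h' => hf.comm54 1 h 1 h'
  have e0 := fun h => hf.comm65 0 h 0 Nat.one_pos
  have e1 := fun h => hf.comm65 1 h 0 Nat.one_pos
  have g0 := fun h => hf.comm75 0 h 0 Nat.one_pos
  have g1 := fun h => hf.comm75 1 h 0 Nat.one_pos
  have z310 := z3 1 0
  have z301 := z3 0 1
  have z410 := z4 1 0
  have z401 := z4 0 1
  have z510 := z5 1 0
  have z501 := z5 0 1
  clear z3 z4 z5 hf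
  refine ⟨f .v3 0 0, ?_⟩
  rcases x with _ | _ <;> rcases y with _ | _ <;> rcases z with _ | _ <;>
    first
    | exact absurd rfl (h rfl)
    | skip
  all_goals
    simp [patternW, Finset.sum_range_succ] at a0 a1 b0 b1 c0 c1 c2 c3 d0 d1 d2 d3 e0 e1 g0 g1 z310 z301 z410 z401 z510 z501
    apply Pattern.forall_dim <;> intro r hr c hc <;>
      simp only [patternW, Bool.toNat_false, Bool.toNat_true, Nat.reduceAdd] at hr hc <;>
      interval_cases r <;> interval_cases c <;> grind

theorem patternW_isTreeBrick (x y z : Bool) (h : y = true → x ≠ z) :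
    Pattern.IsTreeBrick.{u} (patternW x y z) where
  bit31 := fun r c => bit_ite _
  bit32 := fun r c => Or.inr rfl
  bit65 := fun r c => bit_ite _
  bit75 := fun r c => Or.inr rfl
  brick := patternW_isBrick x y z h
  root := by revert h; revert x y z; decide
  entries := by revert h; revert x y z; decide

theorem patternI_isBrick (a b : Fin 3) (h : a ≤ b) : Pattern.IsBrick.{u} (patternI a b) := by
  intro k _ f hf
  have c0 := fun h h' => hf.comm43 0 h 0 h'
  have d0 := fun h h' => hf.comm54 0 h 0 h'
  -- The scalar is read off at the vertex 3 + a, where the representation is nonzero.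
  refine ⟨if a = 0 then f .v3 0 0 else if a = 1 then f .v4 0 0 else f .v5 0 0, ?_⟩
  fin_cases a <;> fin_cases b <;>
    first
    | exact absurd h (by decide)
    | skip
  all_goals
    simp [patternI] at c0 d0
    apply Pattern.forall_dim <;> intro r hr c hc <;> simp [patternI] at hr hc <;> simp [hr, hc]
  all_goals grind

theorem patternI_isTreeBrick (a b : Fin 3) (h : a ≤ b) :
    Pattern.IsTreeBrick.{u} (patternI a b) where
  bit31 := fun r c => Or.inr rfl
  bit32 := fun r c => Or.inr rfl
  bit65 := fun r c => Or.inr rfl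
  bit75 := fun r c => Or.inr rfl
  brick := patternI_isBrick a b h
  root := by revert h; revert a b; decide
  entries := by revert h; revert a b; decide

theorem patternT_isTreeBrick : Pattern.IsTreeBrick.{u} patternT where
  bit31 := fun r c => Or.inr rfl
  bit32 := fun r c => Or.inr rfl
  bit65 := fun r c => Or.inr rfl
  bit75 := fun r c => Or.inr rfl
  brick := by
    intro k _ f hf
    have a0 := hf.comm31 0 Nat.one_pos 0 Nat.one_pos
    have c0 := hf.comm43 0 Nat.one_pos 0 Nat.one_pos
    have d0 := hf.comm54 0 Nat.one_pos 0 Nat.one_pos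
    have e0 := hf.comm65 0 Nat.one_pos 0 Nat.one_pos
    simp [patternT] at a0 c0 d0 e0
    refine ⟨f .v3 0 0, Pattern.forall_dim ?_ ?_ ?_ ?_ ?_ ?_ ?_⟩ <;> intro r hr c hc <;>
      simp [patternT] at hr hc <;> simp [hr, hc] <;> grind
  root := by decide
  entries := by decide

theorem Regular.isTreeBrick : ∀ r : Regular, Pattern.IsTreeBrick.{u} r.pattern
  | .i a b h => patternI_isTreeBrick a b h
  | .t false false => patternT_isTreeBrick
  | .t true false => patternT_isTreeBrick.swap12
  | .t false true => patternT_isTreeBrick.swap67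
  | .t true true => patternT_isTreeBrick.swap12.swap67
  | .w x y z h => patternW_isTreeBrick x y z h

end RegularTreeBricks

/-- The patterns of the list. -/
def Label.pattern : Label → Pattern
  | .preprojective f n => f.pattern n
  | .preinjective f n => (f.pattern n).transpose
  | .regular r => r.pattern

theorem treeList_eq : ∀ x : Label, treeList x = x.pattern.toMatrixRep
  | .preprojective _ _ => rfl
  | .preinjective _ _ => rfl
  | .regular _ => rfl

theorem Label.isTreeBrick : ∀ x : Label, Pattern.IsTreeBrick.{u} x.pattern
  | .preprojective f n => f.isTreeBrick n
  | .preinjective f n => (f.isTreeBrick n).transpose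
  | .regular r => r.isTreeBrick

section Extensions

variable {k : Type u} [Field k]

/-! ## Vanishing of extensions -/

theorem exists_comp_eq_of_bijective {U V W : Type*} [AddCommGroup U] [AddCommGroup V]
    [AddCommGroup W] [Module k U] [Module k V] [Module k W] {g : V →ₗ[k] W}
    (hg : Function.Bijective g) (f : U →ₗ[k] W) : ∃ h : U →ₗ[k] V, g ∘ₗ h = f := by
  refine ⟨(LinearEquiv.ofBijective g hg).symm ∘ₗ f, LinearMap.ext fun x => ?_⟩
  exact (LinearEquiv.ofBijective g hg).apply_symm_apply (f x)

theorem exists_comp_eq_of_injective {U V W : Type*} [AddCommGroup U] [AddCommGroup V]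
    [AddCommGroup W] [Module k U] [Module k V] [Module k W] {p : U →ₗ[k] V}
    (hp : Function.Injective p) (f : U →ₗ[k] W) : ∃ h : V →ₗ[k] W, h ∘ₗ p = f := by
  obtain ⟨s, hs⟩ := LinearMap.exists_leftInverse_of_injective p (LinearMap.ker_eq_bot.2 hp)
  exact ⟨f ∘ₗ s, by rw [LinearMap.comp_assoc, hs, LinearMap.comp_id]⟩

/-- Extensions of `N` by a representation `X` which is supported on the path from `b` to `a`, with
bijective maps along this path, are controlled by the path from `c` to `a`, where `{b, c}` are the
two sources of the quiver. -/
theorem extVanish_of_path_injective {N : QuiverRep.{u, v, 0} k Vertex}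
    {X : QuiverRep.{u, v', 0} k Vertex} {a b c : Vertex} (α : Arrow .v3 a) (β : Arrow b .v5)
    (γ : Arrow c .v5) (hbc : b ≠ c)
    (hα : Function.Bijective (X.map (show Vertex.v3 ⟶ a from α)))
    (h43 : Function.Bijective (X.map (show Vertex.v4 ⟶ .v3 from .a43)))
    (h54 : Function.Bijective (X.map (show Vertex.v5 ⟶ .v4 from .a54)))
    (hβ : Function.Bijective (X.map (show b ⟶ .v5 from β)))
    (h0 : ∀ a', Arrow .v3 a' → a' ≠ a → Subsingleton (X.space a'))
    (hN : Function.Injective (N.map (show Vertex.v3 ⟶ a from α) ∘ₗ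
      N.map (show Vertex.v4 ⟶ .v3 from .a43) ∘ₗ N.map (show Vertex.v5 ⟶ .v4 from .a54) ∘ₗ
        N.map (show c ⟶ .v5 from γ))) : QuiverRep.ExtVanish N X := by
  intro x
  -- The equations at α, 4 → 3 and 5 → 4 are solved successively with zero at vertex a. Only the
  -- arrow γ, from whose source X receives no component, remains.
  obtain ⟨u3, hu3⟩ := exists_comp_eq_of_bijective hα (x _ _ α)
  obtain ⟨u4, hu4⟩ := exists_comp_eq_of_bijective h43
    (x _ _ Arrow.a43 + u3 ∘ₗ N.map (show Vertex.v4 ⟶ .v3 from .a43))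
  obtain ⟨u5, hu5⟩ := exists_comp_eq_of_bijective h54
    (x _ _ Arrow.a54 + u4 ∘ₗ N.map (show Vertex.v5 ⟶ .v4 from .a54))
  -- A nonzero component at a changes `u5` by `w5` composed with the path of N from 5 to a.
  -- Injectivity of the path from c lets this correct the equation at γ. In homological terms, X
  -- embeds into the injective I(a) with cokernel I(c).
  obtain ⟨w5, hw5⟩ := exists_comp_eq_of_injective hN
    (-(x _ _ γ) - u5 ∘ₗ N.map (show c ⟶ .v5 from γ))
  let ha := X.map (show Vertex.v3 ⟶ a from α) ∘ₗ X.map (show Vertex.v4 ⟶ .v3 from .a43) ∘ₗ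
    X.map (show Vertex.v5 ⟶ .v4 from .a54) ∘ₗ w5
  let h3 := u3 + X.map (show Vertex.v4 ⟶ .v3 from .a43) ∘ₗ
    X.map (show Vertex.v5 ⟶ .v4 from .a54) ∘ₗ w5 ∘ₗ N.map (show Vertex.v3 ⟶ a from α)
  let h4 := u4 + X.map (show Vertex.v5 ⟶ .v4 from .a54) ∘ₗ w5 ∘ₗ
    N.map (show Vertex.v3 ⟶ a from α) ∘ₗ N.map (show Vertex.v4 ⟶ .v3 from .a43)
  let h5 := u5 + w5 ∘ₗ N.map (show Vertex.v3 ⟶ a from α) ∘ₗ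
    N.map (show Vertex.v4 ⟶ .v3 from .a43) ∘ₗ N.map (show Vertex.v5 ⟶ .v4 from .a54)
  obtain ⟨hb, hhb⟩ := exists_comp_eq_of_bijective hβ
    (x _ _ β + h5 ∘ₗ N.map (show b ⟶ .v5 from β))
  have e1 : X.map (show Vertex.v3 ⟶ a from α) ∘ₗ h3 -
      ha ∘ₗ N.map (show Vertex.v3 ⟶ a from α) = x _ _ α := by
    simp only [h3, ha, LinearMap.comp_add, hu3, LinearMap.comp_assoc, add_sub_cancel_right]
  have e2 : X.map (show Vertex.v4 ⟶ .v3 from .a43) ∘ₗ h4 -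
      h3 ∘ₗ N.map (show Vertex.v4 ⟶ .v3 from .a43) = x _ _ Arrow.a43 := by
    simp only [h3, h4, LinearMap.comp_add, LinearMap.add_comp, hu4, LinearMap.comp_assoc]
    abel
  have e3 : X.map (show Vertex.v5 ⟶ .v4 from .a54) ∘ₗ h5 -
      h4 ∘ₗ N.map (show Vertex.v5 ⟶ .v4 from .a54) = x _ _ Arrow.a54 := by
    simp only [h4, h5, LinearMap.comp_add, LinearMap.add_comp, hu5, LinearMap.comp_assoc]
    abel
  have e4 : X.map (show b ⟶ .v5 from β) ∘ₗ hb - h5 ∘ₗ N.map (show b ⟶ .v5 from β) = x _ _ β := by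
    rw [hhb, add_sub_cancel_right]
  have e5 : X.map (show c ⟶ .v5 from γ) ∘ₗ 0 - h5 ∘ₗ N.map (show c ⟶ .v5 from γ) = x _ _ γ := by
    simp only [h5, LinearMap.add_comp, LinearMap.comp_assoc, LinearMap.comp_zero]
    rw [hw5]
    abel
  clear_value ha h3 h4 h5
  clear hN hw5 hu3 hu4 hu5 hhb hα h43 h54 hβ w5
  cases α <;> cases β <;> cases γ <;> first
    | exact absurd rfl hbc
    | skip
  · have := h0 _ .a32 (by decide)
    refine ⟨fun
      | .v1 => ha | .v2 => 0 | .v3 => h3 | .v4 => h4 | .v5 => h5 | .v6 => hb | .v7 => 0, ?_⟩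
    funext i j (δ : Arrow i j)
    cases δ
    exacts [e1, LinearMap.ext fun _ => Subsingleton.elim _ _, e2, e3, e4, e5]
  · have := h0 _ .a32 (by decide)
    refine ⟨fun
      | .v1 => ha | .v2 => 0 | .v3 => h3 | .v4 => h4 | .v5 => h5 | .v7 => hb | .v6 => 0, ?_⟩
    funext i j (δ : Arrow i j)
    cases δ
    exacts [e1, LinearMap.ext fun _ => Subsingleton.elim _ _, e2, e3, e5, e4]
  · have := h0 _ .a31 (by decide)
    refine ⟨fun
      | .v2 => ha | .v1 => 0 | .v3 => h3 | .v4 => h4 | .v5 => h5 | .v6 => hb | .v7 => 0, ?_⟩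
    funext i j (δ : Arrow i j)
    cases δ
    exacts [LinearMap.ext fun _ => Subsingleton.elim _ _, e1, e2, e3, e4, e5]
  · have := h0 _ .a31 (by decide)
    refine ⟨fun
      | .v2 => ha | .v1 => 0 | .v3 => h3 | .v4 => h4 | .v5 => h5 | .v7 => hb | .v6 => 0, ?_⟩
    funext i j (δ : Arrow i j)
    cases δ
    exacts [LinearMap.ext fun _ => Subsingleton.elim _ _, e1, e2, e3, e5, e4]

namespace Pattern

theorem map_overField_apply (P : Pattern) {i j : Vertex} (α : Arrow i j)
    (x : Fin (P.dim i) → k) (r : Fin (P.dim j)) :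
    ((P.toMatrixRep.overField k).map (show i ⟶ j from α) : (Fin (P.dim i) → k) →ₗ[k] _) x r =
      ∑ s : Fin (P.dim i), (P.entry α r s : k) * x s := by
  change Matrix.toLin' ((P.toMatrixRep.mat (show i ⟶ j from α)).map (fun z : ℤ => (z : k))) x r = _
  rw [Matrix.toLin'_apply, Matrix.mulVec, dotProduct]
  simp only [Matrix.map_apply, toMatrixRep_mat]

theorem map_overField_bijective (P : Pattern) {i j : Vertex} (α : Arrow i j) (hi : P.dim i = 1)
    (hj : P.dim j = 1) (h : P.entry α 0 0 = 1) :
    Function.Bijective ((P.toMatrixRep.overField k).map (show i ⟶ j from α)) := by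
  have hinj : Function.Injective ((P.toMatrixRep.overField k).map (show i ⟶ j from α)) := by
    rw [injective_iff_map_eq_zero]
    intro (x : Fin (P.dim i) → k) hx
    have h1 := congrFun hx (⟨0, hj ▸ Nat.one_pos⟩ : Fin (P.dim j))
    have h2 := (P.map_overField_apply α x ⟨0, hj ▸ Nat.one_pos⟩).symm.trans h1
    have hu : Subsingleton (Fin (P.dim i)) := by rw [hi]; infer_instance
    rw [Fintype.sum_subsingleton _ (⟨0, hi ▸ Nat.one_pos⟩ : Fin (P.dim i)), h, Int.cast_one,
      one_mul] at h2
    funext s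
    rw [Subsingleton.elim s ⟨0, hi ▸ Nat.one_pos⟩]
    exact h2
  refine ⟨hinj, (LinearMap.injective_iff_surjective_of_finrank_eq_finrank ?_).1 hinj⟩
  have h1 := fun i => congrFun (dimVector_overField P.toMatrixRep k) i
  exact (h1 i).trans (hi.trans (hj.symm.trans (h1 j).symm))

/-- A sufficient condition on the matrices for the path from `c` to `a` to act injectively. -/
def PathInjective (P : Pattern) {a c : Vertex} (α : Arrow .v3 a) (γ : Arrow c .v5) : Prop :=
  P.dim c = 0 ∨ P.dim c = 1 ∧ 0 < P.dim a ∧ 0 < P.d3 ∧ 0 < P.d4 ∧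
    0 < P.d5 ∧ P.entry γ 0 0 = 1 ∧ P.entry α 0 0 = 1 ∧
    ((∀ s < P.d5, s ≠ 0 → P.entry γ s 0 = 0) ∨ ∀ s < P.d3, s ≠ 0 → P.entry α 0 s = 0)

theorem PathInjective.map_overField_injective {P : Pattern} {a c : Vertex} {α : Arrow .v3 a}
    {γ : Arrow c .v5} (h : P.PathInjective α γ) :
    Function.Injective ((P.toMatrixRep.overField k).map (show Vertex.v3 ⟶ a from α) ∘ₗ
      (P.toMatrixRep.overField k).map (show Vertex.v4 ⟶ .v3 from .a43) ∘ₗ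
      (P.toMatrixRep.overField k).map (show Vertex.v5 ⟶ .v4 from .a54) ∘ₗ
      (P.toMatrixRep.overField k).map (show c ⟶ .v5 from γ)) := by
  rw [injective_iff_map_eq_zero]
  intro (x : Fin (P.dim c) → k) hx
  rcases h with h | ⟨hc, ha, h3, h4, h5, hγ, hα, hs⟩
  · have : IsEmpty (Fin (P.dim c)) := by rw [h]; infer_instance
    exact Subsingleton.elim (α := Fin (P.dim c) → k) _ _
  have hu : Subsingleton (Fin (P.dim c)) := by rw [hc]; infer_instance
  let c0 : Fin (P.dim c) := ⟨0, hc ▸ Nat.one_pos⟩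
  let y5 : Fin (P.dim .v5) → k := (P.toMatrixRep.overField k).map (show c ⟶ .v5 from γ) x
  let y4 : Fin (P.dim .v4) → k :=
    (P.toMatrixRep.overField k).map (show Vertex.v5 ⟶ .v4 from .a54) y5
  let y3 : Fin (P.dim .v3) → k :=
    (P.toMatrixRep.overField k).map (show Vertex.v4 ⟶ .v3 from .a43) y4
  have e5 : ∀ r, y5 r = (P.entry γ r 0 : k) * x c0 := fun r =>
    (P.map_overField_apply γ x r).trans (Fintype.sum_subsingleton _ c0)
  have e4 : ∀ r, y4 r = ∑ s : Fin (P.dim .v5), ((if (r : ℕ) = s then 1 else 0 : ℤ) : k) * y5 s :=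
    fun r => P.map_overField_apply .a54 y5 r
  have e3 : ∀ r, y3 r = ∑ s : Fin (P.dim .v4), ((if (r : ℕ) = s then 1 else 0 : ℤ) : k) * y4 s :=
    fun r => P.map_overField_apply .a43 y4 r
  have e2 : ∑ s : Fin (P.dim .v3), (P.entry α 0 s : k) * y3 s = 0 :=
    (P.map_overField_apply α y3 ⟨0, ha⟩).symm.trans (congrFun hx (⟨0, ha⟩ : Fin (P.dim a)))
  have f4 : y4 ⟨0, h4⟩ = x c0 := by
    rw [e4, Finset.sum_eq_single ⟨0, h5⟩]
    · simp [e5, hγ]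
    · intro s _ hs
      have : (0 : ℕ) ≠ s := fun h => hs (Fin.ext h.symm)
      simp [this]
    · simp
  have f3 : y3 ⟨0, h3⟩ = x c0 := by
    rw [e3, Finset.sum_eq_single ⟨0, h4⟩]
    · simp [f4]
    · intro s _ hs
      have : (0 : ℕ) ≠ s := fun h => hs (Fin.ext h.symm)
      simp [this]
    · simp
  have f2 : x c0 = 0 := by
    rw [Finset.sum_eq_single ⟨0, h3⟩] at e2
    · simpa [hα, f3] using e2
    · intro s _ hs0
      have hs1 : (s : ℕ) ≠ 0 := fun h => hs0 (Fin.ext h)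
      -- Either the transported vector has no coordinate besides 0, or the row of α ignores the
      -- others.
      rcases hs with hs | hs
      · have : y3 s = 0 := by
          rw [e3]
          refine Finset.sum_eq_zero fun t _ => ?_
          split_ifs with hst
          · have : y4 t = 0 := by
              rw [e4]
              refine Finset.sum_eq_zero fun r _ => ?_
              split_ifs with htr
              · rw [e5, hs r r.2 (by omega)]
                simp
              · simp
            simp [this]
          · simp
        rw [this, mul_zero]
      · rw [hs s s.2 hs1, Int.cast_zero, zero_mul]
    · simp
  funext s
  rw [Subsingleton.elim s c0]
  exact f2

end Pattern

end Extensions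

/-! ### Extensions of regular representations by representations of dimension mδ -/

section TubeExtensions

variable {k : Type u} [Field k]

theorem Pattern.PathInjective.extVanish {P T : Pattern} {a b c : Vertex} {α : Arrow .v3 a}
    {γ : Arrow c .v5} (h : P.PathInjective α γ) (β : Arrow b .v5) (hbc : b ≠ c)
    (h3 : T.d3 = 1) (h4 : T.d4 = 1) (h5 : T.d5 = 1) (ha : T.dim a = 1) (hb : T.dim b = 1)
    (hα : T.entry α 0 0 = 1) (hβ : T.entry β 0 0 = 1)
    (h0 : ∀ a', Arrow .v3 a' → a' ≠ a → T.dim a' = 0) :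
    QuiverRep.ExtVanish (P.toMatrixRep.overField k) (T.toMatrixRep.overField k) :=
  extVanish_of_path_injective α β γ hbc (T.map_overField_bijective α h3 ha hα)
    (T.map_overField_bijective .a43 h4 h3 rfl) (T.map_overField_bijective .a54 h5 h4 rfl)
    (T.map_overField_bijective β hb h5 hβ)
    (fun a' α' ha' => by
      change Subsingleton (Fin (T.dim a') → k)
      rw [h0 a' α' ha']
      infer_instance)
    h.map_overField_injective

/-- The dimension vector that generates the radical of the Euler form. -/
def nullRoot : Vertex → ℕ
  | .v1 => 1
  | .v2 => 1
  | .v3 => 2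
  | .v4 => 2
  | .v5 => 2
  | .v6 => 1
  | .v7 => 1

/-- The vector δ splits in two ways into dimension vectors of path modules: from 6 to 1 and 7 to 2,
or from 6 to 2 and 7 to 1. These pairs are the quasi-simples of the two tubes of rank two, and the
extensions vanish for the pair whose path conditions hold. -/
theorem Pattern.exists_extVanish_of_pathInjective {P : Pattern}
    (h : P.PathInjective .a31 .a75 ∧ P.PathInjective .a32 .a65 ∨
      P.PathInjective .a32 .a75 ∧ P.PathInjective .a31 .a65) :
    ∃ Y : QuiverRep.{u, u, 0} k Vertex, Y.dimVector = nullRoot ∧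
      QuiverRep.ExtVanish (P.toMatrixRep.overField k) Y := by
  rcases h with ⟨h1, h2⟩ | ⟨h1, h2⟩
  · refine ⟨(patternT.toMatrixRep.overField k).prod
      (patternT.swap12.swap67.toMatrixRep.overField k), funext fun i => ?_,
      (h1.extVanish .a65 (by decide) rfl rfl rfl rfl rfl rfl rfl ?_).prod
        (h2.extVanish .a75 (by decide) rfl rfl rfl rfl rfl rfl rfl ?_)⟩
    · rw [QuiverRep.dimVector_prod, dimVector_overField, dimVector_overField]
      cases i <;> rfl
    all_goals
      intro a' α' ha'
      cases α'
      first | rfl | exact absurd rfl ha'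
      first | rfl | exact absurd rfl ha'
  · refine ⟨(patternT.swap12.toMatrixRep.overField k).prod
      (patternT.swap67.toMatrixRep.overField k), funext fun i => ?_,
      (h1.extVanish .a65 (by decide) rfl rfl rfl rfl rfl rfl rfl ?_).prod
        (h2.extVanish .a75 (by decide) rfl rfl rfl rfl rfl rfl rfl ?_)⟩
    · rw [QuiverRep.dimVector_prod, dimVector_overField, dimVector_overField]
      cases i <;> rfl
    all_goals
      intro a' α' ha'
      cases α'
      first | rfl | exact absurd rfl ha'
      first | rfl | exact absurd rfl ha'

/-- A path module uses the pair of the other tube of rank two; the modules of the remaining tube, of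
rank four, can use the first pair. -/
theorem Regular.pathInjective : ∀ r : Regular,
    r.pattern.PathInjective .a31 .a75 ∧ r.pattern.PathInjective .a32 .a65 ∨
      r.pattern.PathInjective .a32 .a75 ∧ r.pattern.PathInjective .a31 .a65
  | .i _ _ _ => Or.inl ⟨Or.inl rfl, Or.inl rfl⟩
  | .t false false => Or.inr ⟨Or.inl rfl, by right; decide⟩
  | .t true true => Or.inr ⟨by right; decide, Or.inl rfl⟩
  | .t true false => Or.inl ⟨Or.inl rfl, by right; decide⟩
  | .t false true => Or.inl ⟨by right; decide, Or.inl rfl⟩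
  | .w x y z _ => Or.inl (by
      constructor <;> right
      · revert x y z; decide
      · revert x y z; decide)

variable (k)

/-- The zero representation. -/
def zeroRep : QuiverRep.{u, u, 0} k Vertex where
  space _ := PUnit
  map _ := 0

theorem dimVector_zeroRep : (zeroRep k).dimVector = 0 :=
  funext fun _ => Module.finrank_zero_of_subsingleton (R := k) (M := PUnit.{u + 1})

theorem extVanish_zeroRep (N : QuiverRep.{u, v, 0} k Vertex) :
    QuiverRep.ExtVanish N (zeroRep k) := fun _ =>
  ⟨0, funext fun _ => funext fun _ => funext fun _ => LinearMap.ext fun _ =>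
    Subsingleton.elim (α := PUnit) _ _⟩

theorem Regular.exists_extVanish (r : Regular) (m : ℕ) :
    ∃ Y : QuiverRep.{u, u, 0} k Vertex, (∀ i, Y.dimVector i = m * nullRoot i) ∧
      QuiverRep.ExtVanish (r.pattern.toMatrixRep.overField k) Y := by
  induction m with
  | zero => exact ⟨zeroRep k, fun i => by simp [dimVector_zeroRep], extVanish_zeroRep k _⟩
  | succ m ih =>
    obtain ⟨Y, hY, hext⟩ := ih
    obtain ⟨Z, hZ, hext'⟩ := Pattern.exists_extVanish_of_pathInjective (k := k) r.pathInjective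
    refine ⟨Y.prod Z, fun i => ?_, hext.prod hext'⟩
    rw [QuiverRep.dimVector_prod, hY, hZ]
    ring

end TubeExtensions

/-! ## Real roots -/

/-- Coordinates of a dimension vector modulo `nullRoot`. -/
def signature (d : Vertex → ℕ) : Fin 6 → ℤ :=
  ![2 * d .v1 - d .v3, 2 * d .v2 - d .v3, 2 * d .v6 - d .v5, 2 * d .v7 - d .v5, d .v3 - d .v4,
    d .v4 - d .v5]

theorem signature_add_mul_nullRoot (d : Vertex → ℕ) (m : ℕ) :
    signature (fun i => d i + m * nullRoot i) = signature d := by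
  funext j
  fin_cases j <;> simp [signature, nullRoot] <;> ring

/-- Equal signatures mean a difference that is an integral multiple of δ; as `e` is not at least δ
in every coordinate, the multiple cannot be negative. -/
theorem exists_add_mul_nullRoot {d e : Vertex → ℕ} (h : signature d = signature e)
    (he : ∃ i, e i < nullRoot i) : ∃ m : ℕ, ∀ i, d i = e i + m * nullRoot i := by
  have h0 := congrFun h 0
  have h1 := congrFun h 1
  have h2 := congrFun h 2
  have h3 := congrFun h 3
  have h4 := congrFun h 4
  have h5 := congrFun h 5
  simp [signature] at h0 h1 h2 h3 h4 h5
  obtain ⟨i, hi⟩ := he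
  have hm : e .v1 ≤ d .v1 := by
    cases i <;> simp only [nullRoot] at hi <;> omega
  refine ⟨d .v1 - e .v1, fun j => ?_⟩
  cases j <;> simp only [nullRoot] <;> omega

def families : List Family :=
  [.a 0 false, .a 1 false, .a 2 false, .a 3 false, .a 0 true, .a 1 true, .a 2 true, .a 3 true,
    .b 0 false, .b 1 false, .b 2 false, .b 3 false, .b 0 true, .b 1 true, .b 2 true, .b 3 true,
    .c 1 0 (by decide), .c 2 0 (by decide), .c 3 0 (by decide), .c 2 1 (by decide),
    .c 3 1 (by decide), .c 3 2 (by decide)]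

theorem mem_families (f : Family) : f ∈ families := by
  rcases f with ⟨e, s⟩ | ⟨e, s⟩ | ⟨e, e', h⟩
  · fin_cases e <;> cases s <;> simp [families]
  · fin_cases e <;> cases s <;> simp [families]
  · fin_cases e <;> fin_cases e' <;> first | exact absurd h (by decide) | simp [families]

def regulars : List Regular :=
  [.i 0 0 (by decide), .i 0 1 (by decide), .i 0 2 (by decide), .i 1 1 (by decide),
    .i 1 2 (by decide), .i 2 2 (by decide), .t false false, .t false true, .t true false,
    .t true true, .w false false false (by decide), .w false false true (by decide),
    .w true false false (by decide), .w true false true (by decide),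
    .w false true true (by decide), .w true true false (by decide)]

theorem mem_regulars (r : Regular) : r ∈ regulars := by
  rcases r with ⟨a, b, h⟩ | ⟨s, s'⟩ | ⟨x, y, z, h⟩
  · fin_cases a <;> fin_cases b <;> first | exact absurd h (by decide) | simp [regulars]
  · cases s <;> cases s' <;> simp [regulars]
  · cases x <;> cases y <;> cases z <;> first | exact absurd h (by decide) | simp [regulars]

/-- The first members of the families, and the regular modules. -/
def baseLabels : List Label :=
  families.map (.preprojective · 0) ++ families.map (.preinjective · 0) ++ regulars.map .regular

def Label.base : Label → Label
  | .preprojective f _ => .preprojective f 0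
  | .preinjective f _ => .preinjective f 0
  | .regular r => .regular r

def Label.shift : Label → ℕ
  | .preprojective _ n => n
  | .preinjective _ n => n
  | .regular _ => 0

theorem Label.base_mem : ∀ x : Label, x.base ∈ baseLabels
  | .preprojective f _ => by simp [base, baseLabels, mem_families]
  | .preinjective f _ => by simp [base, baseLabels, mem_families]
  | .regular r => by simp [base, baseLabels, mem_regulars]

theorem Label.eq_of_base_eq {x y : Label} (h : x.base = y.base) (h' : x.shift = y.shift) :
    x = y := by
  cases x <;> cases y <;> simp_all [base, shift]

theorem Family.dim_pattern (f : Family) (n : ℕ) (i : Vertex) :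
    (f.pattern n).dim i = (f.pattern 0).dim i + n * nullRoot i := by
  rcases f with ⟨e, _ | _⟩ | ⟨e, _ | _⟩ | ⟨e, e', h⟩ <;> cases i <;>
    simp only [pattern, Pattern.dim, Pattern.toMatrixRep, patternA, patternB, patternC,
      Pattern.swap12, Pattern.swap67, nullRoot] <;> omega

theorem Label.dim_pattern (x : Label) (i : Vertex) :
    x.pattern.dim i = x.base.pattern.dim i + x.shift * nullRoot i := by
  cases x with
  | preprojective f n => exact f.dim_pattern n i
  | preinjective f n =>
    cases i
    · exact f.dim_pattern n .v6
    · exact f.dim_pattern n .v7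
    · exact f.dim_pattern n .v5
    · exact f.dim_pattern n .v4
    · exact f.dim_pattern n .v3
    · exact f.dim_pattern n .v1
    · exact f.dim_pattern n .v2
  | regular r => simp [shift, base]

/-- The 60 base labels represent the real roots modulo δ, that is, the roots of the finite root
system D₆. -/
theorem nodup_signature_baseLabels :
    (baseLabels.map fun x => signature x.pattern.dim).Nodup := by
  decide +kernel

theorem exists_dim_lt_nullRoot : ∀ x ∈ baseLabels, ∃ i, x.pattern.dim i < nullRoot i := by
  decide +kernel

/-- The bounds follow from the sum of squares, and the congruences hold for the signature of every
integral vector; together they leave only the 60 listed classes. -/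
theorem exists_signature : ∀ p ∈ [(-1 : ℤ), 0, 1], ∀ q ∈ [(-1 : ℤ), 0, 1],
    ∀ a ∈ [(-2 : ℤ), -1, 0, 1, 2], ∀ b ∈ [(-2 : ℤ), -1, 0, 1, 2],
    ∀ c ∈ [(-2 : ℤ), -1, 0, 1, 2], ∀ e ∈ [(-2 : ℤ), -1, 0, 1, 2],
    a * a + b * b + c * c + e * e + 2 * (p * p) + 2 * (q * q) = 4 →
    2 ∣ a - b → 2 ∣ c - e → 2 ∣ a - c - (p + q) →
    ∃ x ∈ baseLabels, ![a, b, c, e, p, q] = signature x.pattern.dim := by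
  decide +kernel

/-- The signature determines the base label; the coordinate at vertex 1, where δ is 1, then
determines the multiple of δ. -/
theorem Label.eq_of_dim_eq {x y : Label} (h : x.pattern.dim = y.pattern.dim) : x = y := by
  have hsig : ∀ z : Label, signature z.pattern.dim = signature z.base.pattern.dim := fun z => by
    rw [← signature_add_mul_nullRoot z.base.pattern.dim z.shift]
    exact congrArg _ (funext z.dim_pattern)
  have hb : x.base = y.base :=
    List.inj_on_of_nodup_map nodup_signature_baseLabels x.base_mem y.base_mem
      (by rw [← hsig, ← hsig, h])
  refine Label.eq_of_base_eq hb ?_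
  have h1 := x.dim_pattern .v1
  rw [h, y.dim_pattern .v1, hb] at h1
  simpa [nullRoot] using h1.symm

theorem mem_of_sq_le_four {a : ℤ} (h : a * a ≤ 4) : a ∈ [(-2 : ℤ), -1, 0, 1, 2] := by
  have h1 : -2 ≤ a := by nlinarith
  have h2 : a ≤ 2 := by nlinarith
  interval_cases a <;> decide

theorem mem_of_sq_le_two {a : ℤ} (h : a * a ≤ 2) : a ∈ [(-1 : ℤ), 0, 1] := by
  have h1 : -1 ≤ a := by nlinarith
  have h2 : a ≤ 1 := by nlinarith
  interval_cases a <;> decide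

/-- The dimension vectors with Euler form one are those of the list and the translates of those of
the regular modules by the multiples of `nullRoot`. -/
theorem exists_label_of_euler_eq_one {d : Vertex → ℕ}
    (hd : QuiverRep.eulerVertex d d = QuiverRep.eulerArrow d d + 1) :
    (∃ x : Label, d = x.pattern.dim) ∨
      ∃ (r : Regular) (m : ℕ), 0 < m ∧ ∀ i, d i = r.pattern.dim i + m * nullRoot i := by
  rw [eulerVertex_eq, eulerArrow_eq] at hd
  zify at hd
  -- Four times the quadratic form as a sum of squares of signature coordinates.
  have hq : (2 * d .v1 - d .v3 : ℤ) * (2 * d .v1 - d .v3) +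
      (2 * d .v2 - d .v3) * (2 * d .v2 - d .v3) + (2 * d .v6 - d .v5) * (2 * d .v6 - d .v5) +
      (2 * d .v7 - d .v5) * (2 * d .v7 - d .v5) + 2 * ((d .v3 - d .v4) * (d .v3 - d .v4)) +
      2 * ((d .v4 - d .v5) * (d .v4 - d .v5)) = 4 := by linear_combination 4 * hd
  have h1 := mul_self_nonneg (2 * d .v1 - d .v3 : ℤ)
  have h2 := mul_self_nonneg (2 * d .v2 - d .v3 : ℤ)
  have h3 := mul_self_nonneg (2 * d .v6 - d .v5 : ℤ)
  have h4 := mul_self_nonneg (2 * d .v7 - d .v5 : ℤ)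
  have h5 := mul_self_nonneg (d .v3 - d .v4 : ℤ)
  have h6 := mul_self_nonneg (d .v4 - d .v5 : ℤ)
  obtain ⟨x, hx, hsig⟩ := exists_signature _ (mem_of_sq_le_two (a := d .v3 - d .v4) (by linarith))
    _ (mem_of_sq_le_two (a := d .v4 - d .v5) (by linarith))
    _ (mem_of_sq_le_four (a := 2 * d .v1 - d .v3) (by linarith))
    _ (mem_of_sq_le_four (a := 2 * d .v2 - d .v3) (by linarith))
    _ (mem_of_sq_le_four (a := 2 * d .v6 - d .v5) (by linarith))
    _ (mem_of_sq_le_four (a := 2 * d .v7 - d .v5) (by linarith)) hq (by omega) (by omega) (by omega)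
  obtain ⟨m, hm⟩ := exists_add_mul_nullRoot (d := d) hsig (exists_dim_lt_nullRoot x hx)
  simp only [baseLabels, List.mem_append, List.mem_map] at hx
  rcases hx with (⟨f, -, rfl⟩ | ⟨f, -, rfl⟩) | ⟨r, -, rfl⟩
  · exact Or.inl ⟨.preprojective f m, funext fun i => by
      rw [hm, (Label.preprojective f m).dim_pattern]
      rfl⟩
  · exact Or.inl ⟨.preinjective f m, funext fun i => by
      rw [hm, (Label.preinjective f m).dim_pattern]
      rfl⟩
  · rcases m.eq_zero_or_pos with rfl | hpos
    · exact Or.inl ⟨.regular r, funext fun i => by rw [hm, Nat.zero_mul, Nat.add_zero]⟩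
    · exact Or.inr ⟨r, m, hpos, hm⟩

/-! ### Classification of the exceptional representations -/

theorem Regular.defect (r : Regular) :
    r.pattern.d1 + r.pattern.d2 = r.pattern.d6 + r.pattern.d7 := by
  rcases r with ⟨a, b, h⟩ | ⟨_ | _, _ | _⟩ | ⟨x, y, z, h⟩ <;> rfl

theorem Label.isExceptional_overField (x : Label) (k : Type u) [Field k] :
    (x.pattern.toMatrixRep.overField k).IsExceptional :=
  x.isTreeBrick.isExceptional_overField k

/-- A listed dimension vector is recognized with R = 0. A vector dim N + mδ with N regular and m > 0
is excluded: recognition would give M ≅ N. -/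
theorem exists_isIsomorphic_of_isExceptional {k : Type u} [Field k]
    {M : QuiverRep.{u, v, 0} k Vertex} (hM : M.IsExceptional) :
    ∃ x : Label, M.IsIsomorphic (x.pattern.toMatrixRep.overField k) := by
  have hMM := (QuiverRep.hasNoSelfExtensions_iff_extVanish M).1 hM.2
  rcases exists_label_of_euler_eq_one (hM.1.euler_of_extVanish hMM) with
    ⟨x, hx⟩ | ⟨r, m, hm, hd⟩
  · have hN := x.isExceptional_overField k
    refine ⟨x, QuiverRep.isIsomorphic_of_dimVector_eq hM.1 hMM hN.1
      ((QuiverRep.hasNoSelfExtensions_iff_extVanish _).1 hN.2) (extVanish_zeroRep k _)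
      (fun i => ?_) ?_ ?_⟩
    · rw [hx, Pattern.dimVector_overField, dimVector_zeroRep]
      rfl
    all_goals
      rw [hx, Pattern.dimVector_overField]
      exact (Nat.lt_succ_self _).trans_eq (Label.isTreeBrick.{u} x).euler.symm
  · have hN := (Label.regular r).isExceptional_overField k
    have hr := (Regular.isTreeBrick.{u} r).root
    have h0 := r.defect
    obtain ⟨Y, hY, hext⟩ := r.exists_extVanish k m
    have hiso : M.IsIsomorphic (r.pattern.toMatrixRep.overField k) := by
      refine QuiverRep.isIsomorphic_of_dimVector_eq hM.1 hMM hN.1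
        ((QuiverRep.hasNoSelfExtensions_iff_extVanish _).1 hN.2) hext (fun i => ?_) ?_ ?_
      · rw [hd, hY, Pattern.dimVector_overField]
      -- Pairing with δ on either side gives ± the defect d₁ + d₂ - d₆ - d₇, which is zero for N; so
      -- both Euler forms between M and N equal ⟨dim N, dim N⟩ = 1.
      all_goals
        rw [eulerVertex_eq, eulerArrow_eq, Pattern.dimVector_overField]
        simp only [hd, nullRoot, Pattern.dim, Pattern.toMatrixRep]
        zify at hr h0 ⊢
      · linear_combination -hr + m * h0
      · linear_combination -hr - m * h0
    have h1 := congrFun hiso.dimVector_eq .v1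
    rw [hd, Pattern.dimVector_overField] at h1
    simp [nullRoot] at h1
    omega

end D6

theorem mainTheorem2 :
    (∀ x : D6.Label, (D6.treeList x).HasFieldIndependentTreeProperty.{u, 0}) ∧
    (∀ (k : Type u) [Field k] (M : QuiverRep.{u, v, 0} k D6.Vertex), M.IsExceptional →
      ∃! x : D6.Label, M.IsIsomorphic ((D6.treeList x).overField k)) := by
  refine ⟨fun x => ?_, fun k _ M hM => ?_⟩
  · rw [D6.treeList_eq]
    exact x.isTreeBrick.hasFieldIndependentTreeProperty
  · obtain ⟨x, hx⟩ := D6.exists_isIsomorphic_of_isExceptional hM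
    refine ⟨x, ?_, fun y hy => D6.Label.eq_of_dim_eq ?_⟩
    · change M.IsIsomorphic _
      rwa [D6.treeList_eq]
    · change M.IsIsomorphic _ at hy
      rw [D6.treeList_eq] at hy
      have h := hy.dimVector_eq.symm.trans hx.dimVector_eq
      rwa [D6.Pattern.dimVector_overField, D6.Pattern.dimVector_overField] at h
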